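/- Proposition P1. Let $X$ be a smooth manifold of dimension $n$ (Hausdorff, second countable, without boundary) and let $\Omega\subset X$ be a relatively compact domain (connected open set) with smooth boundary $b\Omega$, that is, near each of its boundary points $\Omega$ is $\{\rho<0\}$ for a smooth function $\rho$ with non-zero differential at that point. For $F=X$, $F=X\setminus\Omega$ or $F=b\Omega$ let $H^j(F)$ be the $j$-th de Rham cohomology group of $F$ with real coefficients, computed with the smooth forms on $F$ (forms smooth up to the boundary when $F=X\setminus\Omega$, forms on the hypersurface when $F=b\Omega$). Assume that $H^j(b\Omega)=0$ for $1\le j\le n-2$. If $\Omega$ is contractible, then for every $j$ with $1<j\le n-2$ the restriction map $H^j(X)\to H^j(X\setminus\Omega)$ is an isomorphism. -/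

import Mathlib

open scoped Manifold ContDiff Topology

/-- The representative `(e⁻¹)^* α` in a chart `e` of a family `α` of alternating forms on the
tangent spaces of `X`; it is meaningful on `e.target`. -/
noncomputable def localRep {n p : ℕ} {X : Type*} [TopologicalSpace X]
    [ChartedSpace (EuclideanSpace ℝ (Fin n)) X]
    (e : OpenPartialHomeomorph X (EuclideanSpace ℝ (Fin n)))
    (α : (x : X) → TangentSpace (𝓡 n) x [⋀^Fin p]→L[ℝ] ℝ)
    (y : EuclideanSpace ℝ (Fin n)) : EuclideanSpace ℝ (Fin n) [⋀^Fin p]→L[ℝ] ℝ :=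
  (α (e.symm y)).compContinuousLinearMap (mfderiv (𝓡 n) (𝓡 n) e.symm y)

theorem localRep_add {n p : ℕ} {X : Type*} [TopologicalSpace X]
    [ChartedSpace (EuclideanSpace ℝ (Fin n)) X]
    (e : OpenPartialHomeomorph X (EuclideanSpace ℝ (Fin n)))
    (α η : (x : X) → TangentSpace (𝓡 n) x [⋀^Fin p]→L[ℝ] ℝ) :
    localRep e (α + η) = localRep e α + localRep e η := rfl

theorem localRep_smul {n p : ℕ} {X : Type*} [TopologicalSpace X]
    [ChartedSpace (EuclideanSpace ℝ (Fin n)) X]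
    (e : OpenPartialHomeomorph X (EuclideanSpace ℝ (Fin n))) (c : ℝ)
    (α : (x : X) → TangentSpace (𝓡 n) x [⋀^Fin p]→L[ℝ] ℝ) :
    localRep e (c • α) = c • localRep e α := rfl

/-- The space `Λ^p(X)` of smooth differential `p`-forms on the `n`-dimensional manifold `X`:
families of alternating forms on the tangent spaces that are smooth in every chart. -/
def SmoothForm (n : ℕ) (X : Type*) [TopologicalSpace X]
    [ChartedSpace (EuclideanSpace ℝ (Fin n)) X] (p : ℕ) :
    Submodule ℝ ((x : X) → TangentSpace (𝓡 n) x [⋀^Fin p]→L[ℝ] ℝ) where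
  carrier := {α | ∀ e ∈ atlas (EuclideanSpace ℝ (Fin n)) X, ContDiffOn ℝ ∞ (localRep e α) e.target}
  zero_mem' := fun e _ => by
    have h : localRep e (0 : (x : X) → TangentSpace (𝓡 n) x [⋀^Fin p]→L[ℝ] ℝ) = fun _ => 0 := rfl
    rw [h]
    exact contDiffOn_const
  add_mem' := fun {α η} hα hη e he => by
    rw [localRep_add]
    exact (hα e he).add (hη e he)
  smul_mem' := fun c α hα e he => by
    rw [localRep_smul]
    exact contDiffOn_const.smul (hα e he)

noncomputable instance {n : ℕ} {X : Type*} [TopologicalSpace X]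
    [ChartedSpace (EuclideanSpace ℝ (Fin n)) X] {p : ℕ} : AddCommGroup (SmoothForm n X p) :=
  Submodule.addCommGroup _

noncomputable instance {n : ℕ} {X : Type*} [TopologicalSpace X]
    [ChartedSpace (EuclideanSpace ℝ (Fin n)) X] {p : ℕ} : Module ℝ (SmoothForm n X p) :=
  Submodule.module _

/-- The exterior derivative at `x`, computed in the preferred chart at `x`. -/
noncomputable def extDerivAt {n p : ℕ} {X : Type*} [TopologicalSpace X]
    [ChartedSpace (EuclideanSpace ℝ (Fin n)) X]
    (α : (x : X) → TangentSpace (𝓡 n) x [⋀^Fin p]→L[ℝ] ℝ) (x : X) :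
    TangentSpace (𝓡 n) x [⋀^Fin (p + 1)]→L[ℝ] ℝ :=
  (extDeriv (localRep (chartAt (EuclideanSpace ℝ (Fin n)) x) α)
    (chartAt (EuclideanSpace ℝ (Fin n)) x x)).compContinuousLinearMap
      (mfderiv (𝓡 n) (𝓡 n) (chartAt (EuclideanSpace ℝ (Fin n)) x) x)

/-- A chart change acts on representatives by pull-back. -/
theorem localRep_eq_pullback {n p : ℕ} {X : Type*} [TopologicalSpace X]
    [ChartedSpace (EuclideanSpace ℝ (Fin n)) X] [IsManifold (𝓡 n) ∞ X]
    (α : (x : X) → TangentSpace (𝓡 n) x [⋀^Fin p]→L[ℝ] ℝ)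
    {e f : OpenPartialHomeomorph X (EuclideanSpace ℝ (Fin n))}
    (he : e ∈ atlas (EuclideanSpace ℝ (Fin n)) X) (hf : f ∈ atlas (EuclideanSpace ℝ (Fin n)) X)
    {y : EuclideanSpace ℝ (Fin n)} (hy : y ∈ (e.symm.trans f).source) :
    mfderiv (𝓡 n) (𝓡 n) f (e.symm y) ∘L mfderiv (𝓡 n) (𝓡 n) e.symm y = fderiv ℝ (f ∘ e.symm) y ∧
    localRep e α y =
      (localRep f α ((f ∘ e.symm) y)).compContinuousLinearMap (fderiv ℝ (f ∘ e.symm) y) := by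
  have hy1 : y ∈ e.target := by simpa using hy.1
  have hy2 : e.symm y ∈ f.source := by simpa using hy.2
  have hE : MDifferentiableAt (𝓡 n) (𝓡 n) e.symm y :=
    mdifferentiableAt_atlas_symm (I := 𝓡 n) he hy1
  have hF : MDifferentiableAt (𝓡 n) (𝓡 n) f (e.symm y) :=
    mdifferentiableAt_atlas (I := 𝓡 n) hf hy2
  have hF' : MDifferentiableAt (𝓡 n) (𝓡 n) f.symm (f (e.symm y)) :=
    mdifferentiableAt_atlas_symm (I := 𝓡 n) hf (f.map_source hy2)
  have h1 : mfderiv (𝓡 n) (𝓡 n) f (e.symm y) ∘L mfderiv (𝓡 n) (𝓡 n) e.symm y =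
      fderiv ℝ (f ∘ e.symm) y := by
    rw [← mfderiv_eq_fderiv]
    exact (mfderiv_comp y hF hE).symm
  refine ⟨h1, ?_⟩
  have h2 : mfderiv (𝓡 n) (𝓡 n) f.symm (f (e.symm y)) ∘L mfderiv (𝓡 n) (𝓡 n) f (e.symm y) =
      ContinuousLinearMap.id ℝ (TangentSpace (𝓡 n) (e.symm y)) := by
    rw [← mfderiv_comp (e.symm y) hF' hF, ← mfderiv_id]
    apply Filter.EventuallyEq.mfderiv_eq
    filter_upwards [f.open_source.mem_nhds hy2] with z hz using f.left_inv hz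
  have h3 : f.symm ((f ∘ e.symm) y) = e.symm y := f.left_inv hy2
  have h4 : ∀ z : X, z = e.symm y →
      (α z : EuclideanSpace ℝ (Fin n) [⋀^Fin p]→L[ℝ] ℝ) = α (e.symm y) := by
    rintro z rfl; rfl
  ext v
  change α (e.symm y) (fun i => mfderiv (𝓡 n) (𝓡 n) e.symm y (v i)) =
    (α (f.symm ((f ∘ e.symm) y)) : EuclideanSpace ℝ (Fin n) [⋀^Fin p]→L[ℝ] ℝ)
      (fun i => mfderiv (𝓡 n) (𝓡 n) f.symm (f (e.symm y)) (fderiv ℝ (f ∘ e.symm) y (v i)))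
  rw [h4 _ h3, ← h1]
  congr 1
  funext i
  exact (DFunLike.congr_fun h2 (mfderiv (𝓡 n) (𝓡 n) e.symm y (v i))).symm

/-- The exterior derivative has the expected representative in every chart. -/
theorem localRep_extDerivAt {n p : ℕ} {X : Type*} [TopologicalSpace X]
    [ChartedSpace (EuclideanSpace ℝ (Fin n)) X] [IsManifold (𝓡 n) ∞ X]
    {α : (x : X) → TangentSpace (𝓡 n) x [⋀^Fin p]→L[ℝ] ℝ} (hα : α ∈ SmoothForm n X p)
    {e : OpenPartialHomeomorph X (EuclideanSpace ℝ (Fin n))}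
    (he : e ∈ atlas (EuclideanSpace ℝ (Fin n)) X)
    {y : EuclideanSpace ℝ (Fin n)} (hy : y ∈ e.target) :
    localRep e (extDerivAt α) y = extDeriv (localRep e α) y := by
  set f := chartAt (EuclideanSpace ℝ (Fin n)) (e.symm y) with hf_def
  have hf : f ∈ atlas (EuclideanSpace ℝ (Fin n)) X := chart_mem_atlas _ _
  have hyf : e.symm y ∈ f.source := mem_chart_source _ _
  have hys : y ∈ (e.symm.trans f).source := by simpa using ⟨hy, hyf⟩
  have hev : localRep e α =ᶠ[𝓝 y] fun z =>
      (localRep f α ((f ∘ e.symm) z)).compContinuousLinearMap (fderiv ℝ (f ∘ e.symm) z) := by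
    filter_upwards [(e.symm.trans f).open_source.mem_nhds hys] with z hz
      using (localRep_eq_pullback α he hf hz).2
  have hd : DifferentiableAt ℝ (localRep f α) ((f ∘ e.symm) y) :=
    ((hα f hf).contDiffAt (f.open_target.mem_nhds (f.map_source hyf))).differentiableAt (by simp)
  have hs : ContDiffAt ℝ ∞ (f ∘ e.symm) y := by
    have h := (contDiffGroupoid ∞ (𝓡 n)).compatible he hf
    rw [contDiffGroupoid, mem_groupoid_of_pregroupoid] at h
    have h' : ContDiffOn ℝ ∞ (f ∘ e.symm) (e.symm.trans f).source := by
      simpa [contDiffPregroupoid] using h.1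
    exact h'.contDiffAt ((e.symm.trans f).open_source.mem_nhds hys)
  rw [hev.extDeriv_eq, extDeriv_pullback hd hs 
    (by simpa using (WithTop.coe_le_coe.2 le_top : ((2 : ℕ∞) : WithTop ℕ∞) ≤ ∞)), ← (localRep_eq_pullback α he hf hys).1]
  rfl

theorem differentiableAt_localRep {n p : ℕ} {X : Type*} [TopologicalSpace X]
    [ChartedSpace (EuclideanSpace ℝ (Fin n)) X]
    {α : (x : X) → TangentSpace (𝓡 n) x [⋀^Fin p]→L[ℝ] ℝ} (hα : α ∈ SmoothForm n X p) (x : X) :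
    DifferentiableAt ℝ (localRep (chartAt (EuclideanSpace ℝ (Fin n)) x) α)
      (chartAt (EuclideanSpace ℝ (Fin n)) x x) :=
  ((hα _ (chart_mem_atlas _ x)).contDiffAt ((chartAt _ x).open_target.mem_nhds
    (mem_chart_target _ x))).differentiableAt (by simp)

/-- The exterior derivative `d : Λ^p(X) → Λ^(p+1)(X)`. -/
noncomputable def extD (n : ℕ) (X : Type*) [TopologicalSpace X]
    [ChartedSpace (EuclideanSpace ℝ (Fin n)) X] [IsManifold (𝓡 n) ∞ X] (p : ℕ) :
    SmoothForm n X p →ₗ[ℝ] SmoothForm n X (p + 1) where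
  toFun α := ⟨extDerivAt α.1, fun e he => by
    have h : ContDiffOn ℝ ∞ (extDeriv (localRep e α.1)) e.target := by
      have h1 : ContDiffOn ℝ ∞ (fderiv ℝ (localRep e α.1)) e.target :=
        (α.2 e he).fderiv_of_isOpen e.open_target (by simp)
      exact (ContinuousAlternatingMap.alternatizeUncurryFinCLM ℝ (EuclideanSpace ℝ (Fin n))
        ℝ).contDiff.comp_contDiffOn h1
    exact h.congr fun y hy => localRep_extDerivAt α.2 he hy⟩
  map_add' α β := by
    ext1
    funext x
    change extDerivAt (α.1 + β.1) x = extDerivAt α.1 x + extDerivAt β.1 x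
    simp only [extDerivAt]
    rw [localRep_add,
      extDeriv_add (differentiableAt_localRep α.2 x) (differentiableAt_localRep β.2 x)]
    rfl
  map_smul' c α := by
    ext1
    funext x
    change extDerivAt (c • α.1) x = c • extDerivAt α.1 x
    simp only [extDerivAt]
    rw [localRep_smul, extDeriv_smul]
    rfl

theorem extD_extD {n : ℕ} {X : Type*} [TopologicalSpace X]
    [ChartedSpace (EuclideanSpace ℝ (Fin n)) X] [IsManifold (𝓡 n) ∞ X] {p : ℕ}
    (α : SmoothForm n X p) : extD n X (p + 1) (extD n X p α) = 0 := by
  ext1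
  funext x
  set f := chartAt (EuclideanSpace ℝ (Fin n)) x with hf
  have hfx : f x ∈ f.target := mem_chart_target _ x
  have h1 : localRep f (extDerivAt α.1) =ᶠ[𝓝 (f x)] extDeriv (localRep f α.1) := by
    filter_upwards [f.open_target.mem_nhds hfx] with y hy
      using localRep_extDerivAt α.2 (chart_mem_atlas _ x) hy
  change extDerivAt (extDerivAt α.1) x = 0
  rw [extDerivAt, ← hf, h1.extDeriv_eq, extDeriv_extDeriv_apply (r := ∞)
    ((α.2 f (chart_mem_atlas _ x)).contDiffAt (f.open_target.mem_nhds hfx))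
    
    (by simpa using (WithTop.coe_le_coe.2 le_top : ((2 : ℕ∞) : WithTop ℕ∞) ≤ ∞))]
  rfl

/-- The tangent space at `x` of a subset `F` of the manifold `X`: the span of the tangent
directions to `F` at `x`, read in the preferred chart at `x` (through which Mathlib identifies
`TangentSpace (𝓡 n) x` with `ℝⁿ`). For a closed domain with smooth boundary it is all of `T_x X`,
for a smooth hypersurface it is the tangent hyperplane. -/
noncomputable def tangentSpaceOf (n : ℕ) {X : Type*} [TopologicalSpace X]
    [ChartedSpace (EuclideanSpace ℝ (Fin n)) X] (F : Set X) (x : X) :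
    Submodule ℝ (TangentSpace (𝓡 n) x) :=
  Submodule.span ℝ (tangentConeAt ℝ
    ((chartAt (EuclideanSpace ℝ (Fin n)) x).target ∩
      (chartAt (EuclideanSpace ℝ (Fin n)) x).symm ⁻¹' F)
    (chartAt (EuclideanSpace ℝ (Fin n)) x x) : Set (EuclideanSpace ℝ (Fin n)))

theorem tangentSpaceOf_univ (n : ℕ) {X : Type*} [TopologicalSpace X]
    [ChartedSpace (EuclideanSpace ℝ (Fin n)) X] (x : X) :
    tangentSpaceOf n (Set.univ : Set X) x = ⊤ := by
  have h := (chartAt (EuclideanSpace ℝ (Fin n)) x).open_target.mem_nhds (mem_chart_target _ x)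
  simp only [tangentSpaceOf, Set.preimage_univ, Set.inter_univ]
  rw [tangentConeAt_of_mem_nhds h]
  exact Submodule.span_univ

/-- The smooth `p`-forms on `X` whose restriction to `F` is zero, where the restriction of `α`
to `F` is the family of the alternating forms `α_x` on `T_x F`, `x ∈ F`. The space of smooth
`p`-forms on a closed domain with smooth boundary, or on a closed smooth hypersurface, is
`Λ^p(F) = Λ^p(X) / vanishingOn F`: each smooth form on `F` is the restriction of one on `X`. -/
def vanishingOn {n : ℕ} {X : Type*} [TopologicalSpace X]
    [ChartedSpace (EuclideanSpace ℝ (Fin n)) X] (F : Set X) (p : ℕ) :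
    Submodule ℝ (SmoothForm n X p) where
  carrier := {α | ∀ x ∈ F, ∀ v : Fin p → TangentSpace (𝓡 n) x,
    (∀ i, v i ∈ tangentSpaceOf n F x) → α.1 x v = 0}
  zero_mem' := fun _ _ _ _ => rfl
  add_mem' := fun {α β} hα hβ x hx v hv => by
    change α.1 x v + β.1 x v = 0
    rw [hα x hx v hv, hβ x hx v hv, add_zero]
  smul_mem' := fun c α hα x hx v hv => by
    change c • α.1 x v = 0
    rw [hα x hx v hv, smul_zero]

/-- The smooth `p`-forms on `X` whose restriction to `F` is closed: `(dα)|_F = 0`. -/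
noncomputable def closedOn {n : ℕ} {X : Type*} [TopologicalSpace X]
    [ChartedSpace (EuclideanSpace ℝ (Fin n)) X] [IsManifold (𝓡 n) ∞ X] (F : Set X) (p : ℕ) :
    Submodule ℝ (SmoothForm n X p) :=
  (vanishingOn F (p + 1)).comap (extD n X p)

/-- The smooth `p`-forms on `X` whose restriction to `F` is exact: `α|_F = (dβ)|_F` for some
`β ∈ Λ^(p-1)(X)`; in degree `0`, `α|_F = 0`. -/
noncomputable def exactOn {n : ℕ} {X : Type*} [TopologicalSpace X]
    [ChartedSpace (EuclideanSpace ℝ (Fin n)) X] [IsManifold (𝓡 n) ∞ X] (F : Set X) :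
    (p : ℕ) → Submodule ℝ (SmoothForm n X p)
  | 0 => vanishingOn F 0
  | p + 1 => (extD n X p).range ⊔ vanishingOn F (p + 1)

/-- The de Rham cohomology group `H^p(F)` of a closed domain with smooth boundary or closed smooth
hypersurface `F` of the `n`-dimensional manifold `X`, or of `F = X`: closed forms on `F` modulo
exact forms on `F`. -/
abbrev DeRham (n : ℕ) {X : Type*} [TopologicalSpace X]
    [ChartedSpace (EuclideanSpace ℝ (Fin n)) X] [IsManifold (𝓡 n) ∞ X] (F : Set X) (p : ℕ) :
    Type _ :=
  closedOn (n := n) F p ⧸ (exactOn F p).submoduleOf (closedOn F p)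

theorem vanishingOn_univ {n : ℕ} {X : Type*} [TopologicalSpace X]
    [ChartedSpace (EuclideanSpace ℝ (Fin n)) X] (p : ℕ) :
    vanishingOn (n := n) (Set.univ : Set X) p = ⊥ := by
  refine (Submodule.eq_bot_iff _).2 fun α hα => ?_
  ext1
  funext x
  ext v
  exact hα x trivial v fun i => by rw [tangentSpaceOf_univ]; trivial

theorem closedOn_univ_le {n : ℕ} {X : Type*} [TopologicalSpace X]
    [ChartedSpace (EuclideanSpace ℝ (Fin n)) X] [IsManifold (𝓡 n) ∞ X] (F : Set X) (p : ℕ) :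
    closedOn (n := n) (Set.univ : Set X) p ≤ closedOn F p :=
  Submodule.comap_mono (by rw [vanishingOn_univ]; exact bot_le)

theorem exactOn_univ_le {n : ℕ} {X : Type*} [TopologicalSpace X]
    [ChartedSpace (EuclideanSpace ℝ (Fin n)) X] [IsManifold (𝓡 n) ∞ X] (F : Set X) :
    ∀ p : ℕ, exactOn (n := n) (Set.univ : Set X) p ≤ exactOn F p
  | 0 => by simp only [exactOn, vanishingOn_univ, bot_le]
  | p + 1 => sup_le_sup_left (by rw [vanishingOn_univ]; exact bot_le) _

/-- The restriction map `H^p(X) → H^p(F)`, `[α] ↦ [α|_F]`. -/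
noncomputable def DeRham.restrict (n : ℕ) {X : Type*} [TopologicalSpace X]
    [ChartedSpace (EuclideanSpace ℝ (Fin n)) X] [IsManifold (𝓡 n) ∞ X] (F : Set X) (p : ℕ) :
    DeRham n (Set.univ : Set X) p →ₗ[ℝ] DeRham n F p :=
  Submodule.mapQ _ _ (Submodule.inclusion (closedOn_univ_le F p))
    fun _ hα => exactOn_univ_le F p hα

/-- The open set `Ω` has smooth boundary: near each boundary point it is `{ρ < 0}` for a smooth
function `ρ` whose differential at that point is nonzero. -/
def HasSmoothBoundary (n : ℕ) {X : Type*} [TopologicalSpace X]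
    [ChartedSpace (EuclideanSpace ℝ (Fin n)) X] (Ω : Set X) : Prop :=
  ∀ x ∈ frontier Ω, ∃ U : Set X, IsOpen U ∧ x ∈ U ∧ ∃ ρ : X → ℝ,
    ContMDiffOn (𝓡 n) 𝓘(ℝ, ℝ) ∞ ρ U ∧ mfderiv (𝓡 n) 𝓘(ℝ, ℝ) ρ x ≠ 0 ∧
      Ω ∩ U = {y ∈ U | ρ y < 0}

/-! A form on `X \ Ω` or on `bΩ` is represented by a form on all of `X`, modulo those whose
restriction is zero. So extending forms is free, and the problem is to extend closed forms as closed
forms and to find global primitives. Two tools carry the proof.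

The first is a one-sided relative Poincaré lemma, `exists_collar_primitive`. If `μ` is closed off
`Ω` near `bΩ` and restricts to zero on `bΩ`, then `μ = dκ` off `Ω` near `bΩ`, with `κ` smooth on
`X`. Then `μ - dκ` is zero on the outer side near `bΩ`, so it may be cut along `bΩ`, keeping either
side and putting zero on the other, and stays smooth (`exteriorPart`). Locally `κ` comes from the
homotopy formula `dK + Kd = id - p^*` for the projection `p` onto the boundary in a chart that
straightens `Ω` to a half space. The local corrections are applied one after another over the
compact boundary.

The second is `exists_primitive_near_closure`: a closed form of positive degree is exact near the
closure of `Ω`. A smooth map `P` that preserves cohomology classes pushes the closure into `Ω`. The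
contraction of `Ω`, smoothed along compact sets, gives a primitive near the image of the closure,
and this primitive is pulled back by `P`.

Surjectivity: let `α` be closed off `Ω`. Since `H^j(bΩ) = 0`, some `α - dβ` restricts to zero on
`bΩ`. The first tool makes it zero on the outer side near `bΩ` modulo an exact form, and extension
by zero into `Ω` is closed (`exists_closed_extension`). Contractibility plays no role here.

Injectivity: if `α` is closed and equals `dβ` off `Ω`, then `ν = α - dβ` is closed on `X` and zero
off `Ω`. The second tool gives `ν = dη` near the closure. The restriction of `η` to `bΩ` is closed
of degree `j - 1 ≥ 1`, hence exact there, so `η` can be corrected by exact forms until it is zero on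
the outer side near `bΩ`. Its part on `Ω`, extended by zero, is a primitive of `ν` on `X`
(`exists_primitive_of_eq_zero`). -/

set_option linter.unusedSectionVars false

/-! ### Smooth families of alternating maps. -/

section AlternatingSmooth

variable {ι E F V : Type*} [Fintype ι] [NormedAddCommGroup E] [NormedSpace ℝ E]
  [NormedAddCommGroup F] [NormedSpace ℝ F] [NormedAddCommGroup V] [NormedSpace ℝ V]

/-- Evaluation of a smooth family of alternating maps on smooth vector fields is smooth. -/
theorem ContDiffAt.continuousAlternatingMap_apply {r : WithTop ℕ∞} {α : V → F [⋀^ι]→L[ℝ] ℝ}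
    {v : V → ι → F} {z : V} (hα : ContDiffAt ℝ r α z) (hv : ∀ i, ContDiffAt ℝ r (fun y => v y i) z) :
    ContDiffAt ℝ r (fun y => α y (v y)) z := by
  have h1 : ContDiffAt ℝ r (fun y => (α y).toContinuousMultilinearMap) z :=
    (ContinuousAlternatingMap.toContinuousMultilinearMapCLM ℝ (𝕜 := ℝ) (E := F) (F := ℝ)
      (ι := ι)).contDiff.contDiffAt.comp z hα
  -- A vector is the value at `1` of a linear map from `ℝ`. Evaluation thus becomes composition with
  -- linear maps, which is continuous multilinear in them and hence smooth.
  have h2 : ContDiffAt ℝ r (fun y => fun i : ι =>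
      ContinuousLinearMap.toSpanSingleton ℝ (v y i)) z := by
    refine contDiffAt_pi.2 fun i => ?_
    exact (ContinuousLinearMap.toSpanSingletonCLE (𝕜 := ℝ) (E := F) :
      F →L[ℝ] (ℝ →L[ℝ] F)).contDiff.contDiffAt.comp z (hv i)
  have h3 := (ContinuousMultilinearMap.contDiff (n := r)
    (F := (ContinuousMultilinearMap ℝ (fun _ : ι => F) ℝ →L[ℝ]
      ContinuousMultilinearMap ℝ (fun _ : ι => ℝ) ℝ))
    (ContinuousMultilinearMap.compContinuousLinearMapContinuousMultilinear ℝ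
    (fun _ : ι => ℝ) (fun _ : ι => F) ℝ)).contDiffAt.comp z h2
  have h4 := h3.clm_apply h1
  have h5 := (ContinuousMultilinearMap.apply ℝ (fun _ : ι => ℝ) ℝ
    (fun _ => (1 : ℝ))).contDiff (n := r).contDiffAt.comp z h4
  refine h5.congr_of_eventuallyEq (Filter.Eventually.of_forall fun y => ?_)
  simp [ContinuousMultilinearMap.apply]

/-- A family of alternating maps on a finite-dimensional space is smooth as soon as all its
evaluations on constant vectors are. -/
theorem contDiffAt_continuousAlternatingMap_iff [FiniteDimensional ℝ E] {r : WithTop ℕ∞}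
    {α : V → E [⋀^ι]→L[ℝ] ℝ} {z : V} :
    ContDiffAt ℝ r α z ↔ ∀ v : ι → E, ContDiffAt ℝ r (fun y => α y v) z := by
  classical
  refine ⟨fun h v => h.continuousAlternatingMap_apply fun i => contDiffAt_const, fun h => ?_⟩
  let b := Module.finBasis ℝ E
  -- The values on tuples of basis vectors determine the form, so `α` is recovered from finitely
  -- many scalar functions by a linear left inverse.
  let L : (E [⋀^ι]→L[ℝ] ℝ) →ₗ[ℝ] ((ι → Fin (Module.finrank ℝ E)) → ℝ) :=
    { toFun := fun f σ => f (fun i => b (σ i))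
      map_add' := fun f g => rfl
      map_smul' := fun c f => rfl }
  have hL : Function.Injective L := by
    intro f g hfg
    apply ContinuousAlternatingMap.toAlternatingMap_injective
    exact Module.Basis.ext_alternating b fun σ _ => congrFun hfg σ
  have : FiniteDimensional ℝ (E [⋀^ι]→L[ℝ] ℝ) := FiniteDimensional.of_injective L hL
  obtain ⟨M, hM⟩ := L.exists_leftInverse_of_injective (LinearMap.ker_eq_bot.2 hL)
  have h1 : ContDiffAt ℝ r (fun y => L (α y)) z := contDiffAt_pi.2 fun σ => h _
  have h2 := (LinearMap.toContinuousLinearMap M).contDiff (n := r).contDiffAt.comp z h1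
  refine h2.congr_of_eventuallyEq (Filter.Eventually.of_forall fun y => ?_)
  exact (LinearMap.congr_fun hM (α y)).symm

theorem ContDiffAt.continuousAlternatingMap_compContinuousLinearMap [FiniteDimensional ℝ E]
    {r : WithTop ℕ∞} {α : V → F [⋀^ι]→L[ℝ] ℝ} {A : V → E →L[ℝ] F} {z : V}
    (hα : ContDiffAt ℝ r α z) (hA : ContDiffAt ℝ r A z) :
    ContDiffAt ℝ r (fun y => (α y).compContinuousLinearMap (A y)) z :=
  contDiffAt_continuousAlternatingMap_iff.2 fun v =>
    hα.continuousAlternatingMap_apply fun i => hA.clm_apply contDiffAt_const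

end AlternatingSmooth

/-! ### Pointwise calculus of forms: smoothness, exterior derivative, pull-back. -/

section Toolkit

variable {n p : ℕ} {X Y Z : Type*} [TopologicalSpace X] [TopologicalSpace Y] [TopologicalSpace Z]
  [ChartedSpace (EuclideanSpace ℝ (Fin n)) X] [ChartedSpace (EuclideanSpace ℝ (Fin n)) Y]
  [ChartedSpace (EuclideanSpace ℝ (Fin n)) Z]

/-- A family of alternating forms is smooth at `x` if its representative in the preferred chart
at `x` is. -/
def SmoothFormAt (α : (x : X) → TangentSpace (𝓡 n) x [⋀^Fin p]→L[ℝ] ℝ) (x : X) : Prop :=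
  ContDiffAt ℝ ∞ (localRep (chartAt (EuclideanSpace ℝ (Fin n)) x) α)
    (chartAt (EuclideanSpace ℝ (Fin n)) x x)

/-- The pull-back `g^* α`. -/
noncomputable def formPullback (g : X → Y) (α : (y : Y) → TangentSpace (𝓡 n) y [⋀^Fin p]→L[ℝ] ℝ)
    (x : X) : TangentSpace (𝓡 n) x [⋀^Fin p]→L[ℝ] ℝ :=
  (α (g x)).compContinuousLinearMap (mfderiv (𝓡 n) (𝓡 n) g x)

theorem localRep_eventuallyEq {α β : (x : X) → TangentSpace (𝓡 n) x [⋀^Fin p]→L[ℝ] ℝ} {x : X}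
    (h : ∀ᶠ y in 𝓝 x, α y = β y) : localRep (chartAt (EuclideanSpace ℝ (Fin n)) x) α
      =ᶠ[𝓝 (chartAt (EuclideanSpace ℝ (Fin n)) x x)]
        localRep (chartAt (EuclideanSpace ℝ (Fin n)) x) β := by
  have h1 := (chartAt (EuclideanSpace ℝ (Fin n)) x).tendsto_symm (mem_chart_source _ x)
  filter_upwards [h1.eventually h] with y hy
  simp only [localRep, hy]

theorem SmoothFormAt.congr {α β : (x : X) → TangentSpace (𝓡 n) x [⋀^Fin p]→L[ℝ] ℝ} {x : X}
    (hα : SmoothFormAt α x) (h : ∀ᶠ y in 𝓝 x, β y = α y) : SmoothFormAt β x :=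
  ContDiffAt.congr_of_eventuallyEq hα (localRep_eventuallyEq h)

theorem extDerivAt_congr {α β : (x : X) → TangentSpace (𝓡 n) x [⋀^Fin p]→L[ℝ] ℝ} {x : X}
    (h : ∀ᶠ y in 𝓝 x, α y = β y) : extDerivAt α x = extDerivAt β x := by
  simp only [extDerivAt, (localRep_eventuallyEq h).extDeriv_eq]

theorem SmoothFormAt.add {α β : (x : X) → TangentSpace (𝓡 n) x [⋀^Fin p]→L[ℝ] ℝ} {x : X}
    (hα : SmoothFormAt α x) (hβ : SmoothFormAt β x) : SmoothFormAt (α + β) x := by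
  unfold SmoothFormAt
  rw [localRep_add]
  exact ContDiffAt.add hα hβ

theorem SmoothFormAt.const_smul {α : (x : X) → TangentSpace (𝓡 n) x [⋀^Fin p]→L[ℝ] ℝ} {x : X}
    (c : ℝ) (hα : SmoothFormAt α x) : SmoothFormAt (c • α) x := by
  unfold SmoothFormAt
  rw [localRep_smul]
  exact contDiffAt_const.smul hα

theorem SmoothFormAt.neg {α : (x : X) → TangentSpace (𝓡 n) x [⋀^Fin p]→L[ℝ] ℝ} {x : X}
    (hα : SmoothFormAt α x) : SmoothFormAt (-α) x := by
  have h : -α = (-1 : ℝ) • α := by funext y; exact (neg_one_smul ℝ (α y)).symm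
  rw [h]
  exact hα.const_smul (-1)

theorem SmoothFormAt.sub {α β : (x : X) → TangentSpace (𝓡 n) x [⋀^Fin p]→L[ℝ] ℝ} {x : X}
    (hα : SmoothFormAt α x) (hβ : SmoothFormAt β x) : SmoothFormAt (α - β) x := by
  rw [sub_eq_add_neg]
  exact hα.add hβ.neg

theorem smoothFormAt_zero {x : X} :
    SmoothFormAt (0 : (x : X) → TangentSpace (𝓡 n) x [⋀^Fin p]→L[ℝ] ℝ) x :=
  contDiffAt_const (𝕜 := ℝ) (E := EuclideanSpace ℝ (Fin n))
    (c := (0 : EuclideanSpace ℝ (Fin n) [⋀^Fin p]→L[ℝ] ℝ))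

theorem SmoothFormAt.differentiableAt {α : (x : X) → TangentSpace (𝓡 n) x [⋀^Fin p]→L[ℝ] ℝ}
    {x : X} (hα : SmoothFormAt α x) :
    DifferentiableAt ℝ (localRep (chartAt (EuclideanSpace ℝ (Fin n)) x) α)
      (chartAt (EuclideanSpace ℝ (Fin n)) x x) :=
  ContDiffAt.differentiableAt hα (by simp)

theorem extDerivAt_add {α β : (x : X) → TangentSpace (𝓡 n) x [⋀^Fin p]→L[ℝ] ℝ} {x : X}
    (hα : SmoothFormAt α x) (hβ : SmoothFormAt β x) :
    extDerivAt (α + β) x = extDerivAt α x + extDerivAt β x := by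
  simp only [extDerivAt]
  rw [localRep_add, extDeriv_add hα.differentiableAt hβ.differentiableAt]
  rfl

theorem extDerivAt_const_smul (c : ℝ) (α : (x : X) → TangentSpace (𝓡 n) x [⋀^Fin p]→L[ℝ] ℝ)
    (x : X) : extDerivAt (c • α) x = c • extDerivAt α x := by
  simp only [extDerivAt]
  rw [localRep_smul, extDeriv_smul]
  rfl

theorem extDerivAt_neg (α : (x : X) → TangentSpace (𝓡 n) x [⋀^Fin p]→L[ℝ] ℝ)
    (x : X) : extDerivAt (-α) x = -extDerivAt α x := by
  have h : -α = (-1 : ℝ) • α := by funext y; exact (neg_one_smul ℝ (α y)).symm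
  rw [h, extDerivAt_const_smul]
  exact neg_one_smul ℝ (extDerivAt α x)

theorem extDerivAt_zero (x : X) :
    extDerivAt (0 : (x : X) → TangentSpace (𝓡 n) x [⋀^Fin p]→L[ℝ] ℝ) x = 0 := by
  have h : (0 : (x : X) → TangentSpace (𝓡 n) x [⋀^Fin p]→L[ℝ] ℝ) = (0 : ℝ) • 0 := by
    
    funext y
    exact (zero_smul ℝ (0 : TangentSpace (𝓡 n) y [⋀^Fin p]→L[ℝ] ℝ)).symm
  rw [h, extDerivAt_const_smul]
  exact zero_smul ℝ (extDerivAt (0 : (x : X) → TangentSpace (𝓡 n) x [⋀^Fin p]→L[ℝ] ℝ) x)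

theorem extDerivAt_sub {α β : (x : X) → TangentSpace (𝓡 n) x [⋀^Fin p]→L[ℝ] ℝ} {x : X}
    (hα : SmoothFormAt α x) (hβ : SmoothFormAt β x) :
    extDerivAt (α - β) x = extDerivAt α x - extDerivAt β x := by
  rw [sub_eq_add_neg, extDerivAt_add hα hβ.neg, extDerivAt_neg, sub_eq_add_neg]

theorem formPullback_congr {g g' : X → Y} {x : X} (h : g =ᶠ[𝓝 x] g')
    (α : (y : Y) → TangentSpace (𝓡 n) y [⋀^Fin p]→L[ℝ] ℝ) : formPullback g α x = formPullback g' α x := by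
  -- Every tangent space unfolds to the model space, so values of `α` at equal points are compared
  -- there without transport.
  have h1 : ∀ y : Y, y = g x → (α y : EuclideanSpace ℝ (Fin n) [⋀^Fin p]→L[ℝ] ℝ) = α (g x) := by
    rintro y rfl; rfl
  ext v
  change (α (g x) : EuclideanSpace ℝ (Fin n) [⋀^Fin p]→L[ℝ] ℝ)
    (fun i => mfderiv (𝓡 n) (𝓡 n) g x (v i)) =
    (α (g' x) : EuclideanSpace ℝ (Fin n) [⋀^Fin p]→L[ℝ] ℝ)
    (fun i => mfderiv (𝓡 n) (𝓡 n) g' x (v i))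
  rw [h1 (g' x) h.self_of_nhds.symm, h.mfderiv_eq]
  rfl

theorem formPullback_comp {g : Y → Z} {h : X → Y} {x : X}
    (hg : MDifferentiableAt (𝓡 n) (𝓡 n) g (h x)) (hh : MDifferentiableAt (𝓡 n) (𝓡 n) h x)
    (α : (y : Z) → TangentSpace (𝓡 n) y [⋀^Fin p]→L[ℝ] ℝ) :
    formPullback (g ∘ h) α x = formPullback h (formPullback g α) x := by
  ext v
  change α (g (h x)) (fun i => mfderiv (𝓡 n) (𝓡 n) (g ∘ h) x (v i)) = α (g (h x))
    (fun i => mfderiv (𝓡 n) (𝓡 n) g (h x) (mfderiv (𝓡 n) (𝓡 n) h x (v i)))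
  rw [mfderiv_comp x hg hh]
  rfl

theorem formPullback_id (α : (y : X) → TangentSpace (𝓡 n) y [⋀^Fin p]→L[ℝ] ℝ) (x : X) :
    formPullback id α x = α x := by
  ext v
  change α x (fun i => mfderiv (𝓡 n) (𝓡 n) id x (v i)) = α x v
  rw [mfderiv_id]
  rfl

end Toolkit

/-! ### Pull-back by smooth maps. -/

section PullbackSmooth

variable {n p : ℕ} {X Y : Type*} [TopologicalSpace X] [TopologicalSpace Y]
  [ChartedSpace (EuclideanSpace ℝ (Fin n)) X] [ChartedSpace (EuclideanSpace ℝ (Fin n)) Y]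
  [IsManifold (𝓡 n) ∞ X] [IsManifold (𝓡 n) ∞ Y]

theorem ContMDiffAt.contDiffAt_chart {g : X → Y} {x : X} (hg : ContMDiffAt (𝓡 n) (𝓡 n) ∞ g x) :
    ContDiffAt ℝ ∞ (chartAt (EuclideanSpace ℝ (Fin n)) (g x) ∘ g ∘
      (chartAt (EuclideanSpace ℝ (Fin n)) x).symm) (chartAt (EuclideanSpace ℝ (Fin n)) x x) := by
  have h := (contMDiffAt_iff.1 hg).2
  simpa [mfld_simps, contDiffWithinAt_univ] using h

theorem ContMDiffAt.eventually_mdifferentiableAt {g : X → Y} {x : X}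
    (hg : ContMDiffAt (𝓡 n) (𝓡 n) ∞ g x) : ∀ᶠ y in 𝓝 x, MDifferentiableAt (𝓡 n) (𝓡 n) g y := by
  have h1 : ContMDiffAt (𝓡 n) (𝓡 n) 1 g x := hg.of_le (by exact_mod_cast le_top)
  filter_upwards [contMDiffAt_iff_contMDiffAt_nhds (by simp) |>.1 h1] with y hy using hy.mdifferentiableAt (by simp)

/-- The representative of a pull-back, in the preferred charts. -/
theorem localRep_formPullback {g : X → Y} {x : X} (hg : ContMDiffAt (𝓡 n) (𝓡 n) ∞ g x)
    (α : (y : Y) → TangentSpace (𝓡 n) y [⋀^Fin p]→L[ℝ] ℝ) :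
    ∀ᶠ z in 𝓝 (chartAt (EuclideanSpace ℝ (Fin n)) x x),
    localRep (chartAt (EuclideanSpace ℝ (Fin n)) x) (formPullback g α) z =
      (localRep (chartAt (EuclideanSpace ℝ (Fin n)) (g x)) α
        ((chartAt (EuclideanSpace ℝ (Fin n)) (g x) ∘ g ∘
          (chartAt (EuclideanSpace ℝ (Fin n)) x).symm) z)).compContinuousLinearMap
        (fderiv ℝ (chartAt (EuclideanSpace ℝ (Fin n)) (g x) ∘ g ∘
          (chartAt (EuclideanSpace ℝ (Fin n)) x).symm) z) := by
  set e := chartAt (EuclideanSpace ℝ (Fin n)) x with he_def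
  set f := chartAt (EuclideanSpace ℝ (Fin n)) (g x) with hf_def
  have he : e ∈ atlas (EuclideanSpace ℝ (Fin n)) X := chart_mem_atlas _ _
  have hf : f ∈ atlas (EuclideanSpace ℝ (Fin n)) Y := chart_mem_atlas _ _
  have h1 := e.tendsto_symm (mem_chart_source _ x)
  have h2 : ∀ᶠ y in 𝓝 x, g y ∈ f.source :=
    hg.continuousAt.eventually (f.open_source.mem_nhds (mem_chart_source _ _))
  filter_upwards [h1.eventually hg.eventually_mdifferentiableAt, h1.eventually h2,
    e.open_target.mem_nhds (mem_chart_target _ x)] with z hgz hgf hz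
  have hE : MDifferentiableAt (𝓡 n) (𝓡 n) e.symm z :=
    mdifferentiableAt_atlas_symm (I := 𝓡 n) he hz
  have hF : MDifferentiableAt (𝓡 n) (𝓡 n) f (g (e.symm z)) :=
    mdifferentiableAt_atlas (I := 𝓡 n) hf hgf
  have hF' : MDifferentiableAt (𝓡 n) (𝓡 n) f.symm (f (g (e.symm z))) :=
    mdifferentiableAt_atlas_symm (I := 𝓡 n) hf (f.map_source hgf)
  have h3 : fderiv ℝ (f ∘ g ∘ e.symm) z = mfderiv (𝓡 n) (𝓡 n) f (g (e.symm z)) ∘L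
      mfderiv (𝓡 n) (𝓡 n) g (e.symm z) ∘L mfderiv (𝓡 n) (𝓡 n) e.symm z := by
    rw [← mfderiv_eq_fderiv]
    have h4 := mfderiv_comp z hgz hE
    have h5 := mfderiv_comp (I' := 𝓡 n) (g := f) (f := g ∘ e.symm) z hF (hgz.comp z hE)
    rw [h4] at h5
    exact h5
  have h6 : mfderiv (𝓡 n) (𝓡 n) f.symm (f (g (e.symm z))) ∘L
      mfderiv (𝓡 n) (𝓡 n) f (g (e.symm z)) =
      ContinuousLinearMap.id ℝ (TangentSpace (𝓡 n) (g (e.symm z))) := by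
    rw [← mfderiv_comp (g (e.symm z)) hF' hF, ← mfderiv_id]
    apply Filter.EventuallyEq.mfderiv_eq
    filter_upwards [f.open_source.mem_nhds hgf] with w hw using f.left_inv hw
  have h7 : ∀ w : Y, w = g (e.symm z) →
      (α w : EuclideanSpace ℝ (Fin n) [⋀^Fin p]→L[ℝ] ℝ) = α (g (e.symm z)) := by
    rintro w rfl; rfl
  ext v
  change α (g (e.symm z)) (fun i => mfderiv (𝓡 n) (𝓡 n) g (e.symm z)
      (mfderiv (𝓡 n) (𝓡 n) e.symm z (v i))) =
    (α (f.symm (f (g (e.symm z)))) : EuclideanSpace ℝ (Fin n) [⋀^Fin p]→L[ℝ] ℝ)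
      (fun i => mfderiv (𝓡 n) (𝓡 n) f.symm (f (g (e.symm z)))
        (fderiv ℝ (f ∘ g ∘ e.symm) z (v i)))
  rw [h7 _ (f.left_inv hgf), h3]
  congr 1
  funext i
  exact (DFunLike.congr_fun h6 (mfderiv (𝓡 n) (𝓡 n) g (e.symm z)
    (mfderiv (𝓡 n) (𝓡 n) e.symm z (v i)))).symm

theorem SmoothFormAt.formPullback {g : X → Y} {x : X} (hg : ContMDiffAt (𝓡 n) (𝓡 n) ∞ g x)
    {α : (y : Y) → TangentSpace (𝓡 n) y [⋀^Fin p]→L[ℝ] ℝ} (hα : SmoothFormAt α (g x)) :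
    SmoothFormAt (formPullback g α) x := by
  refine ContDiffAt.congr_of_eventuallyEq ?_ (localRep_formPullback hg α)
  have h1 := hg.contDiffAt_chart
  refine ContDiffAt.continuousAlternatingMap_compContinuousLinearMap ?_ (h1.fderiv_right (by simp))
  refine ContDiffAt.comp (g := localRep (chartAt (EuclideanSpace ℝ (Fin n)) (g x)) α) _ ?_ h1
  simp only [Function.comp_apply, OpenPartialHomeomorph.left_inv _ (mem_chart_source _ x)]
  exact hα

/-- Naturality of `d` in coordinates, combined with the chain rule for the preferred charts.
Smoothness is required only at the point, so it applies to maps and forms that are smooth merely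
along a compact set. -/
theorem extDerivAt_formPullback {g : X → Y} {x : X} (hg : ContMDiffAt (𝓡 n) (𝓡 n) ∞ g x)
    {α : (y : Y) → TangentSpace (𝓡 n) y [⋀^Fin p]→L[ℝ] ℝ} (hα : SmoothFormAt α (g x)) :
    extDerivAt (formPullback g α) x = formPullback g (extDerivAt α) x := by
  set e := chartAt (EuclideanSpace ℝ (Fin n)) x with he_def
  set f := chartAt (EuclideanSpace ℝ (Fin n)) (g x) with hf_def
  have he : e ∈ atlas (EuclideanSpace ℝ (Fin n)) X := chart_mem_atlas _ _
  have hf : f ∈ atlas (EuclideanSpace ℝ (Fin n)) Y := chart_mem_atlas _ _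
  have hx : e.symm (e x) = x := e.left_inv (mem_chart_source _ x)
  have hd : DifferentiableAt ℝ (localRep f α) ((f ∘ g ∘ e.symm) (e x)) := by
    simpa [hx] using hα.differentiableAt
  have hgx := hg.mdifferentiableAt (by simp)
  have hE : MDifferentiableAt (𝓡 n) (𝓡 n) e x :=
    mdifferentiableAt_atlas (I := 𝓡 n) he (mem_chart_source _ x)
  have hF : MDifferentiableAt (𝓡 n) (𝓡 n) f (g x) :=
    mdifferentiableAt_atlas (I := 𝓡 n) hf (mem_chart_source _ _)
  have h1 : mfderiv (𝓡 n) (𝓡 n) (f ∘ g ∘ e.symm) (e x) ∘L mfderiv (𝓡 n) (𝓡 n) e x =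
      mfderiv (𝓡 n) (𝓡 n) f (g x) ∘L mfderiv (𝓡 n) (𝓡 n) g x := by
    have hm : MDifferentiableAt (𝓡 n) (𝓡 n) (f ∘ g ∘ e.symm) (e x) :=
      (hg.contDiffAt_chart.differentiableAt (by simp)).mdifferentiableAt
    rw [← mfderiv_comp x hF hgx, ← mfderiv_comp x hm hE]
    apply Filter.EventuallyEq.mfderiv_eq
    filter_upwards [e.open_source.mem_nhds (mem_chart_source _ x)] with w hw
    simp [e.left_inv hw]
  unfold extDerivAt
  rw [← he_def, Filter.EventuallyEq.extDeriv_eq (localRep_formPullback hg α), ← he_def, ← hf_def,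
    extDeriv_pullback hd hg.contDiffAt_chart
      (by simpa using (WithTop.coe_le_coe.2 le_top : ((2 : ℕ∞) : WithTop ℕ∞) ≤ ∞))]
  have h2 : (f ∘ g ∘ e.symm) (e x) = f (g x) := by simp [hx]
  ext v
  change extDeriv (localRep f α) ((f ∘ g ∘ e.symm) (e x))
    (fun i => (fderiv ℝ (f ∘ g ∘ e.symm) (e x)) (mfderiv (𝓡 n) (𝓡 n) e x (v i))) =
    extDeriv (localRep f α) (f (g x))
      (fun i => mfderiv (𝓡 n) (𝓡 n) f (g x) (mfderiv (𝓡 n) (𝓡 n) g x (v i)))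
  rw [h2, ← mfderiv_eq_fderiv]
  congr 1
  funext i
  exact DFunLike.congr_fun h1 (v i)

end PullbackSmooth

/-! ### Forms on Euclidean space, multiplication by functions, and continuity of forms. -/

section Euclidean

variable {n p : ℕ}

theorem smoothFormAt_euclidean_iff
    {α : EuclideanSpace ℝ (Fin n) → EuclideanSpace ℝ (Fin n) [⋀^Fin p]→L[ℝ] ℝ}
    {x : EuclideanSpace ℝ (Fin n)} :
    SmoothFormAt (X := EuclideanSpace ℝ (Fin n)) α x ↔ ContDiffAt ℝ ∞ α x := by
  have h : localRep (chartAt (EuclideanSpace ℝ (Fin n)) x) α = α := by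
    funext y
    exact formPullback_id (X := EuclideanSpace ℝ (Fin n)) α y
  unfold SmoothFormAt
  rw [h]
  rfl

theorem extDerivAt_euclidean
    (α : EuclideanSpace ℝ (Fin n) → EuclideanSpace ℝ (Fin n) [⋀^Fin p]→L[ℝ] ℝ)
    (x : EuclideanSpace ℝ (Fin n)) :
    extDerivAt (X := EuclideanSpace ℝ (Fin n)) α x = extDeriv α x := by
  have h : localRep (chartAt (EuclideanSpace ℝ (Fin n)) x) α = α := by
    funext y
    exact formPullback_id (X := EuclideanSpace ℝ (Fin n)) α y
  unfold extDerivAt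
  rw [h]
  exact formPullback_id (X := EuclideanSpace ℝ (Fin n)) (extDeriv α) x

variable {X : Type*} [TopologicalSpace X]
  [ChartedSpace (EuclideanSpace ℝ (Fin n)) X] [IsManifold (𝓡 n) ∞ X]

theorem localRep_eq_formPullback_symm (e : OpenPartialHomeomorph X (EuclideanSpace ℝ (Fin n)))
    (α : (x : X) → TangentSpace (𝓡 n) x [⋀^Fin p]→L[ℝ] ℝ) : localRep e α = formPullback e.symm α := rfl

/-- The representative in any chart `e` of the atlas is the pull-back by the smooth map `e.symm`, so
one chart at each point suffices. -/
theorem mem_smoothForm_iff {α : (x : X) → TangentSpace (𝓡 n) x [⋀^Fin p]→L[ℝ] ℝ} :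
    α ∈ SmoothForm n X p ↔ ∀ x, SmoothFormAt α x := by
  refine ⟨fun h x => (h _ (chart_mem_atlas _ x)).contDiffAt
    ((chartAt _ x).open_target.mem_nhds (mem_chart_target _ x)), fun h e he y hy => ?_⟩
  have h1 : ContMDiffAt (𝓡 n) (𝓡 n) ∞ e.symm y :=
    (contMDiffOn_symm_of_mem_maximalAtlas (IsManifold.subset_maximalAtlas he)).contMDiffAt
      (e.open_target.mem_nhds hy)
  exact (smoothFormAt_euclidean_iff.1 (SmoothFormAt.formPullback h1 (h (e.symm y)))).contDiffWithinAt

theorem SmoothFormAt.smul {χ : X → ℝ} {x : X} (hχ : ContMDiffAt (𝓡 n) 𝓘(ℝ, ℝ) ∞ χ x)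
    {α : (x : X) → TangentSpace (𝓡 n) x [⋀^Fin p]→L[ℝ] ℝ} (hα : SmoothFormAt α x) :
    SmoothFormAt (fun y => χ y • α y) x := by
  have h := (contMDiffAt_iff.1 hχ).2
  have h1 : ContDiffAt ℝ ∞ (χ ∘ (chartAt (EuclideanSpace ℝ (Fin n)) x).symm)
      (chartAt (EuclideanSpace ℝ (Fin n)) x x) := by
    simp only [mfld_simps, contDiffWithinAt_univ] at h
    exact h
  exact ContDiffAt.smul h1 hα

/-- The Leibniz rule at a zero of the form. -/
theorem extDerivAt_smul_of_eq_zero {χ : X → ℝ} {x : X} (hχ : ContMDiffAt (𝓡 n) 𝓘(ℝ, ℝ) ∞ χ x)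
    {α : (x : X) → TangentSpace (𝓡 n) x [⋀^Fin p]→L[ℝ] ℝ} (hα : SmoothFormAt α x) (h0 : α x = 0) :
    extDerivAt (fun y => χ y • α y) x = χ x • extDerivAt α x := by
  set e := chartAt (EuclideanSpace ℝ (Fin n)) x with he_def
  have h := (contMDiffAt_iff.1 hχ).2
  have h1 : ContDiffAt ℝ ∞ (χ ∘ e.symm) (e x) := by
    simp only [mfld_simps, contDiffWithinAt_univ] at h
    exact h
  have hx : e.symm (e x) = x := e.left_inv (mem_chart_source _ x)
  have h2 : localRep e α (e x) = 0 := by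
    have : ∀ y : X, y = x → (α y : EuclideanSpace ℝ (Fin n) [⋀^Fin p]→L[ℝ] ℝ) = 0 := by
      rintro y rfl; exact h0
    unfold localRep
    ext v
    exact DFunLike.congr_fun (this _ hx) _
  have h3 : extDeriv (localRep e fun y => χ y • α y) (e x) = χ x • extDeriv (localRep e α) (e x) := by
    have h4 : localRep e (fun y => χ y • α y) = fun z => (χ ∘ e.symm) z • localRep e α z := rfl
    have h5 : fderiv ℝ (fun z => (χ ∘ e.symm) z • localRep e α z) (e x) =
        χ x • fderiv ℝ (localRep e α) (e x) := by
      rw [fderiv_fun_smul (h1.differentiableAt (by simp)) hα.differentiableAt, ← he_def, h2]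
      simp [hx]
    rw [h4, extDeriv, h5, ContinuousAlternatingMap.alternatizeUncurryFin_smul]
    rfl
  unfold extDerivAt
  rw [← he_def, h3]
  rfl

/-- A smooth form that has zeros arbitrarily near a point vanishes at that point. -/
theorem SmoothFormAt.eq_zero_of_frequently {x : X}
    {α : (x : X) → TangentSpace (𝓡 n) x [⋀^Fin p]→L[ℝ] ℝ} (hα : SmoothFormAt α x)
    (h0 : ∃ᶠ y in 𝓝 x, α y = 0) : α x = 0 := by
  set e := chartAt (EuclideanSpace ℝ (Fin n)) x with he_def
  have hxs : x ∈ e.source := mem_chart_source _ x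
  have he : e ∈ atlas (EuclideanSpace ℝ (Fin n)) X := chart_mem_atlas _ _
  have h1 : localRep e α (e x) = 0 := by
    by_contra hne
    have h2 : ∀ᶠ z in 𝓝 (e x), localRep e α z ≠ 0 := ContDiffAt.continuousAt hα |>.eventually_ne hne
    have h3 := (e.continuousAt hxs).eventually h2
    obtain ⟨y, hy, hy2, hy3⟩ := (h0.and_eventually (h3.and (e.open_source.mem_nhds hxs))).exists
    apply hy2
    have : ∀ z : X, z = y → (α z : EuclideanSpace ℝ (Fin n) [⋀^Fin p]→L[ℝ] ℝ) = 0 := by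
      rintro z rfl; exact hy
    unfold localRep
    ext v
    exact DFunLike.congr_fun (this _ (e.left_inv hy3)) _
  have hE : MDifferentiableAt (𝓡 n) (𝓡 n) e x := mdifferentiableAt_atlas (I := 𝓡 n) he hxs
  have hE' : MDifferentiableAt (𝓡 n) (𝓡 n) e.symm (e x) :=
    mdifferentiableAt_atlas_symm (I := 𝓡 n) he (e.map_source hxs)
  have h2 : e.symm ∘ e =ᶠ[𝓝 x] id := by
    filter_upwards [e.open_source.mem_nhds hxs] with w hw using e.left_inv hw
  rw [← formPullback_id α x, ← formPullback_congr h2, formPullback_comp hE' hE, ← localRep_eq_formPullback_symm]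
  change ContinuousAlternatingMap.compContinuousLinearMap (localRep e α (e x)) _ = 0
  rw [h1]
  rfl

end Euclidean

/-! ### Integrals depending smoothly on a parameter. -/

section ParametricIntegral

universe u
variable {E : Type u} [NormedAddCommGroup E] [NormedSpace ℝ E] [FiniteDimensional ℝ E]

theorem continuous_fderiv_of_contDiff {G : Type*} [NormedAddCommGroup G]
    [NormedSpace ℝ G] {f : E → ℝ → G} (hf : ContDiff ℝ 1 (fun z : E × ℝ => f z.1 z.2)) :
    Continuous fun z : E × ℝ => fderiv ℝ (fun y => f y z.2) z.1 := by
  have h : ContDiff ℝ 0 fun z : E × ℝ => fderiv ℝ (fun y => f y z.2) z.1 :=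
    ContDiff.fderiv (f := fun (z : E × ℝ) (y : E) => f y z.2) (n := 0)
      (hf.comp (contDiff_snd.prodMk (contDiff_snd.comp contDiff_fst))) contDiff_fst (by simp)
  exact h.continuous

/-- Differentiation under the integral sign over `[0, 1]`. -/
theorem hasFDerivAt_intervalIntegral_of_contDiff {G : Type*} [NormedAddCommGroup G]
    [NormedSpace ℝ G] {f : E → ℝ → G}
    (hf : ContDiff ℝ 1 (fun z : E × ℝ => f z.1 z.2)) (x : E) :
    HasFDerivAt (fun y => ∫ s in (0 : ℝ)..1, f y s)
      (∫ s in (0 : ℝ)..1, fderiv ℝ (fun y => f y s) x) x := by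
  have hd : ∀ y s, HasFDerivAt (fun y => f y s) (fderiv ℝ (fun y => f y s) y) y := by
    intro y s
    have h : ContDiff ℝ 1 (fun y => f y s) := hf.comp (contDiff_id.prodMk contDiff_const)
    exact (h.differentiable (by simp) y).hasFDerivAt
  have hc := continuous_fderiv_of_contDiff hf
  have : ProperSpace E := FiniteDimensional.proper ℝ E
  obtain ⟨C, hC⟩ := ((isCompact_closedBall x 1).prod (isCompact_Icc (a := (0 : ℝ)) (b := 1))
    ).exists_bound_of_continuousOn hc.continuousOn
  have hcs : ∀ y, Continuous fun s => f y s := fun y =>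
    hf.continuous.comp (continuous_const.prodMk continuous_id)
  refine intervalIntegral.hasFDerivAt_integral_of_dominated_of_fderiv_le
    (F' := fun y s => fderiv ℝ (fun y => f y s) y) (bound := fun _ => C)
    (Metric.closedBall_mem_nhds x one_pos) (Filter.Eventually.of_forall fun y =>
      (hcs y).aestronglyMeasurable) ((hcs x).intervalIntegrable _ _)
    (hc.comp (continuous_const.prodMk continuous_id)).aestronglyMeasurable ?_
    intervalIntegrable_const ?_
  · refine Filter.Eventually.of_forall fun s hs y hy => hC (y, s) ⟨hy, ?_⟩
    rw [Set.uIoc_of_le zero_le_one] at hs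
    exact ⟨hs.1.le, hs.2⟩
  · exact Filter.Eventually.of_forall fun s _ y _ => hd y s

/-- With `A` the alternatization, this moves the exterior derivative under the integral sign. -/
theorem map_fderiv_intervalIntegral {G G' : Type*} [NormedAddCommGroup G] [NormedSpace ℝ G]
    [CompleteSpace G] [NormedAddCommGroup G'] [NormedSpace ℝ G'] [CompleteSpace G'] {f : E → ℝ → G}
    (hf : ContDiff ℝ ∞ (fun z : E × ℝ => f z.1 z.2)) (A : (E →L[ℝ] G) →L[ℝ] G') (x : E) :
    Continuous (fun s => A (fderiv ℝ (fun y => f y s) x)) ∧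
    A (fderiv ℝ (fun y => ∫ s in (0 : ℝ)..1, f y s) x) =
      ∫ s in (0 : ℝ)..1, A (fderiv ℝ (fun y => f y s) x) := by
  have hf1 := hf.of_le (show (1 : WithTop ℕ∞) ≤ ∞ by exact_mod_cast le_top)
  have hc : Continuous fun s => fderiv ℝ (fun y => f y s) x :=
    (continuous_fderiv_of_contDiff hf1).comp (continuous_const.prodMk continuous_id)
  refine ⟨A.continuous.comp hc, ?_⟩
  rw [(hasFDerivAt_intervalIntegral_of_contDiff hf1 x).fderiv,
    A.intervalIntegral_comp_comm (hc.intervalIntegrable _ _)]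

/-- Induction on the order of differentiability: the derivative is an integral of the same kind with
values in `E →L[ℝ] G`. `G` lives in the universe of `E` so that the induction hypothesis applies to
this space. -/
theorem contDiff_intervalIntegral {G : Type u} [NormedAddCommGroup G]
    [NormedSpace ℝ G] {f : E → ℝ → G}
    (hf : ContDiff ℝ ∞ (fun z : E × ℝ => f z.1 z.2)) :
    ContDiff ℝ ∞ (fun y => ∫ s in (0 : ℝ)..1, f y s) := by
  rw [contDiff_infty]
  intro m
  induction m generalizing G with
  | zero =>
    have h : Differentiable ℝ (fun y => ∫ s in (0 : ℝ)..1, f y s) := fun y =>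
      (hasFDerivAt_intervalIntegral_of_contDiff (hf.of_le (by exact_mod_cast le_top)) y
        ).differentiableAt
    exact contDiff_zero.2 h.continuous
  | succ m ih =>
    have h := fun y => hasFDerivAt_intervalIntegral_of_contDiff (f := f)
      (hf.of_le (by exact_mod_cast le_top)) y
    push_cast
    rw [contDiff_succ_iff_fderiv]
    refine ⟨fun y => (h y).differentiableAt, by simp, ?_⟩
    rw [show fderiv ℝ (fun y => ∫ s in (0 : ℝ)..1, f y s) =
      fun y => ∫ s in (0 : ℝ)..1, fderiv ℝ (fun y => f y s) y from funext fun y => (h y).fderiv]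
    refine ih (f := fun y s => fderiv ℝ (fun y => f y s) y) ?_
    exact ContDiff.fderiv (f := fun (z : E × ℝ) (y : E) => f y z.2) (n := ∞)
      (hf.comp (contDiff_snd.prodMk (contDiff_snd.comp contDiff_fst))) contDiff_fst (by simp)

end ParametricIntegral

/-! ### The homotopy operator of an affine contraction. -/

section HomotopyOperator

variable {E : Type} [NormedAddCommGroup E] [NormedSpace ℝ E] [FiniteDimensional ℝ E] {k : ℕ}

open ContinuousAlternatingMap

/-- `ContinuousAlternatingMap.curryLeft` as a continuous linear map. -/
noncomputable def curryLeftCLM (E : Type) [NormedAddCommGroup E] [NormedSpace ℝ E] (k : ℕ) :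
    (E [⋀^Fin (k + 1)]→L[ℝ] ℝ) →L[ℝ] E →L[ℝ] E [⋀^Fin k]→L[ℝ] ℝ :=
  (curryLeftLI (𝕜 := ℝ) (E := E) (F := ℝ) (n := k)).toContinuousLinearMap

theorem curryLeftCLM_apply (f : E [⋀^Fin (k + 1)]→L[ℝ] ℝ) : curryLeftCLM E k f = f.curryLeft :=
  rfl

/-- Cartan's formula for a constant vector `q`, with `D` in the role of the derivative of a form:
the first term of the alternating sum differentiates along `q`, the others form `-d` of the
contraction. -/
theorem curryLeft_alternatizeUncurryFin (D : E →L[ℝ] E [⋀^Fin (k + 1)]→L[ℝ] ℝ) (q : E) :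
    (alternatizeUncurryFin D).curryLeft q =
      D q - alternatizeUncurryFin (((curryLeftCLM E k).flip q) ∘L D) := by
  ext v
  have h : ∀ i : Fin (k + 1), Fin.removeNth i.succ (Matrix.vecCons q v) =
      Matrix.vecCons q (Fin.removeNth i v) := fun i => by
    funext j
    refine Fin.cases ?_ (fun j => ?_) j <;> simp [Fin.removeNth, Matrix.vecCons]
  have h0 : Fin.removeNth 0 (Matrix.vecCons q v) = v := by
    funext j
    simp [Fin.removeNth, Matrix.vecCons]
  simp only [curryLeft_apply_apply, alternatizeUncurryFin_apply, ContinuousAlternatingMap.sub_apply,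
    Fin.sum_univ_succ, h0, h, Matrix.cons_val_zero, Matrix.cons_val_succ, Fin.val_zero, pow_zero,
    one_smul, Fin.val_succ, pow_succ, mul_neg, mul_one, neg_smul, Finset.sum_neg_distrib,
    ContinuousLinearMap.comp_apply, ContinuousLinearMap.flip_apply,
    curryLeftCLM_apply, curryLeft_apply_apply]
  ring

theorem hasFDerivAt_curryLeftCLM_apply {V : Type*} [NormedAddCommGroup V] [NormedSpace ℝ V]
    {f : V → E [⋀^Fin (k + 1)]→L[ℝ] ℝ} {q : V → E} {f' : V →L[ℝ] E [⋀^Fin (k + 1)]→L[ℝ] ℝ}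
    {q' : V →L[ℝ] E} {x : V} (hf : HasFDerivAt f f' x) (hq : HasFDerivAt q q' x) :
    HasFDerivAt (fun y => curryLeftCLM E k (f y) (q y))
      (((curryLeftCLM E k).flip (q x)) ∘L f' + (curryLeftCLM E k (f x)) ∘L q') x := by
  have h1 : HasFDerivAt (fun y => curryLeftCLM E k (f y)) (curryLeftCLM E k ∘L f') x :=
    HasFDerivAt.comp (g := curryLeftCLM E k) (f := f) x
      (ContinuousLinearMap.hasFDerivAt (F := E →L[ℝ] E [⋀^Fin k]→L[ℝ] ℝ) _) hf
  refine (h1.clm_apply hq).congr_fderiv ?_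
  ext u v
  simp [add_comm]

/-- The integrand of the homotopy operator of the affine contraction `x ↦ p + s (x - p)` onto the
image of the affine map `p = c + L x`. -/
noncomputable def homotopyIntegrand (c : E) (L : E →L[ℝ] E) (α : E → E [⋀^Fin (k + 1)]→L[ℝ] ℝ)
    (x : E) (s : ℝ) : E [⋀^Fin k]→L[ℝ] ℝ :=
  (curryLeftCLM E k (α (c + L x + s • (x - (c + L x))))
    (x - (c + L x))).compContinuousLinearMap (L + s • (.id ℝ E - L))

/-- The homotopy operator of the affine contraction `x ↦ p + s (x - p)` onto the image of the
affine map `p = c + L x`. -/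
noncomputable def homotopyOp (c : E) (L : E →L[ℝ] E) (α : E → E [⋀^Fin (k + 1)]→L[ℝ] ℝ) (x : E) :
    E [⋀^Fin k]→L[ℝ] ℝ :=
  ∫ s in (0 : ℝ)..1, homotopyIntegrand c L α x s

theorem contDiff_homotopyIntegrand (c : E) (L : E →L[ℝ] E) {α : E → E [⋀^Fin (k + 1)]→L[ℝ] ℝ}
    (hα : ContDiff ℝ ∞ α) :
    ContDiff ℝ ∞ (fun z : E × ℝ => homotopyIntegrand c L α z.1 z.2) := by
  rw [contDiff_iff_contDiffAt]
  intro z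
  refine ContDiffAt.continuousAlternatingMap_compContinuousLinearMap ?_ ?_
  · refine ContDiffAt.clm_apply (f := fun z : E × ℝ =>
      curryLeftCLM E k (α (c + L z.1 + z.2 • (z.1 - (c + L z.1))))) ?_ ?_
    · refine ContDiffAt.comp (g := curryLeftCLM E k) z (ContinuousLinearMap.contDiff
        (F := E →L[ℝ] E [⋀^Fin k]→L[ℝ] ℝ) _).contDiffAt ?_
      refine hα.contDiffAt.comp (g := α) z ?_
      fun_prop
    · fun_prop
  · fun_prop

theorem contDiff_homotopyOp (c : E) (L : E →L[ℝ] E) {α : E → E [⋀^Fin (k + 1)]→L[ℝ] ℝ}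
    (hα : ContDiff ℝ ∞ α) : ContDiff ℝ ∞ (homotopyOp c L α) :=
  contDiff_intervalIntegral (f := homotopyIntegrand c L α) (contDiff_homotopyIntegrand c L hα)

theorem ContDiff.extDeriv {α : E → E [⋀^Fin k]→L[ℝ] ℝ} (hα : ContDiff ℝ ∞ α) :
    ContDiff ℝ ∞ (extDeriv α) :=
  (alternatizeUncurryFinCLM ℝ E ℝ).contDiff.comp (hα.fderiv_right (by simp))

theorem alternatizeUncurryFin_compContinuousLinearMapCLM (Φ : E →L[ℝ] E)
    (D : E →L[ℝ] E [⋀^Fin k]→L[ℝ] ℝ) :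
    alternatizeUncurryFin (compContinuousLinearMapCLM Φ ∘L D ∘L Φ) =
      (alternatizeUncurryFin D).compContinuousLinearMap Φ := by
  ext v
  simp +unfoldPartialApp [alternatizeUncurryFin_apply, Fin.removeNth, Function.comp_def]

theorem hasFDerivAt_homotopyIntegrand (c : E) (L : E →L[ℝ] E) {α : E → E [⋀^Fin (k + 1)]→L[ℝ] ℝ}
    (hα : ContDiff ℝ ∞ α) (x : E) (s : ℝ) :
    HasFDerivAt (fun y => homotopyIntegrand c L α y s)
      (compContinuousLinearMapCLM (L + s • (.id ℝ E - L)) ∘L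
        (((curryLeftCLM E k).flip (x - (c + L x))) ∘L
          fderiv ℝ α (c + L x + s • (x - (c + L x))) ∘L (L + s • (.id ℝ E - L)) +
          curryLeftCLM E k (α (c + L x + s • (x - (c + L x)))) ∘L (.id ℝ E - L))) x := by
  have hαd : HasFDerivAt α (fderiv ℝ α (c + L x + s • (x - (c + L x))))
    (c + L x + s • (x - (c + L x))) := (hα.differentiable (by simp) _).hasFDerivAt
  have hL : HasFDerivAt (fun y => c + L y) L x := L.hasFDerivAt.const_add c
  have hQ : HasFDerivAt (fun y => y - (c + L y)) (.id ℝ E - L) x := (hasFDerivAt_id x).sub hL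
  have hH' : HasFDerivAt (fun y => c + L y + s • (y - (c + L y))) (L + s • (.id ℝ E - L)) x :=
    hL.add (hQ.const_smul s)
  exact (compContinuousLinearMapCLM (L + s • (.id ℝ E - L))).hasFDerivAt.comp x
    (hasFDerivAt_curryLeftCLM_apply (hαd.comp x hH') hQ)

theorem hasDerivAt_compContinuousLinearMap_homotopy (c : E) (L : E →L[ℝ] E)
    {α : E → E [⋀^Fin (k + 1)]→L[ℝ] ℝ} (hα : ContDiff ℝ ∞ α) (x : E) (s : ℝ) :
    HasDerivAt (fun s : ℝ => (α (c + L x + s • (x - (c + L x)))).compContinuousLinearMap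
        (L + s • (.id ℝ E - L)))
      (compContinuousLinearMapCLM (L + s • (.id ℝ E - L))
        (fderiv ℝ α (c + L x + s • (x - (c + L x))) (x - (c + L x))) +
        (α (c + L x + s • (x - (c + L x)))).fderivCompContinuousLinearMap
          (L + s • (.id ℝ E - L)) (.id ℝ E - L)) s := by
  have hαd : HasFDerivAt α (fderiv ℝ α (c + L x + s • (x - (c + L x))))
    (c + L x + s • (x - (c + L x))) := (hα.differentiable (by simp) _).hasFDerivAt
  have hHs : HasDerivAt (fun s : ℝ => c + L x + s • (x - (c + L x))) (x - (c + L x)) s := by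
    have h := ((hasDerivAt_id s).smul_const (x - (c + L x))).const_add (c + L x)
    rw [one_smul] at h
    exact h
  have hΦs : HasDerivAt (fun s : ℝ => L + s • (.id ℝ E - L)) (.id ℝ E - L) s := by
    have h := ((hasDerivAt_id s).smul_const (ContinuousLinearMap.id ℝ E - L)).const_add L
    rw [one_smul] at h
    exact h
  have h7 := HasFDerivAt.continuousAlternatingMapCompContinuousLinearMap
    (hαd.comp s hHs.hasFDerivAt) hΦs.hasFDerivAt
  refine h7.hasDerivAt.congr_deriv ?_
  simp

/-- Cartan's formula along the homotopy `H_s`: the right-hand side is the `s`-derivative of `H_s^*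
α`. Its first term comes from moving the base point, its second from changing the differential of
`H_s`. -/
theorem alternatizeUncurryFin_fderiv_homotopyIntegrand (c : E) (L : E →L[ℝ] E)
    {α : E → E [⋀^Fin (k + 1)]→L[ℝ] ℝ} (hα : ContDiff ℝ ∞ α) (x : E) (s : ℝ) :
    alternatizeUncurryFin (fderiv ℝ (fun y => homotopyIntegrand c L α y s) x) +
        homotopyIntegrand c L (extDeriv α) x s =
      compContinuousLinearMapCLM (L + s • (.id ℝ E - L))
        (fderiv ℝ α (c + L x + s • (x - (c + L x))) (x - (c + L x))) +
        (α (c + L x + s • (x - (c + L x)))).fderivCompContinuousLinearMap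
          (L + s • (.id ℝ E - L)) (.id ℝ E - L) := by
  rw [(hasFDerivAt_homotopyIntegrand c L hα x s).fderiv]
  unfold homotopyIntegrand
  -- What remains is linear algebra at one point, in which the formulas for `H_s`, its differential
  -- and its velocity play no role.
  generalize hΦ : L + s • (.id ℝ E - L) = Φ
  generalize hH : c + L x + s • (x - (c + L x)) = H
  generalize x - (c + L x) = q
  have h1 := alternatizeUncurryFin_compContinuousLinearMapCLM Φ
    ((curryLeftCLM E k).flip q ∘L fderiv ℝ α H)
  rw [ContinuousLinearMap.comp_assoc] at h1
  rw [ContinuousLinearMap.comp_add, alternatizeUncurryFin_add, h1,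
    curryLeftCLM_apply (extDeriv α H), extDeriv, curryLeft_alternatizeUncurryFin,
    fderivCompContinuousLinearMap_eq_alternatizeUncurryFin]
  ext v
  simp only [ContinuousAlternatingMap.add_apply, ContinuousAlternatingMap.sub_apply,
    ContinuousAlternatingMap.compContinuousLinearMap_apply,
    ContinuousAlternatingMap.compContinuousLinearMapCLM_apply]
  change _ + alternatizeUncurryFin (compContinuousLinearMapCLM Φ ∘L
    (α H).curryLeft ∘L (.id ℝ E - L)) v + _ =
    _ + alternatizeUncurryFin (compContinuousLinearMapCLM Φ ∘L
    (α H).curryLeft ∘L (.id ℝ E - L)) v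
  ring

/-- The homotopy formula. -/
theorem extDeriv_homotopyOp (c : E) (L : E →L[ℝ] E) {α : E → E [⋀^Fin (k + 1)]→L[ℝ] ℝ}
    (hα : ContDiff ℝ ∞ α) (x : E) :
    extDeriv (homotopyOp c L α) x + homotopyOp c L (extDeriv α) x =
      α x - (α (c + L x)).compContinuousLinearMap L := by
  obtain ⟨hc3, h1⟩ := map_fderiv_intervalIntegral (f := homotopyIntegrand c L α)
    (contDiff_homotopyIntegrand c L hα) (alternatizeUncurryFinCLM ℝ E ℝ) x
  have hc2 : Continuous fun s : ℝ => homotopyIntegrand c L (extDeriv α) x s :=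
    Continuous.comp (g := fun z : E × ℝ => homotopyIntegrand c L (extDeriv α) z.1 z.2)
      (f := fun s : ℝ => (x, s)) (contDiff_homotopyIntegrand c L hα.extDeriv).continuous
      (continuous_const.prodMk continuous_id)
  change Continuous fun s : ℝ =>
      alternatizeUncurryFin (fderiv ℝ (fun y => homotopyIntegrand c L α y s) x) at hc3
  change extDeriv (homotopyOp c L α) x = ∫ s in (0 : ℝ)..1,
      alternatizeUncurryFin (fderiv ℝ (fun y => homotopyIntegrand c L α y s) x) at h1
  -- The fundamental theorem of calculus in `s`: the homotopy is the identity at `s = 1` and the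
  -- affine map `c + L` at `s = 0`.
  have h11 := fun s => (hasDerivAt_compContinuousLinearMap_homotopy c L hα x s).congr_deriv
    (alternatizeUncurryFin_fderiv_homotopyIntegrand c L hα x s).symm
  rw [h1, homotopyOp, ← intervalIntegral.integral_add (hc3.intervalIntegrable _ _)
    (hc2.intervalIntegrable _ _),
    intervalIntegral.integral_eq_sub_of_hasDerivAt (fun s _ => h11 s)
    ((hc3.add hc2).intervalIntegrable _ _)]
  simp only [one_smul, zero_smul, add_zero, add_sub_cancel]
  rfl

end HomotopyOperator

/-! ### Local primitives and the Poincaré lemma on a manifold. -/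

section LocalPrimitive

theorem homotopyOp_eq_zero {E : Type} [NormedAddCommGroup E] [NormedSpace ℝ E]
    [FiniteDimensional ℝ E] {k : ℕ} {c : E} {L : E →L[ℝ] E} {α : E → E [⋀^Fin (k + 1)]→L[ℝ] ℝ}
    {x : E} (h : ∀ s ∈ Set.Icc (0 : ℝ) 1, homotopyIntegrand c L α x s = 0) :
    homotopyOp c L α x = 0 := by
  rw [homotopyOp, intervalIntegral.integral_congr (g := fun _ => 0), intervalIntegral.integral_zero]
  intro s hs
  rw [Set.uIcc_of_le zero_le_one] at hs
  exact h s hs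

variable {n k : ℕ} {X : Type*} [TopologicalSpace X]
  [ChartedSpace (EuclideanSpace ℝ (Fin n)) X] [IsManifold (𝓡 n) ∞ X]

theorem formPullback_localRep {e : OpenPartialHomeomorph X (EuclideanSpace ℝ (Fin n))}
    (he : ContMDiffOn (𝓡 n) (𝓡 n) ∞ e e.source)
    (he' : ContMDiffOn (𝓡 n) (𝓡 n) ∞ e.symm e.target)
    (α : (x : X) → TangentSpace (𝓡 n) x [⋀^Fin k]→L[ℝ] ℝ) {x : X} (hx : x ∈ e.source) :
    formPullback e (localRep e α) x = α x := by
  have h1 : MDifferentiableAt (𝓡 n) (𝓡 n) e x :=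
    (he.contMDiffAt (e.open_source.mem_nhds hx)).mdifferentiableAt (by simp)
  have h2 : MDifferentiableAt (𝓡 n) (𝓡 n) e.symm (e x) :=
    (he'.contMDiffAt (e.open_target.mem_nhds (e.map_source hx))).mdifferentiableAt (by simp)
  have h3 : e.symm ∘ e =ᶠ[𝓝 x] id := by
    filter_upwards [e.open_source.mem_nhds hx] with w hw using e.left_inv hw
  rw [localRep_eq_formPullback_symm, ← formPullback_comp h2 h1, formPullback_congr h3,
    formPullback_id]

/-- A local primitive of a form along the affine contraction `y ↦ c + L y` in a chart. -/
theorem exists_local_homotopy_primitive {e : OpenPartialHomeomorph X (EuclideanSpace ℝ (Fin n))}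
    (he : ContMDiffOn (𝓡 n) (𝓡 n) ∞ e e.source)
    (he' : ContMDiffOn (𝓡 n) (𝓡 n) ∞ e.symm e.target)
    {c : EuclideanSpace ℝ (Fin n)} {L : EuclideanSpace ℝ (Fin n) →L[ℝ] EuclideanSpace ℝ (Fin n)}
    {y₀ : EuclideanSpace ℝ (Fin n)} (hy₀ : y₀ ∈ e.target) (hp : c + L y₀ = y₀) :
    ∃ r > 0, (∀ y ∈ Metric.ball y₀ r, ∀ s ∈ Set.Icc (0 : ℝ) 1,
        c + L y + s • (y - (c + L y)) ∈ e.target) ∧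
      ∀ α : (x : X) → TangentSpace (𝓡 n) x [⋀^Fin (k + 1)]→L[ℝ] ℝ, (∀ x, SmoothFormAt α x) →
      ∃ β : (x : X) → TangentSpace (𝓡 n) x [⋀^Fin k]→L[ℝ] ℝ,
      (∀ x ∈ e.source, SmoothFormAt β x) ∧ ∀ x ∈ e.source, e x ∈ Metric.ball y₀ r →
        ((∀ s ∈ Set.Icc (0 : ℝ) 1,
            extDerivAt α (e.symm (c + L (e x) + s • (e x - (c + L (e x))))) = 0) →
          (localRep e α (c + L (e x))).compContinuousLinearMap L = 0 →
            extDerivAt β x = α x) ∧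
        ((∀ s ∈ Set.Icc (0 : ℝ) 1, α (e.symm (c + L (e x) + s • (e x - (c + L (e x))))) = 0) →
          β x = 0) ∧
        (c + L (e x) = e x → β x = 0) := by
  have hsymm : ∀ y ∈ e.target, ContMDiffAt (𝓡 n) (𝓡 n) ∞ e.symm y := fun y hy =>
    he'.contMDiffAt (e.open_target.mem_nhds hy)
  obtain ⟨R, hR, hRe⟩ := Metric.isOpen_iff.1 e.open_target y₀ hy₀
  -- The homotopy operator acts on forms on the whole space, so the representative is cut off inside
  -- `e.target`. Nothing changes on the ball of radius `R / 3`, which will contain all segments in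
  -- use.
  let χ : ContDiffBump y₀ := ⟨R / 3, R / 2, by positivity, by linarith⟩
  have hχin : ∀ y ∈ Metric.ball y₀ (R / 3), χ =ᶠ[𝓝 y] fun _ => 1 := by
    intro y hy
    filter_upwards [Metric.isOpen_ball.mem_nhds hy] with z hz
      using χ.one_of_mem_closedBall (Metric.ball_subset_closedBall hz)
  have hcont : Continuous fun z : EuclideanSpace ℝ (Fin n) × ℝ =>
      c + L z.1 + z.2 • (z.1 - (c + L z.1)) := by fun_prop
  -- The segment from `y₀` to its image is the single point `y₀`; compactness of `[0, 1]` then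
  -- confines the segments of nearby points.
  obtain ⟨r, hr, hrR⟩ : ∃ r > 0, ∀ y ∈ Metric.ball y₀ r, ∀ s ∈ Set.Icc (0 : ℝ) 1,
      c + L y + s • (y - (c + L y)) ∈ Metric.ball y₀ (R / 3) := by
    have h1 : ∀ s ∈ Set.Icc (0 : ℝ) 1, ∀ᶠ z : EuclideanSpace ℝ (Fin n) × ℝ in 𝓝 y₀ ×ˢ 𝓝 s,
        c + L z.1 + z.2 • (z.1 - (c + L z.1)) ∈ Metric.ball y₀ (R / 3) := by
      intro s _
      rw [← nhds_prod_eq]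
      refine hcont.continuousAt.eventually (Metric.isOpen_ball.mem_nhds ?_)
      simp only [hp, sub_self, smul_zero, add_zero]
      exact Metric.mem_ball_self (by positivity)
    have h2 := isCompact_Icc.eventually_forall_of_forall_eventually
      (P := fun y s => c + L y + s • (y - (c + L y)) ∈ Metric.ball y₀ (R / 3))
      (fun s hs => by simpa [nhds_prod_eq] using h1 s hs)
    exact Metric.eventually_nhds_iff_ball.1 h2
  have hball : Metric.ball y₀ (R / 3) ⊆ e.target :=
    (Metric.ball_subset_ball (by linarith)).trans hRe
  refine ⟨r, hr, fun y hy s hs => hball (hrR y hy s hs), fun α hα => ?_⟩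
  have hrep : ∀ y ∈ e.target, ContDiffAt ℝ ∞ (localRep e α) y := fun y hy =>
    smoothFormAt_euclidean_iff.1 (SmoothFormAt.formPullback (hsymm y hy) (hα _))
  have hdrep : ∀ y ∈ e.target, extDeriv (localRep e α) y = localRep e (extDerivAt α) y :=
    fun y hy => by
      rw [← extDerivAt_euclidean]
      exact extDerivAt_formPullback (hsymm y hy) (hα _)
  let a : EuclideanSpace ℝ (Fin n) → EuclideanSpace ℝ (Fin n) [⋀^Fin (k + 1)]→L[ℝ] ℝ :=
    fun y => χ y • localRep e α y
  have ha : ContDiff ℝ ∞ a := by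
    rw [contDiff_iff_contDiffAt]
    intro y
    by_cases hy : y ∈ e.target
    · exact χ.contDiffAt.smul (hrep y hy)
    · have h1 : y ∉ tsupport χ := by
        rw [χ.tsupport_eq]
        intro h
        exact hy (hRe (Metric.closedBall_subset_ball (by change R / 2 < R; linarith) h))
      have h2 := notMem_tsupport_iff_eventuallyEq.1 h1
      refine (contDiffAt_const (c := 0)).congr_of_eventuallyEq ?_
      filter_upwards [h2] with z hz
      simp only [a, hz, Pi.zero_apply, zero_smul]
  have haeq : ∀ y ∈ Metric.ball y₀ (R / 3), a =ᶠ[𝓝 y] localRep e α := by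
    intro y hy
    filter_upwards [hχin y hy] with z hz
    simp only [a, hz, one_smul]
  have hb := contDiff_homotopyOp c L ha
  have hex : ∀ x ∈ e.source, ContMDiffAt (𝓡 n) (𝓡 n) ∞ e x := fun x hx =>
    he.contMDiffAt (e.open_source.mem_nhds hx)
  have hbs : ∀ y, SmoothFormAt (X := EuclideanSpace ℝ (Fin n)) (homotopyOp c L a) y := fun y =>
    smoothFormAt_euclidean_iff.2 hb.contDiffAt
  refine ⟨formPullback e (homotopyOp c L a),
    fun x hx => SmoothFormAt.formPullback (hex x hx) (hbs _), fun x hx hxr => ⟨?_, ?_, ?_⟩⟩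
  · intro hd hL
    have h0 : c + L (e x) ∈ Metric.ball y₀ (R / 3) := by
      simpa using hrR _ hxr 0 ⟨le_rfl, zero_le_one⟩
    have h1 : e x ∈ Metric.ball y₀ (R / 3) := by
      simpa using hrR _ hxr 1 ⟨zero_le_one, le_rfl⟩
    have hK : homotopyOp c L (extDeriv a) (e x) = 0 := by
      refine homotopyOp_eq_zero fun s hs => ?_
      have h2 := hrR _ hxr s hs
      have h3 : extDeriv a (c + L (e x) + s • (e x - (c + L (e x)))) = 0 := by
        rw [(haeq _ h2).extDeriv_eq, hdrep _ (hball h2)]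
        unfold localRep
        rw [hd s hs]
        rfl
      unfold homotopyIntegrand
      rw [h3, map_zero]
      rfl
    have h4 := extDeriv_homotopyOp c L ha (e x)
    rw [hK, add_zero, (haeq _ h0).self_of_nhds, hL, sub_zero, (haeq _ h1).self_of_nhds] at h4
    rw [extDerivAt_formPullback (hex x hx) (hbs _)]
    have h5 : formPullback e (extDerivAt (X := EuclideanSpace ℝ (Fin n)) (homotopyOp c L a)) x =
        formPullback e (localRep e α) x := by
      unfold formPullback
      rw [extDerivAt_euclidean, h4]
    rw [h5, formPullback_localRep he he' α hx]
  · intro hz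
    have h6 : homotopyOp c L a (e x) = 0 := by
      refine homotopyOp_eq_zero fun s hs => ?_
      have h3 : a (c + L (e x) + s • (e x - (c + L (e x)))) = 0 := by
        simp only [a]
        unfold localRep
        rw [hz s hs]
        exact smul_zero _
      unfold homotopyIntegrand
      rw [h3, map_zero]
      rfl
    unfold formPullback
    rw [h6]
    rfl
  · intro hz
    have h6 : homotopyOp c L a (e x) = 0 := by
      refine homotopyOp_eq_zero fun s hs => ?_
      unfold homotopyIntegrand
      rw [hz, sub_self, map_zero]
      rfl
    unfold formPullback
    rw [h6]
    rfl

variable [T2Space X]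

theorem SmoothFormAt.smul_of_tsupport_subset {χ : X → ℝ} (hχ : ContMDiff (𝓡 n) 𝓘(ℝ, ℝ) ∞ χ)
    {β : (x : X) → TangentSpace (𝓡 n) x [⋀^Fin k]→L[ℝ] ℝ} {U : Set X} (hU : tsupport χ ⊆ U)
    (hβ : ∀ x ∈ U, SmoothFormAt β x) (x : X) : SmoothFormAt (fun y => χ y • β y) x := by
  by_cases hx : x ∈ tsupport χ
  · exact SmoothFormAt.smul hχ.contMDiffAt (hβ x (hU hx))
  · refine smoothFormAt_zero.congr ?_
    filter_upwards [notMem_tsupport_iff_eventuallyEq.1 hx] with z hz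
    rw [hz]
    exact zero_smul ℝ (β z)

theorem exists_smooth_cutoff (x : X) {U : Set X} (hU : U ∈ 𝓝 x) :
    ∃ χ : X → ℝ, ContMDiff (𝓡 n) 𝓘(ℝ, ℝ) ∞ χ ∧ tsupport χ ⊆ U ∧ IsCompact (tsupport χ) ∧
      (∀ᶠ y in 𝓝 x, χ y = 1) ∧ ∀ y, χ y ∈ Set.Icc (0 : ℝ) 1 := by
  obtain ⟨f, -, hf⟩ := (SmoothBumpFunction.nhds_basis_tsupport (I := 𝓡 n) x).mem_iff.1 hU
  exact ⟨f, f.contMDiff, hf, f.hasCompactSupport, f.eventuallyEq_one, fun y => ⟨f.nonneg, f.le_one⟩⟩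

/-- The Poincaré lemma: closed forms of positive degree are exact on a neighbourhood that does not
depend on the form. -/
theorem exists_local_primitive (k : ℕ) (x₀ : X) :
    ∃ V ∈ 𝓝 x₀, ∀ α : (x : X) → TangentSpace (𝓡 n) x [⋀^Fin (k + 1)]→L[ℝ] ℝ,
      (∀ x, SmoothFormAt α x) → (∀ x, extDerivAt α x = 0) →
      ∃ β : (x : X) → TangentSpace (𝓡 n) x [⋀^Fin k]→L[ℝ] ℝ, (∀ x, SmoothFormAt β x) ∧
        ∀ x ∈ V, extDerivAt β x = α x := by
  set e := chartAt (EuclideanSpace ℝ (Fin n)) x₀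
  have hx₀ : x₀ ∈ e.source := mem_chart_source _ _
  have hm : e ∈ IsManifold.maximalAtlas (𝓡 n) ∞ X := IsManifold.chart_mem_maximalAtlas x₀
  obtain ⟨r, hr, -, hr'⟩ := exists_local_homotopy_primitive (k := k) (c := e x₀) (L := 0)
    (contMDiffOn_of_mem_maximalAtlas hm) (contMDiffOn_symm_of_mem_maximalAtlas hm)
    (e.map_source hx₀) (by simp)
  obtain ⟨χ, hχ, hχs, -, hχ1, -⟩ := exists_smooth_cutoff (n := n) x₀ (e.open_source.mem_nhds hx₀)
  refine ⟨_, Filter.inter_mem (Filter.inter_mem hχ1.eventually_nhds (e.open_source.mem_nhds hx₀))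
    ((e.continuousAt hx₀).preimage_mem_nhds (Metric.ball_mem_nhds _ hr)), fun α hα hd => ?_⟩
  obtain ⟨β, hβ, hβ'⟩ := hr' α hα
  refine ⟨fun x => χ x • β x, SmoothFormAt.smul_of_tsupport_subset hχ hχs hβ, ?_⟩
  rintro x ⟨⟨h1, h2⟩, h3⟩
  have h4 : ∀ᶠ y in 𝓝 x, χ y • β y = β y := by
    filter_upwards [h1] with y hy
    rw [hy]
    exact one_smul ℝ (β y)
  rw [extDerivAt_congr h4]
  refine (hβ' x h2 h3).1 (fun s _ => hd _) ?_
  -- Here `L = 0`, and the pull-back of a form of positive degree by the zero map is zero.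
  ext v
  rw [ContinuousAlternatingMap.compContinuousLinearMap_apply]
  exact ContinuousAlternatingMap.map_coord_zero _ 0 rfl

/-- If two maps agree off a closed set which both send to a region where `α = dβ`, then their
pull-backs of `α` differ by an exact form. -/
theorem extDerivAt_formPullback_sub_formPullback
    {α : (x : X) → TangentSpace (𝓡 n) x [⋀^Fin (k + 1)]→L[ℝ] ℝ}
    {β : (x : X) → TangentSpace (𝓡 n) x [⋀^Fin k]→L[ℝ] ℝ} (hβ : ∀ x, SmoothFormAt β x)
    {g g' : X → X} {C : Set X} (hC : IsClosed C) (hgg' : ∀ x ∉ C, g x = g' x)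
    (hg : ∀ x ∈ C, extDerivAt β (g x) = α (g x)) (hg' : ∀ x ∈ C, extDerivAt β (g' x) = α (g' x))
    {x : X} (hs : ContMDiffAt (𝓡 n) (𝓡 n) ∞ g x) (hs' : ContMDiffAt (𝓡 n) (𝓡 n) ∞ g' x) :
    extDerivAt (formPullback g β - formPullback g' β) x =
      formPullback g α x - formPullback g' α x := by
  by_cases hx : x ∈ C
  · rw [extDerivAt_sub (SmoothFormAt.formPullback hs (hβ _))
      (SmoothFormAt.formPullback hs' (hβ _)), extDerivAt_formPullback hs (hβ _),
      extDerivAt_formPullback hs' (hβ _)]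
    unfold formPullback
    rw [hg x hx, hg' x hx]
  · have h1 : g =ᶠ[𝓝 x] g' := by
      filter_upwards [hC.isOpen_compl.mem_nhds hx] with y hy using hgg' y hy
    have h2 : ∀ᶠ y in 𝓝 x, (formPullback g β - formPullback g' β) y =
        (0 : (x : X) → TangentSpace (𝓡 n) x [⋀^Fin k]→L[ℝ] ℝ) y := by
      filter_upwards [h1.eventually_nhds] with y hy
      rw [Pi.sub_apply, formPullback_congr hy, sub_self]
      rfl
    rw [extDerivAt_congr h2, extDerivAt_zero, formPullback_congr h1, sub_self]

end LocalPrimitive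

/-! ### Straightening the boundary. -/

section BoundaryChart

variable {n : ℕ} {X : Type*} [TopologicalSpace X]
  [ChartedSpace (EuclideanSpace ℝ (Fin n)) X]

/-- A smooth chart `e` in which `Ω` is the half space `{ℓ < 0}`; the vector `w` points outwards. -/
structure IsBoundaryChart (Ω : Set X) (e : OpenPartialHomeomorph X (EuclideanSpace ℝ (Fin n)))
    (ℓ : EuclideanSpace ℝ (Fin n) →L[ℝ] ℝ) (w : EuclideanSpace ℝ (Fin n)) : Prop where
  contMDiffOn : ContMDiffOn (𝓡 n) (𝓡 n) ∞ e e.source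
  contMDiffOn_symm : ContMDiffOn (𝓡 n) (𝓡 n) ∞ e.symm e.target
  apply_normal : ℓ w = 1
  mem_iff : ∀ y ∈ e.source, y ∈ Ω ↔ ℓ (e y) < 0

namespace IsBoundaryChart

variable {Ω : Set X} {e : OpenPartialHomeomorph X (EuclideanSpace ℝ (Fin n))}
  {ℓ : EuclideanSpace ℝ (Fin n) →L[ℝ] ℝ} {w : EuclideanSpace ℝ (Fin n)}

theorem tendsto_symm_add_smul {y : X} (hy : y ∈ e.source) (w : EuclideanSpace ℝ (Fin n)) :
    Filter.Tendsto (fun t : ℝ => e.symm (e y + t • w)) (𝓝 0) (𝓝 y) ∧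
      ∀ᶠ t : ℝ in 𝓝 0, e y + t • w ∈ e.target := by
  have h1 : Filter.Tendsto (fun t : ℝ => e y + t • w) (𝓝 0) (𝓝 (e y)) := by
    have : Continuous fun t : ℝ => e y + t • w := by fun_prop
    simpa using this.tendsto 0
  exact ⟨(e.tendsto_symm hy).comp h1, h1.eventually (e.open_target.mem_nhds (e.map_source hy))⟩

theorem mem_frontier_iff (h : IsBoundaryChart Ω e ℓ w) (hΩ : IsOpen Ω) {y : X}
    (hy : y ∈ e.source) : y ∈ frontier Ω ↔ ℓ (e y) = 0 := by
  rw [hΩ.frontier_eq]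
  constructor
  · rintro ⟨h1, h2⟩
    rw [h.mem_iff y hy, not_lt] at h2
    refine le_antisymm (not_lt.1 fun h3 => ?_) h2
    have h4 : ∀ᶠ z in 𝓝 y, 0 < ℓ (e z) :=
      (ℓ.continuous.continuousAt.comp (e.continuousAt hy)).eventually_const_lt h3
    obtain ⟨z, hz, hzΩ⟩ := mem_closure_iff_nhds.1 h1 _
      (Filter.inter_mem h4 (e.open_source.mem_nhds hy))
    exact absurd ((h.mem_iff z hz.2).1 hzΩ) (not_lt.2 (le_of_lt hz.1))
  · intro h1
    refine ⟨?_, fun h2 => absurd ((h.mem_iff y hy).1 h2) (by simp [h1])⟩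
    obtain ⟨h2, h3⟩ := tendsto_symm_add_smul hy w
    refine mem_closure_of_tendsto (h2.mono_left (nhdsWithin_le_nhds (s := Set.Iio 0))) ?_
    filter_upwards [nhdsWithin_le_nhds h3, self_mem_nhdsWithin] with t ht ht0
    rw [h.mem_iff _ (e.map_target ht), e.right_inv ht]
    simpa [h1, h.apply_normal] using ht0

/-- A small step along `w` makes `ℓ` positive, and this persists nearby. -/
theorem frequently_mem_interior (h : IsBoundaryChart Ω e ℓ w) {y : X}
    (hy : y ∈ e.source) (hyΩ : y ∉ Ω) : ∃ᶠ z in 𝓝 y, z ∈ interior Ωᶜ := by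
  have hy0 : 0 ≤ ℓ (e y) := not_lt.1 fun h1 => hyΩ ((h.mem_iff y hy).2 h1)
  obtain ⟨h2, h3⟩ := tendsto_symm_add_smul hy w
  refine Filter.Tendsto.frequently (h2.mono_left (nhdsWithin_le_nhds (s := Set.Ioi 0)))
    (Filter.Eventually.frequently ?_)
  filter_upwards [nhdsWithin_le_nhds h3, self_mem_nhdsWithin] with t ht ht0
  have h4 : e.symm (e y + t • w) ∈ e.source := e.map_target ht
  have h5 : 0 < ℓ (e (e.symm (e y + t • w))) := by
    rw [e.right_inv ht]
    simp only [map_add, map_smul, h.apply_normal, smul_eq_mul, mul_one]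
    exact add_pos_of_nonneg_of_pos hy0 ht0
  rw [mem_interior_iff_mem_nhds]
  filter_upwards [(ℓ.continuous.continuousAt.comp (e.continuousAt h4)).eventually_const_lt h5,
    e.open_source.mem_nhds h4] with z hz hz2
  rw [Set.mem_compl_iff, h.mem_iff z hz2]
  exact not_lt.2 (le_of_lt hz)

end IsBoundaryChart

variable [IsManifold (𝓡 n) ∞ X]

/-- The inverse function theorem makes the defining function `ρ` a linear coordinate `ℓ`. -/
theorem exists_isBoundaryChart {Ω : Set X} (hΩ : IsOpen Ω) (hb : HasSmoothBoundary n Ω) {x : X}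
    (hx : x ∈ frontier Ω) {N : Set X} (hN : N ∈ 𝓝 x) :
    ∃ e ℓ w, IsBoundaryChart (n := n) Ω e ℓ w ∧ x ∈ e.source ∧ e.source ⊆ N ∧ e x = 0 := by
  obtain ⟨U, hU, hxU, ρ, hρ, hdρ, hΩU⟩ := hb x hx
  set e₀ := chartAt (EuclideanSpace ℝ (Fin n)) x with he₀
  have hm : e₀ ∈ IsManifold.maximalAtlas (𝓡 n) ∞ X := IsManifold.chart_mem_maximalAtlas x
  have hxs : x ∈ e₀.source := mem_chart_source _ x
  have hsm := contMDiffOn_of_mem_maximalAtlas hm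
  have hsm' := contMDiffOn_symm_of_mem_maximalAtlas hm
  have hmemU : ∀ y ∈ U, y ∈ Ω ↔ ρ y < 0 := fun y hy => by
    have := Set.ext_iff.1 hΩU y
    simpa [hy] using this
  have hρx : ρ x = 0 := by
    rw [hΩ.frontier_eq] at hx
    refine le_antisymm (not_lt.1 fun h3 => ?_) (not_lt.1 fun h => hx.2 ((hmemU x hxU).2 h))
    have h4 : ∀ᶠ z in 𝓝 x, 0 < ρ z :=
      (hρ.contMDiffAt (hU.mem_nhds hxU)).continuousAt.eventually_const_lt h3
    obtain ⟨z, hz, hzΩ⟩ := mem_closure_iff_nhds.1 hx.1 _ (Filter.inter_mem h4 (hU.mem_nhds hxU))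
    exact absurd ((hmemU z hz.2).1 hzΩ) (not_lt.2 (le_of_lt hz.1))
  set z₀ := e₀ x with hz₀
  obtain ⟨N', hN'N, hN', hxN'⟩ := mem_nhds_iff.1 hN
  set T := e₀.target ∩ e₀.symm ⁻¹' (U ∩ N') with hT
  have hTo : IsOpen T := e₀.isOpen_inter_preimage_symm (hU.inter hN')
  have hzT : z₀ ∈ T := ⟨e₀.map_source hxs, by
    simp only [Set.mem_preimage, hz₀, e₀.left_inv hxs]
    exact ⟨hxU, hxN'⟩⟩
  set r : EuclideanSpace ℝ (Fin n) → ℝ := ρ ∘ e₀.symm with hr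
  have hrT : ContDiffOn ℝ ∞ r T := by
    rw [← contMDiffOn_iff_contDiffOn]
    exact hρ.comp (hsm'.mono Set.inter_subset_left) fun z hz => hz.2.1
  have hrz : ∀ z ∈ T, ContDiffAt ℝ ∞ r z := fun z hz => hrT.contDiffAt (hTo.mem_nhds hz)
  set ℓ := fderiv ℝ r z₀ with hℓ
  have hℓ0 : ℓ ≠ 0 := by
    intro h0
    apply hdρ
    have h1 : MDifferentiableAt (𝓡 n) 𝓘(ℝ, ℝ) r z₀ :=
      ((hrz z₀ hzT).differentiableAt (by simp)).mdifferentiableAt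
    have h2 : MDifferentiableAt (𝓡 n) (𝓡 n) e₀ x :=
      (hsm.contMDiffAt (e₀.open_source.mem_nhds hxs)).mdifferentiableAt (by simp)
    have h3 : ρ =ᶠ[𝓝 x] r ∘ e₀ := by
      filter_upwards [e₀.open_source.mem_nhds hxs] with y hy
      simp [hr, e₀.left_inv hy]
    have h4 : mfderiv (𝓡 n) 𝓘(ℝ, ℝ) (r ∘ e₀) x = 0 := by
      have h5 := mfderiv_comp (f := e₀) (g := r) (I' := 𝓡 n) x h1 h2
      refine h5.trans ?_
      rw [mfderiv_eq_fderiv, ← hz₀, ← hℓ, h0]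
      rfl
    exact h3.mfderiv_eq.trans h4
  obtain ⟨v, hv⟩ : ∃ v, ℓ v ≠ 0 := by
    by_contra! h
    exact hℓ0 (ContinuousLinearMap.ext h)
  set w := (ℓ v)⁻¹ • v with hw
  have hℓw : ℓ w = 1 := by simp [hw, hv]
  -- The correction along `w` replaces the `ℓ`-component of `z - z₀` by `r z`. It vanishes to first
  -- order at `z₀`, so the differential of `Ψ` there is the identity.
  set Ψ : EuclideanSpace ℝ (Fin n) → EuclideanSpace ℝ (Fin n) :=
    fun z => z - z₀ + (r z - ℓ (z - z₀)) • w with hΨ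
  have hΨT : ∀ z ∈ T, ContDiffAt ℝ ∞ Ψ z := by
    intro z hz
    have := hrz z hz
    fun_prop
  have hℓΨ : ∀ z, ℓ (Ψ z) = r z := fun z => by simp [hΨ, hℓw]
  have hdΨ : HasFDerivAt Ψ ((ContinuousLinearEquiv.refl ℝ (EuclideanSpace ℝ (Fin n)) :
      EuclideanSpace ℝ (Fin n) →L[ℝ] EuclideanSpace ℝ (Fin n))) z₀ := by
    have h1 : HasFDerivAt r ℓ z₀ := ((hrz z₀ hzT).differentiableAt (by simp)).hasFDerivAt
    have h2 : HasFDerivAt (fun z => z - z₀) (.id ℝ (EuclideanSpace ℝ (Fin n))) z₀ :=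
      (hasFDerivAt_id z₀).sub_const z₀
    have h3 := h2.add ((h1.sub (ℓ.hasFDerivAt.comp z₀ h2)).smul_const w)
    refine h3.congr_fderiv ?_
    ext u
    simp
  set Φ := (hΨT z₀ hzT).toOpenPartialHomeomorph Ψ hdΨ (by simp) with hΦ
  have hΦΨ : ∀ z, Φ z = Ψ z := fun z => rfl
  have hzΦ : z₀ ∈ Φ.source := (hΨT z₀ hzT).mem_toOpenPartialHomeomorph_source hdΨ (by simp)
  -- The inverse is smooth at the image of a point where the differential is invertible; restricting
  -- to `W` gives this on the whole target.
  set W := T ∩ fderiv ℝ Ψ ⁻¹' (Set.range ((↑) :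
    (EuclideanSpace ℝ (Fin n) ≃L[ℝ] EuclideanSpace ℝ (Fin n)) →
      EuclideanSpace ℝ (Fin n) →L[ℝ] EuclideanSpace ℝ (Fin n))) with hW
  have hWo : IsOpen W := by
    refine ContinuousOn.isOpen_inter_preimage (fun z hz => ?_) hTo (ContinuousLinearEquiv.isOpen)
    exact ((hΨT z hz).fderiv_right (m := 0) (by simp)).continuousAt.continuousWithinAt
  have hzW : z₀ ∈ W := ⟨hzT, by rw [Set.mem_preimage, hdΨ.fderiv]; exact ⟨_, rfl⟩⟩
  set Φ' := Φ.restrOpen W hWo with hΦ'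
  have hΦ's : Φ'.source = Φ.source ∩ W := Φ.restrOpen_source W hWo
  have hΦ'c : ContDiffOn ℝ ∞ Φ' Φ'.source := fun z hz => by
    rw [hΦ's] at hz
    exact (hΨT z hz.2.1).contDiffWithinAt
  have hΦ'c' : ContDiffOn ℝ ∞ Φ'.symm Φ'.target := fun z hz => by
    have h1 : Φ'.symm z ∈ Φ'.source := Φ'.map_target hz
    rw [hΦ's] at h1
    obtain ⟨f', hf'⟩ := h1.2.2
    have h2 := hΨT _ h1.2.1
    refine (Φ'.contDiffAt_symm hz (f₀' := f') ?_ h2).contDiffWithinAt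
    rw [hf']
    exact (h2.differentiableAt (by simp)).hasFDerivAt
  have hsub : ∀ y ∈ (e₀.trans Φ').source, y ∈ e₀.source ∧ e₀ y ∈ Φ'.source := fun y hy => by
    simpa [OpenPartialHomeomorph.trans_source] using hy
  have hsub2 : ∀ y ∈ (e₀.trans Φ').source, y ∈ U ∩ N' := fun y hy => by
    obtain ⟨h1, h2⟩ := hsub y hy
    rw [hΦ's] at h2
    have h3 := h2.2.1.2
    rwa [Set.mem_preimage, e₀.left_inv h1] at h3
  have hval : ∀ y ∈ (e₀.trans Φ').source, ℓ ((e₀.trans Φ') y) = ρ y := fun y hy => by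
    change ℓ (Ψ (e₀ y)) = ρ y
    rw [hℓΨ, hr, Function.comp_apply, e₀.left_inv (hsub y hy).1]
  refine ⟨e₀.trans Φ', ℓ, w, ⟨?_, ?_, hℓw, fun y hy => ?_⟩, ?_, fun y hy => hN'N (hsub2 y hy).2, ?_⟩
  · exact hΦ'c.contMDiffOn.comp (hsm.mono fun y hy => (hsub y hy).1) fun y hy => (hsub y hy).2
  · refine hsm'.comp (hΦ'c'.contMDiffOn.mono fun y hy => ?_) fun y hy => ?_
    · simp only [OpenPartialHomeomorph.trans_target] at hy
      exact hy.1
    · simp only [OpenPartialHomeomorph.trans_target] at hy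
      exact hy.2
  · rw [hval y hy, hmemU y (hsub2 y hy).1]
  · simp only [OpenPartialHomeomorph.trans_source, Set.mem_inter_iff, Set.mem_preimage]
    refine ⟨hxs, ?_⟩
    rw [hΦ's]
    exact ⟨hzΦ, hzW⟩
  · change Ψ z₀ = 0
    simp [hΨ, hr, hz₀, e₀.left_inv hxs, hρx]

theorem frequently_mem_interior_compl {Ω : Set X} (hΩ : IsOpen Ω) (hb : HasSmoothBoundary n Ω)
    {x : X} (hx : x ∉ Ω) : ∃ᶠ y in 𝓝 x, y ∈ interior Ωᶜ := by
  by_cases hxf : x ∈ frontier Ω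
  · obtain ⟨e, ℓ, w, h, hxe, -, -⟩ := exists_isBoundaryChart hΩ hb hxf Filter.univ_mem
    exact h.frequently_mem_interior hxe hx
  · have h1 : x ∈ interior Ωᶜ := by
      rw [interior_compl]
      exact fun h2 => hxf (by rw [hΩ.frontier_eq]; exact ⟨h2, hx⟩)
    exact Filter.Eventually.frequently (isOpen_interior.mem_nhds h1)

end BoundaryChart

/-! ### The relative Poincaré lemma on the outer side of the boundary. -/

section Collar

variable {n k : ℕ} {X : Type*} [TopologicalSpace X]
  [ChartedSpace (EuclideanSpace ℝ (Fin n)) X] [IsManifold (𝓡 n) ∞ X]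

theorem smoothFormAt_extDerivAt {α : (x : X) → TangentSpace (𝓡 n) x [⋀^Fin k]→L[ℝ] ℝ}
    (hα : ∀ x, SmoothFormAt α x) (x : X) : SmoothFormAt (extDerivAt α) x :=
  mem_smoothForm_iff.1 (extD n X k ⟨α, mem_smoothForm_iff.2 hα⟩).2 x

theorem extDerivAt_extDerivAt {α : (x : X) → TangentSpace (𝓡 n) x [⋀^Fin k]→L[ℝ] ℝ}
    (hα : ∀ x, SmoothFormAt α x) (x : X) : extDerivAt (extDerivAt α) x = 0 :=
  congrFun (congrArg Subtype.val (extD_extD (⟨α, mem_smoothForm_iff.2 hα⟩ : SmoothForm n X k))) x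

/-- The restriction of the form `α` to the subset `F` is zero. -/
def VanishesAlong (F : Set X) (α : (x : X) → TangentSpace (𝓡 n) x [⋀^Fin k]→L[ℝ] ℝ) : Prop :=
  ∀ x ∈ F, ∀ v : Fin k → TangentSpace (𝓡 n) x, (∀ i, v i ∈ tangentSpaceOf n F x) → α x v = 0

/-- Tangent spaces of subsets are read in the preferred chart. The differential of the chart change
carries the tangent cone of the hyperplane `ℓ = 0` into that of the boundary. -/
theorem IsBoundaryChart.mfderiv_symm_mem_tangentSpaceOf {Ω : Set X}
    {e : OpenPartialHomeomorph X (EuclideanSpace ℝ (Fin n))}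
    {ℓ : EuclideanSpace ℝ (Fin n) →L[ℝ] ℝ} {w : EuclideanSpace ℝ (Fin n)}
    (h : IsBoundaryChart Ω e ℓ w) (hΩ : IsOpen Ω) {y : EuclideanSpace ℝ (Fin n)}
    (hy : y ∈ e.target) (hℓy : ℓ y = 0) {u : EuclideanSpace ℝ (Fin n)} (hu : ℓ u = 0) :
    mfderiv (𝓡 n) (𝓡 n) e.symm y u ∈ tangentSpaceOf n (frontier Ω) (e.symm y) := by
  set f := chartAt (EuclideanSpace ℝ (Fin n)) (e.symm y) with hf
  have hyf : e.symm y ∈ f.source := mem_chart_source _ _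
  have hm : MDifferentiableAt (𝓡 n) (𝓡 n) e.symm y :=
    (h.contMDiffOn_symm.contMDiffAt (e.open_target.mem_nhds hy)).mdifferentiableAt (by simp)
  have h1 : HasFDerivAt (f ∘ e.symm) (mfderiv (𝓡 n) (𝓡 n) e.symm y :
      EuclideanSpace ℝ (Fin n) →L[ℝ] EuclideanSpace ℝ (Fin n)) y := by
    have h2 := hm.hasMFDerivAt.2
    simp only [mfld_simps, writtenInExtChartAt] at h2
    exact hasFDerivWithinAt_univ.1 h2
  set s := (e.target ∩ e.symm ⁻¹' f.source) ∩ {z | ℓ z = 0} with hs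
  have h3 : u ∈ tangentConeAt ℝ s y := by
    refine mem_tangentConeAt_of_add_smul_mem (l := 𝓝[≠] (0 : ℝ)) (c := id) Filter.tendsto_id ?_
    have h4 : Filter.Tendsto (fun t : ℝ => y + t • u) (𝓝 0) (𝓝 y) := by
      have : Continuous fun t : ℝ => y + t • u := by fun_prop
      simpa using this.tendsto 0
    filter_upwards [nhdsWithin_le_nhds (h4.eventually ((e.isOpen_inter_preimage_symm
      f.open_source).mem_nhds ⟨hy, hyf⟩))] with t ht
    exact ⟨ht, by simp [hℓy, hu]⟩
  have h5 := h1.hasFDerivWithinAt.mapsTo_tangent_cone h3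
  refine Submodule.subset_span (tangentConeAt_mono ?_ h5)
  rintro _ ⟨z, ⟨⟨hz1, hz2⟩, hz3⟩, rfl⟩
  refine ⟨f.map_source hz2, ?_⟩
  simp only [Function.comp_apply, Set.mem_preimage]
  rw [f.left_inv hz2, h.mem_frontier_iff hΩ (e.map_target hz1), e.right_inv hz1]
  exact hz3

/-- The derivative vanishes at interior points of the complement. These accumulate at every point
off `Ω`, and the derivative is continuous. -/
theorem eventually_extDerivAt_eq_zero {Ω : Set X} (hΩ : IsOpen Ω) (hb : HasSmoothBoundary n Ω)
    {κ : (x : X) → TangentSpace (𝓡 n) x [⋀^Fin k]→L[ℝ] ℝ} (hκ : ∀ x, SmoothFormAt κ x) {x : X}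
    (h : ∀ᶠ y in 𝓝 x, y ∉ Ω → κ y = 0) : ∀ᶠ y in 𝓝 x, y ∉ Ω → extDerivAt κ y = 0 := by
  filter_upwards [h.eventually_nhds] with y hy hyΩ
  refine (smoothFormAt_extDerivAt hκ y).eq_zero_of_frequently ?_
  refine ((frequently_mem_interior_compl hΩ hb hyΩ).and_eventually hy.eventually_nhds).mono ?_
  rintro z ⟨hz1, hz2⟩
  rw [extDerivAt_congr (β := 0), extDerivAt_zero]
  filter_upwards [hz2, isOpen_interior.mem_nhds hz1] with t ht1 ht2
  exact ht1 (interior_subset ht2)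

/-- One step of the collar argument: kill the form near a boundary point. -/
theorem exists_local_collar_primitive [T2Space X] {Ω : Set X} (hΩ : IsOpen Ω)
    (hb : HasSmoothBoundary n Ω) {N : Set X} {x₀ : X} (hx₀ : x₀ ∈ frontier Ω) (hN : N ∈ 𝓝 x₀) :
    ∃ t ∈ 𝓝 x₀, ∀ μ : (x : X) → TangentSpace (𝓡 n) x [⋀^Fin (k + 1)]→L[ℝ] ℝ,
      (∀ x, SmoothFormAt μ x) → (∀ x ∈ N, x ∉ Ω → extDerivAt μ x = 0) →
      VanishesAlong (frontier Ω) μ →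
      ∃ κ : (x : X) → TangentSpace (𝓡 n) x [⋀^Fin k]→L[ℝ] ℝ, (∀ x, SmoothFormAt κ x) ∧
        VanishesAlong (frontier Ω) (μ - extDerivAt κ) ∧
        (∀ x ∈ t ∩ frontier Ω, ∀ᶠ y in 𝓝 x, y ∉ Ω → (μ - extDerivAt κ) y = 0) ∧
        ∀ x ∈ frontier Ω, (∀ᶠ y in 𝓝 x, y ∉ Ω → μ y = 0) →
          ∀ᶠ y in 𝓝 x, y ∉ Ω → (μ - extDerivAt κ) y = 0 := by
  obtain ⟨e, ℓ, w, h, hxe, heN, hex⟩ := exists_isBoundaryChart hΩ hb hx₀ hN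
  -- The projection along `w` onto the boundary hyperplane. The contraction multiplies `ℓ` by `s`,
  -- so segments that start off `Ω` stay off `Ω`, where `μ` is closed.
  let L : EuclideanSpace ℝ (Fin n) →L[ℝ] EuclideanSpace ℝ (Fin n) :=
    .id ℝ _ - ℓ.smulRight w
  have hL : ∀ y, L y = y - ℓ y • w := fun y => rfl
  have hseg : ∀ (y : EuclideanSpace ℝ (Fin n)) (s : ℝ),
      ℓ (0 + L y + s • (y - (0 + L y))) = s * ℓ y := fun y s => by
    simp [hL, h.apply_normal]
  obtain ⟨r, hr, hrt, hr'⟩ := exists_local_homotopy_primitive (k := k) (c := 0) (L := L)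
    h.contMDiffOn h.contMDiffOn_symm (y₀ := 0) (by rw [← hex]; exact e.map_source hxe) (by simp)
  set V := e.source ∩ e ⁻¹' Metric.ball 0 r with hV
  have hVo : IsOpen V := e.isOpen_inter_preimage Metric.isOpen_ball
  have hxV : x₀ ∈ V := ⟨hxe, by
    rw [Set.mem_preimage, hex]
    exact Metric.mem_ball_self hr⟩
  obtain ⟨χ, hχ, hχV, -, hχ1, -⟩ := exists_smooth_cutoff (n := n) x₀ (hVo.mem_nhds hxV)
  refine ⟨_, Filter.inter_mem hχ1.eventually_nhds (hVo.mem_nhds hxV), fun μ hμ hd hv => ?_⟩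
  obtain ⟨β, hβ, hβ'⟩ := hr' μ hμ
  have hβd : ∀ x ∈ V, x ∉ Ω → extDerivAt β x = μ x := by
    intro x hx hxΩ
    have hx0 : 0 ≤ ℓ (e x) := not_lt.1 fun h1 => hxΩ ((h.mem_iff x hx.1).2 h1)
    refine (hβ' x hx.1 hx.2).1 (fun s hs => ?_) ?_
    · have h1 := hrt _ hx.2 s hs
      have h2 := e.map_target h1
      refine hd _ (heN h2) fun h3 => ?_
      rw [h.mem_iff _ h2, e.right_inv h1, hseg] at h3
      exact absurd h3 (not_lt.2 (mul_nonneg hs.1 hx0))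
    · have h1 : 0 + L (e x) ∈ e.target := by simpa using hrt _ hx.2 0 ⟨le_rfl, zero_le_one⟩
      have h2 : ℓ (0 + L (e x)) = 0 := by simpa using hseg (e x) 0
      ext v
      refine hv (e.symm (0 + L (e x))) ?_ _ fun i => ?_
      · rw [h.mem_frontier_iff hΩ (e.map_target h1), e.right_inv h1, h2]
      · refine h.mfderiv_symm_mem_tangentSpaceOf hΩ h1 h2 ?_
        simp [hL, h.apply_normal]
  have hβ0 : ∀ x ∈ V, x ∈ frontier Ω → β x = 0 := by
    intro x hx hxf
    refine (hβ' x hx.1 hx.2).2.2 ?_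
    rw [hL, (h.mem_frontier_iff hΩ hx.1).1 hxf]
    simp
  -- A boundary point is fixed by the contraction, so segments from nearby points stay where `μ` is
  -- zero off `Ω`. This is what preserves the gains of earlier steps.
  have hβg : ∀ x ∈ V, x ∈ frontier Ω → (∀ᶠ y in 𝓝 x, y ∉ Ω → μ y = 0) →
      ∀ᶠ y in 𝓝 x, y ∉ Ω → β y = 0 := by
    intro x hx hxf hμx
    have h0 : ℓ (e x) = 0 := (h.mem_frontier_iff hΩ hx.1).1 hxf
    have h1 : ∀ᶠ y in 𝓝 x, ∀ s ∈ Set.Icc (0 : ℝ) 1,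
        (e.symm (0 + L (e y) + s • (e y - (0 + L (e y)))) ∉ Ω →
          μ (e.symm (0 + L (e y) + s • (e y - (0 + L (e y))))) = 0) := by
      refine isCompact_Icc.eventually_forall_of_forall_eventually (P := fun y s =>
        (e.symm (0 + L (e y) + s • (e y - (0 + L (e y)))) ∉ Ω →
          μ (e.symm (0 + L (e y) + s • (e y - (0 + L (e y))))) = 0)) fun s hs => ?_
      have h2 : ContinuousAt (fun z : X × ℝ => e z.1) (x, s) :=
        ContinuousAt.comp (g := e) (e.continuousAt hx.1) continuousAt_fst
      have h3 : ContinuousAt (fun z : X × ℝ =>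
          0 + L (e z.1) + z.2 • (e z.1 - (0 + L (e z.1)))) (x, s) := by
        have h4 : ContinuousAt (fun z : X × ℝ => L (e z.1)) (x, s) :=
          ContinuousAt.comp (g := L) L.continuous.continuousAt h2
        exact (continuousAt_const.add h4).add
          (continuousAt_snd.smul (h2.sub (continuousAt_const.add h4)))
      have h5 : 0 + L (e x) + s • (e x - (0 + L (e x))) = e x := by
        rw [hL, h0]
        simp
      have h6 : Filter.Tendsto (fun z : X × ℝ =>
          e.symm (0 + L (e z.1) + z.2 • (e z.1 - (0 + L (e z.1))))) (𝓝 (x, s)) (𝓝 x) := by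
        have h7 := h3.tendsto
        simp only [h5] at h7
        exact (e.tendsto_symm hx.1).comp h7
      exact h6.eventually hμx
    filter_upwards [h1, hVo.mem_nhds hx] with y hy hyV hyΩ
    have hy0 : 0 ≤ ℓ (e y) := not_lt.1 fun h1 => hyΩ ((h.mem_iff y hyV.1).2 h1)
    refine (hβ' y hyV.1 hyV.2).2.1 fun s hs => hy s hs fun h3 => ?_
    have h1 := hrt _ hyV.2 s hs
    rw [h.mem_iff _ (e.map_target h1), e.right_inv h1, hseg] at h3
    exact absurd h3 (not_lt.2 (mul_nonneg hs.1 hy0))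
  have hβs : ∀ x ∈ V, SmoothFormAt β x := fun x hx => hβ x hx.1
  have hκ := SmoothFormAt.smul_of_tsupport_subset hχ hχV hβs
  have hout : ∀ x, x ∉ tsupport χ → ∀ᶠ y in 𝓝 x, extDerivAt (fun z => χ z • β z) y = 0 := by
    intro x hx
    filter_upwards [(notMem_tsupport_iff_eventuallyEq.1 hx).eventually_nhds] with y hy
    rw [extDerivAt_congr (β := 0), extDerivAt_zero]
    filter_upwards [hy] with z hz
    rw [hz]
    exact zero_smul ℝ (β z)
  refine ⟨fun x => χ x • β x, hκ, ?_, ?_, ?_⟩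
  · intro x hx v hvx
    have hxΩ : x ∉ Ω := by
      rw [hΩ.frontier_eq] at hx
      exact hx.2
    have h1 : extDerivAt (fun z => χ z • β z) x v = 0 := by
      by_cases hxχ : x ∈ tsupport χ
      -- Since `β` vanishes at boundary points, the term `dχ ∧ β` drops out and `d(χβ) = χ μ` there.
      · rw [extDerivAt_smul_of_eq_zero hχ.contMDiffAt (hβs x (hχV hxχ)) (hβ0 x (hχV hxχ) hx),
          hβd x (hχV hxχ) hxΩ]
        change χ x • μ x v = 0
        rw [hv x hx v hvx, smul_zero]
      · rw [(hout x hxχ).self_of_nhds]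
        rfl
    change μ x v - extDerivAt (fun z => χ z • β z) x v = 0
    rw [hv x hx v hvx, h1, sub_zero]
  · rintro x ⟨⟨hx1, hxV⟩, hxf⟩
    filter_upwards [hx1.eventually_nhds, hVo.mem_nhds hxV] with y hy hyV hyΩ
    have h2 : ∀ᶠ z in 𝓝 y, χ z • β z = β z := by
      filter_upwards [hy] with z hz
      rw [hz]
      exact one_smul ℝ (β z)
    rw [Pi.sub_apply, extDerivAt_congr h2, hβd y hyV hyΩ, sub_self]
  · intro x hx hμx
    by_cases hxχ : x ∈ tsupport χ
    · have h1 : ∀ᶠ y in 𝓝 x, y ∉ Ω → (fun z => χ z • β z) y = 0 := by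
        filter_upwards [hβg x (hχV hxχ) hx hμx] with y hy hyΩ
        simp only [hy hyΩ]
        exact smul_zero (χ y)
      filter_upwards [eventually_extDerivAt_eq_zero hΩ hb hκ h1, hμx] with y hy hy2 hyΩ
      rw [Pi.sub_apply, hy hyΩ, hy2 hyΩ, sub_zero]
    · filter_upwards [hout x hxχ, hμx] with y hy hy2 hyΩ
      rw [Pi.sub_apply, hy, hy2 hyΩ, sub_zero]

/-- The relative Poincaré lemma on the outer side of the boundary. -/
theorem exists_collar_primitive [T2Space X] {Ω : Set X} (hΩ : IsOpen Ω)
    (hb : HasSmoothBoundary n Ω) (hc : IsCompact (frontier Ω)) {N : Set X}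
    (hN : ∀ x ∈ frontier Ω, N ∈ 𝓝 x)
    {μ : (x : X) → TangentSpace (𝓡 n) x [⋀^Fin (k + 1)]→L[ℝ] ℝ}
    (hμ : ∀ x, SmoothFormAt μ x) (hd : ∀ x ∈ N, x ∉ Ω → extDerivAt μ x = 0)
    (hv : VanishesAlong (frontier Ω) μ) :
    ∃ κ : (x : X) → TangentSpace (𝓡 n) x [⋀^Fin k]→L[ℝ] ℝ, (∀ x, SmoothFormAt κ x) ∧
      ∀ x ∈ frontier Ω, ∀ᶠ y in 𝓝 x, y ∉ Ω → μ y = extDerivAt κ y := by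
  -- The statement is made for every admissible `μ`, since each step acts on the remainder of the
  -- previous one. The remainder again vanishes along the boundary, and by the last clause germs
  -- already killed stay zero.
  let Q : Set X → Prop := fun A =>
    ∀ μ : (x : X) → TangentSpace (𝓡 n) x [⋀^Fin (k + 1)]→L[ℝ] ℝ,
      (∀ x, SmoothFormAt μ x) → (∀ x ∈ N, x ∉ Ω → extDerivAt μ x = 0) →
      VanishesAlong (frontier Ω) μ →
      ∃ κ : (x : X) → TangentSpace (𝓡 n) x [⋀^Fin k]→L[ℝ] ℝ, (∀ x, SmoothFormAt κ x) ∧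
        VanishesAlong (frontier Ω) (μ - extDerivAt κ) ∧
        (∀ x ∈ A ∩ frontier Ω, ∀ᶠ y in 𝓝 x, y ∉ Ω → (μ - extDerivAt κ) y = 0) ∧
        ∀ x ∈ frontier Ω, (∀ᶠ y in 𝓝 x, y ∉ Ω → μ y = 0) →
          ∀ᶠ y in 𝓝 x, y ∉ Ω → (μ - extDerivAt κ) y = 0
  have hQ : Q (frontier Ω) := by
    refine hc.induction_on (p := Q) ?_ ?_ ?_ ?_
    · intro μ hμ hd hv
      have h0 : μ - extDerivAt (0 : (x : X) → TangentSpace (𝓡 n) x [⋀^Fin k]→L[ℝ] ℝ) = μ := by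
        funext x
        rw [Pi.sub_apply, extDerivAt_zero, sub_zero]
      refine ⟨0, fun x => smoothFormAt_zero, ?_, ?_, ?_⟩
      · rwa [h0]
      · rintro x ⟨h, -⟩
        exact h.elim
      · intro x _ h
        rwa [h0]
    · intro s t hst ht μ hμ hd hv
      obtain ⟨κ, h1, h2, h3, h4⟩ := ht μ hμ hd hv
      exact ⟨κ, h1, h2, fun x hx => h3 x ⟨hst hx.1, hx.2⟩, h4⟩
    · intro s t hs ht μ hμ hd hv
      obtain ⟨κ₁, h1, h2, h3, h4⟩ := hs μ hμ hd hv
      have hμ₁ : ∀ x, SmoothFormAt (μ - extDerivAt κ₁) x := fun x =>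
        (hμ x).sub (smoothFormAt_extDerivAt h1 x)
      obtain ⟨κ₂, h5, h6, h7, h8⟩ := ht (μ - extDerivAt κ₁) hμ₁ (fun x hx hxΩ => by
        rw [extDerivAt_sub (hμ x) (smoothFormAt_extDerivAt h1 x), hd x hx hxΩ,
          extDerivAt_extDerivAt h1, sub_zero]) h2
      have h0 : μ - extDerivAt (κ₁ + κ₂) = μ - extDerivAt κ₁ - extDerivAt κ₂ := by
        funext x
        simp only [Pi.sub_apply]
        rw [extDerivAt_add (h1 x) (h5 x), sub_sub]
      refine ⟨κ₁ + κ₂, fun x => (h1 x).add (h5 x), ?_, ?_, ?_⟩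
      · rwa [h0]
      · rintro x ⟨hx | hx, hxf⟩
        · rw [h0]
          exact h8 x hxf (h3 x ⟨hx, hxf⟩)
        · rw [h0]
          exact h7 x ⟨hx, hxf⟩
      · intro x hx hμx
        rw [h0]
        exact h8 x hx (h4 x hx hμx)
    · intro x hx
      obtain ⟨t, ht, h⟩ := exists_local_collar_primitive (k := k) hΩ hb hx (hN x hx)
      exact ⟨t, nhdsWithin_le_nhds ht, h⟩
  obtain ⟨κ, h1, -, h3, -⟩ := hQ μ hμ hd hv
  refine ⟨κ, h1, fun x hx => ?_⟩
  filter_upwards [h3 x ⟨hx, hx⟩] with y hy hyΩ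
  exact sub_eq_zero.1 (hy hyΩ)

end Collar

/-! ### Pushing the closure of the domain inside. -/

section Push

variable {n : ℕ} {X : Type*} [TopologicalSpace X]
  [ChartedSpace (EuclideanSpace ℝ (Fin n)) X] [IsManifold (𝓡 n) ∞ X]

/-- A smooth self-map of `X` that preserves the cohomology class of every closed form of degree
`k + 1`. -/
structure PreservesClasses (k : ℕ) (P : X → X) : Prop where
  contMDiff : ContMDiff (𝓡 n) (𝓡 n) ∞ P
  exists_primitive : ∀ α : (x : X) → TangentSpace (𝓡 n) x [⋀^Fin (k + 1)]→L[ℝ] ℝ,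
    (∀ x, SmoothFormAt α x) → (∀ x, extDerivAt α x = 0) →
    ∃ κ : (x : X) → TangentSpace (𝓡 n) x [⋀^Fin k]→L[ℝ] ℝ, (∀ x, SmoothFormAt κ x) ∧
      ∀ x, extDerivAt κ x = α x - formPullback P α x

theorem preservesClasses_id (k : ℕ) : PreservesClasses (n := n) k (id : X → X) where
  contMDiff := contMDiff_id
  exists_primitive := fun α _ _ => ⟨0, fun _ => smoothFormAt_zero, fun x => by
    rw [extDerivAt_zero, formPullback_id, sub_self]⟩

/-- `α - (Q ∘ P)^* α = (α - P^* α) + P^* (α - Q^* α)`. -/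
theorem PreservesClasses.comp {k : ℕ} {P Q : X → X} (hQ : PreservesClasses (n := n) k Q)
    (hP : PreservesClasses (n := n) k P) : PreservesClasses (n := n) k (Q ∘ P) where
  contMDiff := hQ.contMDiff.comp hP.contMDiff
  exists_primitive := fun α hα hd => by
    obtain ⟨κ₁, h1, h2⟩ := hP.exists_primitive α hα hd
    obtain ⟨κ₂, h3, h4⟩ := hQ.exists_primitive α hα hd
    have h5 : ∀ x, SmoothFormAt (formPullback P κ₂) x := fun x =>
      SmoothFormAt.formPullback hP.contMDiff.contMDiffAt (h3 _)
    refine ⟨κ₁ + formPullback P κ₂, fun x => (h1 x).add (h5 x), fun x => ?_⟩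
    have h6 : formPullback P (extDerivAt κ₂) x =
        formPullback P α x - formPullback (Q ∘ P) α x := by
      rw [formPullback_comp (hQ.contMDiff.contMDiffAt.mdifferentiableAt (by simp))
        (hP.contMDiff.contMDiffAt.mdifferentiableAt (by simp))]
      unfold formPullback
      rw [h4]
      rfl
    rw [extDerivAt_add (h1 x) (h5 x), h2, extDerivAt_formPullback hP.contMDiff.contMDiffAt (h3 _),
      h6]
    abel

variable [T2Space X]

/-- Translate by `-εχ w` in a boundary chart. The map moves points only within a set where every
closed form has a primitive `β`, so `β - P^* β` is a primitive of `α - P^* α`. The alternative at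
boundary points lets such maps be composed: a point not yet moved inside is still in place. -/
theorem exists_local_push (k : ℕ) {Ω : Set X} (hΩ : IsOpen Ω) (hb : HasSmoothBoundary n Ω)
    {x₀ : X} (hx₀ : x₀ ∈ frontier Ω) :
    ∃ t ∈ 𝓝 x₀, ∃ P : X → X, PreservesClasses (n := n) k P ∧ (∀ x ∈ Ω, P x ∈ Ω) ∧
      (∀ x ∈ frontier Ω, P x = x ∨ P x ∈ Ω) ∧ ∀ x ∈ t ∩ frontier Ω, P x ∈ Ω := by
  obtain ⟨V, hV, hVβ⟩ := exists_local_primitive (n := n) k x₀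
  obtain ⟨e, ℓ, w, h, hxe, heV, -⟩ := exists_isBoundaryChart hΩ hb hx₀ hV
  obtain ⟨χ, hχ, hχe, hχc, hχ1, hχr⟩ :=
    exists_smooth_cutoff (n := n) x₀ (e.open_source.mem_nhds hxe)
  obtain ⟨ε, hε, hεt⟩ : ∃ ε > 0, ∀ x ∈ tsupport χ, e x - (ε * χ x) • w ∈ e.target := by
    have h1 : ∀ᶠ s : ℝ in 𝓝 0, ∀ x ∈ tsupport χ, e x - (s * χ x) • w ∈ e.target := by
      refine hχc.eventually_forall_of_forall_eventually
        (P := fun s x => e x - (s * χ x) • w ∈ e.target) fun x hx => ?_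
      have h2 : ContinuousAt (fun z : ℝ × X => e z.2 - (z.1 * χ z.2) • w) (0, x) := by
        have h3 : ContinuousAt (fun z : ℝ × X => e z.2) (0, x) :=
          ContinuousAt.comp (g := e) (e.continuousAt (hχe hx)) continuousAt_snd
        have h4 : ContinuousAt (fun z : ℝ × X => χ z.2) (0, x) :=
          ContinuousAt.comp (g := χ) hχ.continuous.continuousAt continuousAt_snd
        exact h3.sub ((continuousAt_fst.mul h4).smul continuousAt_const)
      refine h2.eventually (e.open_target.mem_nhds ?_)
      simpa using e.map_source (hχe hx)
    obtain ⟨ε, hε, hε'⟩ := (h1.filter_mono (nhdsWithin_le_nhds (s := Set.Ioi 0)) |>.and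
      self_mem_nhdsWithin).exists
    exact ⟨ε, hε', hε⟩
  classical
  let P : X → X := fun x => if x ∈ e.source then e.symm (e x - (ε * χ x) • w) else x
  have hP : ∀ x ∈ e.source, P x = e.symm (e x - (ε * χ x) • w) := fun x hx => if_pos hx
  have hPid : ∀ x, χ x = 0 → P x = x := by
    intro x hx
    by_cases hxe : x ∈ e.source
    · rw [hP x hxe, hx, mul_zero, zero_smul, sub_zero, e.left_inv hxe]
    · exact if_neg hxe
  have hPoff : ∀ x ∉ tsupport χ, P x = x := fun x hx => hPid x (image_eq_zero_of_notMem_tsupport hx)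
  have hPe : ∀ x ∈ tsupport χ, P x ∈ e.source := fun x hx => by
    rw [hP x (hχe hx)]
    exact e.map_target (hεt x hx)
  have hPℓ : ∀ x ∈ tsupport χ, ℓ (e (P x)) = ℓ (e x) - ε * χ x := fun x hx => by
    rw [hP x (hχe hx), e.right_inv (hεt x hx), map_sub, map_smul, h.apply_normal, smul_eq_mul,
      mul_one]
  have hPs : ContMDiff (𝓡 n) (𝓡 n) ∞ P := by
    intro x
    by_cases hx : x ∈ tsupport χ
    · have h1 : ContMDiffAt (𝓡 n) (𝓡 n) ∞ (fun y => e y - (ε * χ y) • w) x := by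
        have h2 := h.contMDiffOn.contMDiffAt (e.open_source.mem_nhds (hχe hx))
        have h3 : ContMDiffAt (𝓡 n) 𝓘(ℝ, ℝ) ∞ (fun y => ε * χ y) x :=
          contMDiffAt_const.mul hχ.contMDiffAt
        exact h2.sub (h3.smul contMDiffAt_const)
      have h4 : ContMDiffAt (𝓡 n) (𝓡 n) ∞ e.symm (e x - (ε * χ x) • w) :=
        h.contMDiffOn_symm.contMDiffAt (e.open_target.mem_nhds (hεt x hx))
      refine (h4.comp x h1).congr_of_eventuallyEq ?_
      filter_upwards [e.open_source.mem_nhds (hχe hx)] with y hy using hP y hy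
    · refine contMDiffAt_id.congr_of_eventuallyEq ?_
      filter_upwards [(isClosed_tsupport χ).isOpen_compl.mem_nhds hx] with y hy using hPoff y hy
  have hPf : ∀ x ∈ frontier Ω, χ x ≠ 0 → P x ∈ Ω := by
    intro x hx hχx
    have hxs := subset_tsupport χ (Function.mem_support.2 hχx)
    rw [h.mem_iff _ (hPe x hxs), hPℓ x hxs, (h.mem_frontier_iff hΩ (hχe hxs)).1 hx]
    have := mul_pos hε (lt_of_le_of_ne (hχr x).1 hχx.symm)
    linarith
  refine ⟨_, hχ1, P, ⟨hPs, fun α hα hd => ?_⟩, fun x hx => ?_, fun x hx => ?_, ?_⟩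
  · obtain ⟨β, hβ, hβ'⟩ := hVβ α hα hd
    refine ⟨formPullback id β - formPullback P β, fun x =>
      (SmoothFormAt.formPullback contMDiffAt_id (hβ _)).sub
        (SmoothFormAt.formPullback hPs.contMDiffAt (hβ _)), fun x => ?_⟩
    rw [extDerivAt_formPullback_sub_formPullback (g := id) hβ (isClosed_tsupport χ)
      (fun x hx => (hPoff x hx).symm) (fun x hx => hβ' _ (heV (hχe hx)))
      (fun x hx => hβ' _ (heV (hPe x hx))) contMDiffAt_id hPs.contMDiffAt, formPullback_id]
  · by_cases hxs : x ∈ tsupport χ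
    · rw [h.mem_iff _ (hPe x hxs), hPℓ x hxs]
      have h1 := (h.mem_iff x (hχe hxs)).1 hx
      have h2 := mul_nonneg hε.le (hχr x).1
      linarith
    · rwa [hPoff x hxs]
  · by_cases hχx : χ x = 0
    · exact Or.inl (hPid x hχx)
    · exact Or.inr (hPf x hx hχx)
  · rintro x ⟨hx1, hx2⟩
    refine hPf x hx2 ?_
    rw [show χ x = 1 from hx1]
    exact one_ne_zero

/-- The closure of a relatively compact domain with smooth boundary can be pushed inside. -/
theorem exists_push (k : ℕ) {Ω : Set X} (hΩ : IsOpen Ω) (hb : HasSmoothBoundary n Ω)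
    (hc : IsCompact (frontier Ω)) :
    ∃ P : X → X, PreservesClasses (n := n) k P ∧ ∀ x ∈ closure Ω, P x ∈ Ω := by
  let Q : Set X → Prop := fun A =>
    ∃ P : X → X, PreservesClasses (n := n) k P ∧ (∀ x ∈ Ω, P x ∈ Ω) ∧
      (∀ x ∈ frontier Ω, P x = x ∨ P x ∈ Ω) ∧ ∀ x ∈ A ∩ frontier Ω, P x ∈ Ω
  have hQ : Q (frontier Ω) := by
    refine hc.induction_on (p := Q) ?_ ?_ ?_ ?_
    · exact ⟨id, preservesClasses_id k, fun x hx => hx, fun x _ => Or.inl rfl,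
        fun x hx => hx.1.elim⟩
    · rintro s t hst ⟨P, h1, h2, h3, h4⟩
      exact ⟨P, h1, h2, h3, fun x hx => h4 x ⟨hst hx.1, hx.2⟩⟩
    · rintro s t ⟨P, h1, h2, h3, h4⟩ ⟨P', h1', h2', h3', h4'⟩
      refine ⟨P' ∘ P, h1'.comp h1, fun x hx => h2' _ (h2 x hx), fun x hx => ?_, ?_⟩
      · rcases h3 x hx with h | h
        · simpa only [Function.comp_apply, h] using h3' x hx
        · exact Or.inr (h2' _ h)
      · rintro x ⟨hx | hx, hxf⟩
        · exact h2' _ (h4 x ⟨hx, hxf⟩)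
        · rcases h3 x hxf with h | h
          · simpa only [Function.comp_apply, h] using h4' x ⟨hx, hxf⟩
          · exact h2' _ h
    · intro x hx
      obtain ⟨t, ht, h⟩ := exists_local_push k hΩ hb hx
      exact ⟨t, nhdsWithin_le_nhds ht, h⟩
  obtain ⟨P, h1, h2, -, h4⟩ := hQ
  refine ⟨P, h1, fun x hx => ?_⟩
  rw [closure_eq_self_union_frontier] at hx
  rcases hx with hx | hx
  · exact h2 x hx
  · exact h4 x ⟨hx, hx⟩

end Push

/-! ### Smoothing continuous maps along compact sets. -/

section Smoothing

variable {n : ℕ} {X : Type*} [TopologicalSpace X]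
  [ChartedSpace (EuclideanSpace ℝ (Fin n)) X] [IsManifold (𝓡 n) ∞ X]
  {E' H' M : Type*} [NormedAddCommGroup E'] [NormedSpace ℝ E'] [FiniteDimensional ℝ E']
  [TopologicalSpace H'] {I : ModelWithCorners ℝ E' H'} [TopologicalSpace M] [ChartedSpace H' M]
  [IsManifold I ∞ M] [T2Space M] [SigmaCompactSpace M]

/-- One step of the smoothing argument: make a map smooth near a point, keeping its graph in a
prescribed open set. -/
theorem exists_local_smoothing {H : M → X} {O : Set M} (hO : IsOpen O)
    (hH : ContinuousOn H O) {z₀ : M} (hz₀ : z₀ ∈ O) :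
    ∃ t ∈ 𝓝 z₀, ∃ N : Set (M × X), IsOpen N ∧ (∀ z ∈ O, (z, H z) ∈ N) ∧
      ∀ G : M → X, ContinuousOn G O → (∀ z ∈ O, (z, G z) ∈ N) →
      ∀ N' : Set (M × X), IsOpen N' → (∀ z ∈ O, (z, G z) ∈ N') →
      ∃ G' : M → X, ContinuousOn G' O ∧ (∀ z ∈ O, (z, G' z) ∈ N') ∧ (∀ z ∉ O, G' z = G z) ∧
        (∀ z ∈ t, ContMDiffAt I (𝓡 n) ∞ G' z) ∧
        ∀ z, ContMDiffAt I (𝓡 n) ∞ G z → ContMDiffAt I (𝓡 n) ∞ G' z := by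
  set e := chartAt (EuclideanSpace ℝ (Fin n)) (H z₀)
  have hm : e ∈ IsManifold.maximalAtlas (𝓡 n) ∞ X := IsManifold.chart_mem_maximalAtlas _
  have hes : ∀ y ∈ e.source, ContMDiffAt (𝓡 n) (𝓡 n) ∞ e y := fun y hy =>
    (contMDiffOn_of_mem_maximalAtlas hm).contMDiffAt (e.open_source.mem_nhds hy)
  have het : ∀ y ∈ e.target, ContMDiffAt (𝓡 n) (𝓡 n) ∞ e.symm y := fun y hy =>
    (contMDiffOn_symm_of_mem_maximalAtlas hm).contMDiffAt (e.open_target.mem_nhds hy)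
  have hU : O ∩ H ⁻¹' e.source ∈ 𝓝 z₀ := Filter.inter_mem (hO.mem_nhds hz₀)
    ((hH.continuousAt (hO.mem_nhds hz₀)).preimage_mem_nhds
      (e.open_source.mem_nhds (mem_chart_source _ _)))
  obtain ⟨χ, -, hχU⟩ := (SmoothBumpFunction.nhds_basis_tsupport (I := I) z₀).mem_iff.1 hU
  have hCO : tsupport χ ⊆ O := fun z hz => (hχU hz).1
  -- The open condition on the graph ensures that a map already altered elsewhere still sends the
  -- support of `χ` into the domain of `e`.
  refine ⟨_, χ.eventuallyEq_one.eventually_nhds, {p | p.1 ∈ tsupport χ → p.2 ∈ e.source}, ?_,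
    fun z _ hz => (hχU hz).2, fun G hG hGN N' hN' hGN' => ?_⟩
  · have h1 : {p : M × X | p.1 ∈ tsupport χ → p.2 ∈ e.source} =
        (Prod.fst ⁻¹' (tsupport χ)ᶜ) ∪ (Prod.snd ⁻¹' e.source) := by
      ext p
      simp [imp_iff_not_or]
    rw [h1]
    exact ((isClosed_tsupport χ).isOpen_compl.preimage continuous_fst).union
      (e.open_source.preimage continuous_snd)
  have hGe : ∀ z ∈ tsupport χ, G z ∈ e.source := fun z hz => hGN z (hCO hz) hz
  have hGc : ∀ z ∈ O, ContinuousAt G z := fun z hz => hG.continuousAt (hO.mem_nhds hz)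
  have heG : ∀ z ∈ tsupport χ, ContinuousAt (fun y => e (G y)) z := fun z hz =>
    ContinuousAt.comp (g := e) (e.continuousAt (hGe z hz)) (hGc z (hCO hz))
  obtain ⟨ε, hε, hεN⟩ : ∃ ε > 0, ∀ v : EuclideanSpace ℝ (Fin n), ‖v‖ < ε → ∀ z ∈ tsupport χ,
      e (G z) + v ∈ e.target ∧ (z, e.symm (e (G z) + v)) ∈ N' := by
    have h1 : ∀ᶠ v : EuclideanSpace ℝ (Fin n) in 𝓝 0, ∀ z ∈ tsupport χ,
        e (G z) + v ∈ e.target ∧ (z, e.symm (e (G z) + v)) ∈ N' := by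
      refine χ.hasCompactSupport.isCompact.eventually_forall_of_forall_eventually
        (P := fun v z => e (G z) + v ∈ e.target ∧ (z, e.symm (e (G z) + v)) ∈ N') fun z hz => ?_
      have h2 : ContinuousAt (fun p : EuclideanSpace ℝ (Fin n) × M => e (G p.2) + p.1) (0, z) :=
        (ContinuousAt.comp (g := fun y => e (G y)) (heG z hz) continuousAt_snd).add
          continuousAt_fst
      have h3 : e (G z) + 0 ∈ e.target := by simpa using e.map_source (hGe z hz)
      have h4 : ContinuousAt (fun p : EuclideanSpace ℝ (Fin n) × M =>
          (p.2, e.symm (e (G p.2) + p.1))) (0, z) :=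
        continuousAt_snd.prodMk (ContinuousAt.comp (g := e.symm) (e.symm.continuousAt h3) h2)
      refine (h2.eventually (e.open_target.mem_nhds h3)).and (h4.eventually (hN'.mem_nhds ?_))
      simpa [e.left_inv (hGe z hz)] using hGN' z (hCO hz)
    obtain ⟨ε, hε, h⟩ := Metric.eventually_nhds_iff.1 h1
    exact ⟨ε, hε, fun v hv => h (by simpa using hv)⟩
  -- A smooth map `h` within `ε` of `e ∘ G` on the support of `χ`, with no condition elsewhere. The
  -- new map interpolates in the chart, from `e ∘ G` where `χ = 0` to `h` where `χ = 1`.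
  obtain ⟨h, hh⟩ := exists_contMDiffMap_forall_mem_convex_of_local_const (n := ⊤) I
    (t := fun z => {v : EuclideanSpace ℝ (Fin n) | z ∈ tsupport χ → v ∈ Metric.ball (e (G z)) ε})
    (fun z => by
      by_cases hz : z ∈ tsupport χ
      · exact fun x hx y hy a b ha hb hab hz => convex_ball _ _ (hx hz) (hy hz) ha hb hab
      · exact fun _ _ _ _ _ _ _ _ _ hz' => absurd hz' hz)
    (fun z => by
      refine ⟨e (G z), ?_⟩
      by_cases hz : z ∈ tsupport χ
      · filter_upwards [(heG z hz).eventually (Metric.ball_mem_nhds _ hε)] with y hy _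
        rw [Metric.mem_ball, dist_comm]
        exact hy
      · filter_upwards [(isClosed_tsupport χ).isOpen_compl.mem_nhds hz] with y hy hy'
        exact absurd hy' hy)
  classical
  let Φ : M → EuclideanSpace ℝ (Fin n) := fun z => e (G z) + χ z • (h z - e (G z))
  let G' : M → X := fun z => if z ∈ tsupport χ then e.symm (Φ z) else G z
  have hin : ∀ z ∈ tsupport χ, Φ z ∈ e.target ∧ (z, e.symm (Φ z)) ∈ N' := fun z hz => by
    refine hεN _ ?_ z hz
    have h1 : ‖h z - e (G z)‖ < ε := by simpa [dist_eq_norm] using hh z hz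
    rw [norm_smul, Real.norm_of_nonneg χ.nonneg]
    exact (mul_le_of_le_one_left (norm_nonneg _) χ.le_one).trans_lt h1
  have hoff : ∀ z ∉ tsupport χ, G' z = G z := fun z hz => if_neg hz
  have hoff' : ∀ z ∉ tsupport χ, G' =ᶠ[𝓝 z] G := fun z hz => by
    filter_upwards [(isClosed_tsupport χ).isOpen_compl.mem_nhds hz] with y hy using hoff y hy
  have hon : ∀ z ∈ tsupport χ, G' =ᶠ[𝓝 z] fun y => e.symm (Φ y) := fun z hz => by
    filter_upwards [(hGc z (hCO hz)).eventually (e.open_source.mem_nhds (hGe z hz))] with y hy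
    by_cases hyχ : y ∈ tsupport χ
    · exact if_pos hyχ
    · rw [hoff y hyχ]
      simp only [Φ, image_eq_zero_of_notMem_tsupport hyχ, zero_smul, add_zero]
      exact (e.left_inv hy).symm
  refine ⟨G', fun z hz => ContinuousAt.continuousWithinAt ?_, fun z hz => ?_,
    fun z hz => hoff z fun hz' => hz (hCO hz'), fun z hz => ?_, fun z hz => ?_⟩
  · by_cases hzχ : z ∈ tsupport χ
    · refine ContinuousAt.congr ?_ (hon z hzχ).symm
      refine ContinuousAt.comp (g := e.symm) (e.symm.continuousAt (hin z hzχ).1) ?_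
      exact (heG z hzχ).add (χ.continuous.continuousAt.smul
        (h.contMDiff.continuous.continuousAt.sub (heG z hzχ)))
    · exact (hGc z hz).congr (hoff' z hzχ).symm
  · by_cases hzχ : z ∈ tsupport χ
    · rw [show G' z = _ from if_pos hzχ]
      exact (hin z hzχ).2
    · rw [hoff z hzχ]
      exact hGN' z hz
  · have hz1 : ∀ᶠ y in 𝓝 z, χ y = 1 := hz
    have hzχ : z ∈ tsupport χ := subset_tsupport χ (by simp [hz1.self_of_nhds])
    have h1 : e.symm (Φ z) = e.symm (h z) := by simp [Φ, hz1.self_of_nhds]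
    have h2 : h z ∈ e.target := by simpa [Φ, hz1.self_of_nhds] using (hin z hzχ).1
    refine ((het _ h2).comp z h.contMDiff.contMDiffAt).congr_of_eventuallyEq ?_
    filter_upwards [hon z hzχ, hz1] with y hy hy1
    rw [hy]
    simp [Φ, hy1]
  · by_cases hzχ : z ∈ tsupport χ
    · have h1 : ContMDiffAt I (𝓡 n) ∞ (fun y => e (G y)) z := (hes _ (hGe z hzχ)).comp z hz
      have h2 : ContMDiffAt I (𝓡 n) ∞ Φ z :=
        h1.add (χ.contMDiffAt.smul (h.contMDiff.contMDiffAt.sub h1))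
      exact ((het _ (hin z hzχ).1).comp z h2).congr_of_eventuallyEq (hon z hzχ)
    · exact hz.congr_of_eventuallyEq (hoff' z hzχ)

/-- A map that is continuous on an open set can be made smooth along a compact subset of it without
changing it off the open set and without losing smoothness anywhere. -/
theorem exists_smoothing {H : M → X} {O C : Set M} (hO : IsOpen O) (hC : IsCompact C)
    (hCO : C ⊆ O) (hH : ContinuousOn H O) :
    ∃ G : M → X, (∀ z ∉ O, G z = H z) ∧ (∀ z ∈ C, ContMDiffAt I (𝓡 n) ∞ G z) ∧
      ∀ z, ContMDiffAt I (𝓡 n) ∞ H z → ContMDiffAt I (𝓡 n) ∞ G z := by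
  let S : Set M → Prop := fun A => ∃ N : Set (M × X), IsOpen N ∧ (∀ z ∈ O, (z, H z) ∈ N) ∧
      ∀ G : M → X, ContinuousOn G O → (∀ z ∈ O, (z, G z) ∈ N) →
      ∀ N' : Set (M × X), IsOpen N' → (∀ z ∈ O, (z, G z) ∈ N') →
      ∃ G' : M → X, ContinuousOn G' O ∧ (∀ z ∈ O, (z, G' z) ∈ N') ∧ (∀ z ∉ O, G' z = G z) ∧
        (∀ z ∈ A, ContMDiffAt I (𝓡 n) ∞ G' z) ∧
        ∀ z, ContMDiffAt I (𝓡 n) ∞ G z → ContMDiffAt I (𝓡 n) ∞ G' z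
  have hS : S C := by
    refine hC.induction_on (p := S) ?_ ?_ ?_ ?_
    · exact ⟨Set.univ, isOpen_univ, fun z _ => trivial, fun G hG _ N' _ hGN' =>
        ⟨G, hG, hGN', fun z _ => rfl, fun z hz => hz.elim, fun z hz => hz⟩⟩
    · rintro s t hst ⟨N, h1, h2, h3⟩
      refine ⟨N, h1, h2, fun G hG hGN N' hN' hGN' => ?_⟩
      obtain ⟨G', h4, h5, h6, h7, h8⟩ := h3 G hG hGN N' hN' hGN'
      exact ⟨G', h4, h5, h6, fun z hz => h7 z (hst hz), h8⟩
    · rintro s t ⟨N₁, h1, h2, h3⟩ ⟨N₂, k1, k2, k3⟩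
      refine ⟨N₁ ∩ N₂, h1.inter k1, fun z hz => ⟨h2 z hz, k2 z hz⟩,
        fun G hG hGN N' hN' hGN' => ?_⟩
      -- The first smoothing must keep the graph inside `N₂`, or the second could not be applied to
      -- its result.
      obtain ⟨G₁, h4, h5, h6, h7, h8⟩ := h3 G hG (fun z hz => (hGN z hz).1) (N₂ ∩ N')
        (k1.inter hN') fun z hz => ⟨(hGN z hz).2, hGN' z hz⟩
      obtain ⟨G₂, k4, k5, k6, k7, k8⟩ := k3 G₁ h4 (fun z hz => (h5 z hz).1) N' hN'
        fun z hz => (h5 z hz).2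
      refine ⟨G₂, k4, k5, fun z hz => (k6 z hz).trans (h6 z hz), ?_, fun z hz => k8 z (h8 z hz)⟩
      rintro z (hz | hz)
      · exact k8 z (h7 z hz)
      · exact k7 z hz
    · intro z hz
      obtain ⟨t, ht, h⟩ := exists_local_smoothing (n := n) (I := I) hO hH (hCO hz)
      exact ⟨t, nhdsWithin_le_nhds ht, h⟩
  obtain ⟨N, -, h2, h3⟩ := hS
  obtain ⟨G, -, -, h6, h7, h8⟩ := h3 H hH h2 Set.univ isOpen_univ fun _ _ => trivial
  exact ⟨G, h6, h7, h8⟩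

end Smoothing

/-! ### Homotopy invariance and exactness inside a contractible open set. -/

section Contraction

variable {n k : ℕ} {X : Type*} [TopologicalSpace X]
  [ChartedSpace (EuclideanSpace ℝ (Fin n)) X] [IsManifold (𝓡 n) ∞ X]

/-- Along `K`, the pull-backs of `α` by `g` and `g'` differ by an exact form. -/
def PullbackCohomologous (K : Set X) (α : (x : X) → TangentSpace (𝓡 n) x [⋀^Fin (k + 1)]→L[ℝ] ℝ)
    (g g' : X → X) : Prop :=
  ∃ κ : (x : X) → TangentSpace (𝓡 n) x [⋀^Fin k]→L[ℝ] ℝ, ∀ x ∈ K,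
    SmoothFormAt κ x ∧ extDerivAt κ x = formPullback g α x - formPullback g' α x

namespace PullbackCohomologous

variable {K : Set X} {α : (x : X) → TangentSpace (𝓡 n) x [⋀^Fin (k + 1)]→L[ℝ] ℝ}
  {g g' g'' : X → X}

theorem refl : PullbackCohomologous K α g g :=
  ⟨0, fun x _ => ⟨smoothFormAt_zero, by rw [extDerivAt_zero, sub_self]⟩⟩

theorem symm (h : PullbackCohomologous K α g g') : PullbackCohomologous K α g' g := by
  obtain ⟨κ, hκ⟩ := h
  refine ⟨-κ, fun x hx => ⟨(hκ x hx).1.neg, ?_⟩⟩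
  rw [extDerivAt_neg, (hκ x hx).2, neg_sub]

theorem trans (h : PullbackCohomologous K α g g') (h' : PullbackCohomologous K α g' g'') :
    PullbackCohomologous K α g g'' := by
  obtain ⟨κ, hκ⟩ := h
  obtain ⟨κ', hκ'⟩ := h'
  refine ⟨κ + κ', fun x hx => ⟨(hκ x hx).1.add (hκ' x hx).1, ?_⟩⟩
  rw [extDerivAt_add (hκ x hx).1 (hκ' x hx).1, (hκ x hx).2, (hκ' x hx).2, sub_add_sub_cancel]

theorem congr_right (h : PullbackCohomologous K α g g') (hg : ∀ x ∈ K, g' =ᶠ[𝓝 x] g'') :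
    PullbackCohomologous K α g g'' := by
  obtain ⟨κ, hκ⟩ := h
  exact ⟨κ, fun x hx => ⟨(hκ x hx).1, by rw [(hκ x hx).2, formPullback_congr (hg x hx)]⟩⟩

end PullbackCohomologous

variable [T2Space X] {K : Set X} {α : (x : X) → TangentSpace (𝓡 n) x [⋀^Fin (k + 1)]→L[ℝ] ℝ}
  {G : X × ℝ → X}

theorem contMDiffAt_graph_comp
    (hG : ∀ x ∈ K, ∀ t, ContMDiffAt ((𝓡 n).prod 𝓘(ℝ, ℝ)) (𝓡 n) ∞ G (x, t)) {τ : X → ℝ}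
    (hτ : ContMDiff (𝓡 n) 𝓘(ℝ, ℝ) ∞ τ) {x : X} (hx : x ∈ K) :
    ContMDiffAt (𝓡 n) (𝓡 n) ∞ (fun y => G (y, τ y)) x :=
  ContMDiffAt.comp (g := G) (f := fun y => (y, τ y)) x (hG x hx (τ x))
    (contMDiffAt_id.prodMk hτ.contMDiffAt)

/-- Near a point, the time parameter of a homotopy may be changed to a nearby constant. -/
theorem exists_local_time_change (hα : ∀ x, SmoothFormAt α x) (hd : ∀ x, extDerivAt α x = 0)
    (hG : ∀ x ∈ K, ∀ t, ContMDiffAt ((𝓡 n).prod 𝓘(ℝ, ℝ)) (𝓡 n) ∞ G (x, t)) (t₀ : ℝ) {x₀ : X}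
    (hx₀ : x₀ ∈ K) :
    ∃ A ∈ 𝓝 x₀, ∃ δ > 0, ∀ J ⊆ Metric.ball t₀ δ, Convex ℝ J → ∀ s ∈ J, ∀ τ : X → ℝ,
      ContMDiff (𝓡 n) 𝓘(ℝ, ℝ) ∞ τ → (∀ x, τ x ∈ J) →
      ∃ τ' : X → ℝ, ContMDiff (𝓡 n) 𝓘(ℝ, ℝ) ∞ τ' ∧ (∀ x, τ' x ∈ J) ∧
        (∀ x ∈ A, ∀ᶠ y in 𝓝 x, τ' y = s) ∧ (∀ x, τ x = s → τ' x = s) ∧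
        PullbackCohomologous K α (fun y => G (y, τ y)) (fun y => G (y, τ' y)) := by
  obtain ⟨V, hV, hVβ⟩ := exists_local_primitive (n := n) k (G (x₀, t₀))
  obtain ⟨β, hβ, hβ'⟩ := hVβ α hα hd
  obtain ⟨U, hU, W, hW, hUW⟩ := mem_nhds_prod_iff.1 ((hG x₀ hx₀ t₀).continuousAt.preimage_mem_nhds hV)
  obtain ⟨δ, hδ, hδW⟩ := Metric.mem_nhds_iff.1 hW
  obtain ⟨χ, hχ, hχU, -, hχ1, hχr⟩ := exists_smooth_cutoff (n := n) x₀ hU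
  refine ⟨_, hχ1.eventually_nhds, δ, hδ, fun J hJ hJc s hs τ hτ hτJ => ?_⟩
  -- The time is moved to `s` where `χ = 1` and kept off the support of `χ`. Over that support both
  -- graphs are sent by `G` into `V`, where `α = dβ`.
  have hτ' : ContMDiff (𝓡 n) 𝓘(ℝ, ℝ) ∞ fun x => τ x + χ x * (s - τ x) :=
    hτ.add (hχ.mul (contMDiff_const.sub hτ))
  have hJ' : ∀ x, τ x + χ x * (s - τ x) ∈ J := fun x => by
    have h1 := hJc.add_smul_sub_mem (hτJ x) hs (hχr x)
    simpa using h1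
  have hin : ∀ x ∈ tsupport χ, ∀ t ∈ J, G (x, t) ∈ V := fun x hx t ht =>
    hUW (Set.mk_mem_prod (hχU hx) (hδW (hJ ht)))
  refine ⟨fun x => τ x + χ x * (s - τ x), hτ', hJ', ?_, fun x hx => by simp [hx], ?_⟩
  · intro x hx
    have hx1 : ∀ᶠ y in 𝓝 x, χ y = 1 := hx
    filter_upwards [hx1] with y hy
    rw [hy]
    ring
  · refine ⟨_, fun x hx => ⟨?_, extDerivAt_formPullback_sub_formPullback hβ (isClosed_tsupport χ)
      (fun y hy => ?_) (fun y hy => hβ' _ (hin y hy _ (hτJ y)))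
      (fun y hy => hβ' _ (hin y hy _ (hJ' y))) (contMDiffAt_graph_comp hG hτ hx)
      (contMDiffAt_graph_comp hG hτ' hx)⟩⟩
    · exact (SmoothFormAt.formPullback (contMDiffAt_graph_comp hG hτ hx) (hβ _)).sub
        (SmoothFormAt.formPullback (contMDiffAt_graph_comp hG hτ' hx) (hβ _))
    · simp only [image_eq_zero_of_notMem_tsupport hy, zero_mul, add_zero]

theorem eventually_pullbackCohomologous (hK : IsCompact K) (hα : ∀ x, SmoothFormAt α x)
    (hd : ∀ x, extDerivAt α x = 0)
    (hG : ∀ x ∈ K, ∀ t, ContMDiffAt ((𝓡 n).prod 𝓘(ℝ, ℝ)) (𝓡 n) ∞ G (x, t)) (t₀ : ℝ) :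
    ∀ᶠ s in 𝓝 t₀, PullbackCohomologous K α (fun y => G (y, t₀)) (fun y => G (y, s)) := by
  -- Successive time changes must keep all times in one convex set `J`, and must not undo the value
  -- `s` already reached.
  let S : Set X → Prop := fun A =>
    ∃ δ > 0, ∀ J ⊆ Metric.ball t₀ δ, Convex ℝ J → ∀ s ∈ J, ∀ τ : X → ℝ,
      ContMDiff (𝓡 n) 𝓘(ℝ, ℝ) ∞ τ → (∀ x, τ x ∈ J) →
      ∃ τ' : X → ℝ, ContMDiff (𝓡 n) 𝓘(ℝ, ℝ) ∞ τ' ∧ (∀ x, τ' x ∈ J) ∧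
        (∀ x ∈ A, ∀ᶠ y in 𝓝 x, τ' y = s) ∧ (∀ x, τ x = s → τ' x = s) ∧
        PullbackCohomologous K α (fun y => G (y, τ y)) (fun y => G (y, τ' y))
  have hS : S K := by
    refine hK.induction_on (p := S) ?_ ?_ ?_ ?_
    · exact ⟨1, one_pos, fun J _ _ s _ τ hτ hτJ => ⟨τ, hτ, hτJ, fun x hx => hx.elim,
        fun x hx => hx, .refl⟩⟩
    · rintro A B hAB ⟨δ, hδ, h⟩
      refine ⟨δ, hδ, fun J hJ hJc s hs τ hτ hτJ => ?_⟩
      obtain ⟨τ', h1, h2, h3, h4, h5⟩ := h J hJ hJc s hs τ hτ hτJ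
      exact ⟨τ', h1, h2, fun x hx => h3 x (hAB hx), h4, h5⟩
    · rintro A B ⟨δ, hδ, h⟩ ⟨δ', hδ', h'⟩
      refine ⟨min δ δ', lt_min hδ hδ', fun J hJ hJc s hs τ hτ hτJ => ?_⟩
      obtain ⟨τ₁, h1, h2, h3, h4, h5⟩ :=
        h J (hJ.trans (Metric.ball_subset_ball (min_le_left _ _))) hJc s hs τ hτ hτJ
      obtain ⟨τ₂, k1, k2, k3, k4, k5⟩ :=
        h' J (hJ.trans (Metric.ball_subset_ball (min_le_right _ _))) hJc s hs τ₁ h1 h2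
      refine ⟨τ₂, k1, k2, ?_, fun x hx => k4 x (h4 x hx), h5.trans k5⟩
      rintro x (hx | hx)
      · exact (h3 x hx).mono k4
      · exact k3 x hx
    · intro x hx
      obtain ⟨A, hA, h⟩ := exists_local_time_change hα hd hG t₀ hx
      exact ⟨A, nhdsWithin_le_nhds hA, h⟩
  obtain ⟨δ, hδ, h⟩ := hS
  filter_upwards [Metric.ball_mem_nhds t₀ hδ] with s hs
  obtain ⟨τ', -, -, h3, -, h5⟩ := h _ subset_rfl (convex_ball t₀ δ) s hs (fun _ => t₀)
    contMDiff_const fun _ => Metric.mem_ball_self hδ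
  refine h5.congr_right fun x hx => ?_
  filter_upwards [h3 x hx] with y hy
  rw [hy]

/-- Homotopy invariance of de Rham cohomology, along a compact set. -/
theorem pullbackCohomologous_of_homotopy (hK : IsCompact K) (hα : ∀ x, SmoothFormAt α x)
    (hd : ∀ x, extDerivAt α x = 0)
    (hG : ∀ x ∈ K, ∀ t, ContMDiffAt ((𝓡 n).prod 𝓘(ℝ, ℝ)) (𝓡 n) ∞ G (x, t)) (s t : ℝ) :
    PullbackCohomologous K α (fun y => G (y, s)) (fun y => G (y, t)) := by
  -- Cohomologous time slices form an equivalence relation in which each time is related to all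
  -- nearby ones, and `ℝ` is connected.
  refine PreconnectedSpace.induction₂' (fun s t =>
    PullbackCohomologous K α (fun y => G (y, s)) (fun y => G (y, t))) (fun t₀ => ?_) ?_ s t
  · filter_upwards [eventually_pullbackCohomologous hK hα hd hG t₀] with t ht using ⟨ht, ht.symm⟩
  · exact ⟨fun _ _ _ h h' => h.trans h'⟩

variable [SecondCountableTopology X]

/-- A contractible open set is contracted to a point by a homotopy that is smooth along a given
compact subset. -/
theorem exists_smooth_contraction {Ω : Set X} (hΩ : IsOpen Ω) [ContractibleSpace Ω]
    (hK : IsCompact K) (hKΩ : K ⊆ Ω) :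
    ∃ (G : X × ℝ → X) (p : X),
      (∀ x ∈ K, ∀ t, ContMDiffAt ((𝓡 n).prod 𝓘(ℝ, ℝ)) (𝓡 n) ∞ G (x, t)) ∧
      (∀ x ∈ Ω, G (x, 0) = x) ∧ ∀ x ∈ Ω, G (x, 1) = p := by
  have : LocallyCompactSpace X := ChartedSpace.locallyCompactSpace (EuclideanSpace ℝ (Fin n)) X
  obtain ⟨p, ⟨F⟩⟩ := id_nullhomotopic Ω
  classical
  -- The contraction is reparametrized to be stationary for `t ≤ 1/3` and `t ≥ 2/3`, where it is
  -- already smooth over `Ω`. Only the times in `[1/3, 2/3]` need smoothing, inside a window that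
  -- avoids `0` and `1`.
  let H : X × ℝ → X := fun z => if hz : z.1 ∈ Ω then
    (F (Set.projIcc 0 1 zero_le_one (3 * z.2 - 1), ⟨z.1, hz⟩) : X) else z.1
  have hH : ∀ z (hz : z.1 ∈ Ω), H z =
      (F (Set.projIcc 0 1 zero_le_one (3 * z.2 - 1), ⟨z.1, hz⟩) : X) := fun z hz => dif_pos hz
  have hH0 : ∀ z : X × ℝ, z.1 ∈ Ω → z.2 ≤ 1 / 3 → H z = z.1 := fun z hz ht => by
    rw [hH z hz, Set.projIcc_of_le_left _ (by linarith)]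
    exact congrArg Subtype.val (F.apply_zero _)
  have hH1 : ∀ z : X × ℝ, z.1 ∈ Ω → 2 / 3 ≤ z.2 → H z = p := fun z hz ht => by
    rw [hH z hz, Set.projIcc_of_right_le _ (by linarith)]
    exact congrArg Subtype.val (F.apply_one _)
  have hHc : ContinuousOn H (Ω ×ˢ Set.univ) := by
    rw [continuousOn_iff_continuous_domRestrict]
    have h1 : (Ω ×ˢ Set.univ).domRestrict H = fun z : (Ω ×ˢ Set.univ : Set (X × ℝ)) =>
        (F (Set.projIcc 0 1 zero_le_one (3 * z.1.2 - 1), ⟨z.1.1, z.2.1⟩) : X) :=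
      funext fun z => hH z.1 z.2.1
    rw [h1]
    refine continuous_subtype_val.comp (F.continuous.comp (Continuous.prodMk ?_ ?_))
    · exact continuous_projIcc.comp (by fun_prop)
    · exact Continuous.subtype_mk (by fun_prop) _
  have hO : IsOpen (Ω ×ˢ Set.Ioo (1 / 6 : ℝ) (5 / 6)) := hΩ.prod isOpen_Ioo
  obtain ⟨G, hG1, hG2, hG3⟩ := exists_smoothing (n := n) (I := (𝓡 n).prod 𝓘(ℝ, ℝ)) hO
    (hK.prod (isCompact_Icc (a := (1 / 3 : ℝ)) (b := 2 / 3)))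
    (Set.prod_mono hKΩ (Set.Icc_subset_Ioo (by norm_num) (by norm_num)))
    (hHc.mono (Set.prod_mono_right (Set.subset_univ _)))
  have hΩn : ∀ x ∈ Ω, ∀ t : ℝ, ∀ᶠ z : X × ℝ in 𝓝 (x, t), z.1 ∈ Ω := fun x hx t =>
    continuousAt_fst.eventually (hΩ.mem_nhds hx)
  refine ⟨G, p, fun x hx t => ?_, fun x hx => ?_, fun x hx => ?_⟩
  · rcases lt_or_ge t (1 / 3) with h1 | h1
    · refine hG3 _ (contMDiffAt_fst.congr_of_eventuallyEq ?_)
      filter_upwards [hΩn x (hKΩ hx) t, continuousAt_snd.eventually_lt_const h1] with z hz hz'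
        using hH0 z hz hz'.le
    · rcases lt_or_ge (2 / 3) t with h2 | h2
      · refine hG3 _ ((contMDiffAt_const (c := (p : X))).congr_of_eventuallyEq ?_)
        filter_upwards [hΩn x (hKΩ hx) t, continuousAt_snd.eventually_const_lt h2] with z hz hz'
          using hH1 z hz hz'.le
      · exact hG2 _ ⟨hx, h1, h2⟩
  · rw [hG1 _ (fun h => absurd h.2.1 (by norm_num)), hH0 _ hx (by norm_num)]
  · rw [hG1 _ (fun h => absurd h.2.2 (by norm_num)), hH1 _ hx (by norm_num)]

/-- Closed forms of positive degree are exact near a compact subset of a contractible open set. -/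
theorem exists_primitive_near_of_contractible {Ω : Set X} (hΩ : IsOpen Ω) [ContractibleSpace Ω]
    (hK : IsCompact K) (hKΩ : K ⊆ Ω) (hα : ∀ x, SmoothFormAt α x)
    (hd : ∀ x, extDerivAt α x = 0) :
    ∃ η : (x : X) → TangentSpace (𝓡 n) x [⋀^Fin k]→L[ℝ] ℝ, (∀ x, SmoothFormAt η x) ∧
      ∀ x ∈ K, ∀ᶠ y in 𝓝 x, extDerivAt η y = α y := by
  have : LocallyCompactSpace X := ChartedSpace.locallyCompactSpace (EuclideanSpace ℝ (Fin n)) X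
  obtain ⟨K₁, hK₁, hKK₁, hK₁Ω⟩ := exists_compact_between hK hΩ hKΩ
  obtain ⟨G, p, hG, hG0, hG1⟩ := exists_smooth_contraction (n := n) hΩ hK₁ hK₁Ω
  obtain ⟨κ, hκ⟩ := pullbackCohomologous_of_homotopy hK₁ hα hd hG 0 1
  have hκd : ∀ x ∈ K₁, extDerivAt κ x = α x := by
    intro x hx
    have h0 : (fun y => G (y, 0)) =ᶠ[𝓝 x] id := by
      filter_upwards [hΩ.mem_nhds (hK₁Ω hx)] with y hy using hG0 y hy
    have h1 : (fun y => G (y, 1)) =ᶠ[𝓝 x] fun _ => p := by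
      filter_upwards [hΩ.mem_nhds (hK₁Ω hx)] with y hy using hG1 y hy
    rw [(hκ x hx).2, formPullback_congr h0, formPullback_congr h1, formPullback_id]
    have h2 : formPullback (fun _ : X => p) α x = 0 := by
      unfold formPullback
      rw [mfderiv_const]
      ext v
      rw [ContinuousAlternatingMap.compContinuousLinearMap_apply]
      exact ContinuousAlternatingMap.map_coord_zero _ 0 rfl
    rw [h2, sub_zero]
  obtain ⟨K₂, hK₂, hKK₂, hK₂K₁⟩ := exists_compact_between hK isOpen_interior hKK₁
  -- The primitive `κ` is smooth only along `K₁`; a cutoff equal to `1` near `K` makes it smooth on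
  -- `X`.
  obtain ⟨χ, hχ1, hχ0, -⟩ := exists_contMDiffMap_one_nhds_of_subset_interior (n := ⊤) (𝓡 n)
    hK.isClosed hKK₂
  have hχs : tsupport χ ⊆ K₁ := by
    refine (closure_minimal (fun x hx => ?_) hK₂.isClosed).trans (hK₂K₁.trans interior_subset)
    by_contra h
    exact hx (hχ0 x h)
  refine ⟨fun x => χ x • κ x,
    SmoothFormAt.smul_of_tsupport_subset χ.contMDiff hχs fun x hx => (hκ x hx).1, fun x hx => ?_⟩
  filter_upwards [(hχ1.filter_mono (nhds_le_nhdsSet hx)).eventually_nhds,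
    mem_interior_iff_mem_nhds.1 (hKK₁ hx)] with y hy hyK
  rw [← hκd y hyK]
  refine extDerivAt_congr ?_
  filter_upwards [hy] with z hz
  rw [hz]
  exact one_smul ℝ (κ z)

end Contraction

/-! ### Cutting forms along the boundary and gluing. -/

section Gluing

variable {n k : ℕ} {X : Type*} [TopologicalSpace X]
  [ChartedSpace (EuclideanSpace ℝ (Fin n)) X]

theorem tangentSpaceOf_of_mem_interior {F : Set X} {x : X} (hx : x ∈ interior F) :
    tangentSpaceOf n F x = ⊤ := by
  have h : (chartAt (EuclideanSpace ℝ (Fin n)) x).target ∩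
      (chartAt (EuclideanSpace ℝ (Fin n)) x).symm ⁻¹' F ∈
        𝓝 (chartAt (EuclideanSpace ℝ (Fin n)) x x) := by
    refine Filter.inter_mem ((chartAt _ x).open_target.mem_nhds (mem_chart_target _ x)) ?_
    exact ((chartAt (EuclideanSpace ℝ (Fin n)) x).tendsto_symm (mem_chart_source _ x)).eventually
      (mem_interior_iff_mem_nhds.1 hx)
  rw [tangentSpaceOf, tangentConeAt_of_mem_nhds h]
  exact Submodule.span_univ

variable [IsManifold (𝓡 n) ∞ X]

/-- In the interior of the complement the tangent space is everything, so the form is zero there;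
boundary points follow by continuity. -/
theorem VanishesAlong.eq_zero {Ω : Set X} (hΩ : IsOpen Ω) (hb : HasSmoothBoundary n Ω)
    {α : (x : X) → TangentSpace (𝓡 n) x [⋀^Fin k]→L[ℝ] ℝ} (hα : ∀ x, SmoothFormAt α x)
    (hv : VanishesAlong Ωᶜ α) : ∀ x ∉ Ω, α x = 0 := by
  intro x hx
  refine (hα x).eq_zero_of_frequently
    ((frequently_mem_interior_compl hΩ hb hx).mono fun y hy => ?_)
  ext v
  exact hv y (interior_subset hy) v fun i => by
    rw [tangentSpaceOf_of_mem_interior hy]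
    trivial

open Classical in
/-- The form that is zero on `Ω` and `γ` off `Ω`. -/
noncomputable def exteriorPart (Ω : Set X) (γ : (x : X) → TangentSpace (𝓡 n) x [⋀^Fin k]→L[ℝ] ℝ)
    (x : X) : TangentSpace (𝓡 n) x [⋀^Fin k]→L[ℝ] ℝ :=
  if x ∈ Ω then 0 else γ x

variable {Ω : Set X} {γ : (x : X) → TangentSpace (𝓡 n) x [⋀^Fin k]→L[ℝ] ℝ}

theorem exteriorPart_of_notMem {x : X} (hx : x ∉ Ω) : exteriorPart Ω γ x = γ x := if_neg hx

theorem eventually_exteriorPart_of_mem (hΩ : IsOpen Ω) {x : X} (hx : x ∈ Ω) :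
    ∀ᶠ y in 𝓝 x, exteriorPart Ω γ y =
      (0 : (x : X) → TangentSpace (𝓡 n) x [⋀^Fin k]→L[ℝ] ℝ) y := by
  filter_upwards [hΩ.mem_nhds hx] with y hy using if_pos hy

theorem eventually_exteriorPart_of_mem_frontier
    (hγ : ∀ x ∈ frontier Ω, ∀ᶠ y in 𝓝 x, y ∉ Ω → γ y = 0) {x : X} (hx : x ∈ frontier Ω) :
    ∀ᶠ y in 𝓝 x, exteriorPart Ω γ y =
      (0 : (x : X) → TangentSpace (𝓡 n) x [⋀^Fin k]→L[ℝ] ℝ) y := by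
  filter_upwards [hγ x hx] with y hy
  by_cases hyΩ : y ∈ Ω
  · exact if_pos hyΩ
  · rw [exteriorPart_of_notMem hyΩ, hy hyΩ]
    rfl

theorem eventually_exteriorPart_of_notMem_closure {x : X} (hx : x ∉ closure Ω) :
    ∀ᶠ y in 𝓝 x, exteriorPart Ω γ y = γ y := by
  filter_upwards [isClosed_closure.isOpen_compl.mem_nhds hx] with y hy
    using exteriorPart_of_notMem fun h => hy (subset_closure h)

theorem mem_frontier_of_mem_closure (hΩ : IsOpen Ω) {x : X} (hx : x ∈ closure Ω) (hxΩ : x ∉ Ω) :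
    x ∈ frontier Ω := by
  rw [hΩ.frontier_eq]
  exact ⟨hx, hxΩ⟩

theorem smoothFormAt_exteriorPart (hΩ : IsOpen Ω) (hγ : ∀ x, SmoothFormAt γ x)
    (hγ0 : ∀ x ∈ frontier Ω, ∀ᶠ y in 𝓝 x, y ∉ Ω → γ y = 0) (x : X) :
    SmoothFormAt (exteriorPart Ω γ) x := by
  by_cases hxΩ : x ∈ Ω
  · exact smoothFormAt_zero.congr (eventually_exteriorPart_of_mem hΩ hxΩ)
  by_cases hxc : x ∈ closure Ω
  · exact smoothFormAt_zero.congr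
      (eventually_exteriorPart_of_mem_frontier hγ0 (mem_frontier_of_mem_closure hΩ hxc hxΩ))
  · exact (hγ x).congr (eventually_exteriorPart_of_notMem_closure hxc)

theorem extDerivAt_exteriorPart_of_mem (hΩ : IsOpen Ω) {x : X} (hx : x ∈ Ω) :
    extDerivAt (exteriorPart Ω γ) x = 0 := by
  rw [extDerivAt_congr (eventually_exteriorPart_of_mem hΩ hx), extDerivAt_zero]

theorem extDerivAt_exteriorPart_of_notMem (hΩ : IsOpen Ω) (hb : HasSmoothBoundary n Ω)
    (hγ : ∀ x, SmoothFormAt γ x) (hγ0 : ∀ x ∈ frontier Ω, ∀ᶠ y in 𝓝 x, y ∉ Ω → γ y = 0)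
    {x : X} (hx : x ∉ Ω) : extDerivAt (exteriorPart Ω γ) x = extDerivAt γ x := by
  by_cases hxc : x ∈ closure Ω
  · have hxf := mem_frontier_of_mem_closure hΩ hxc hx
    rw [extDerivAt_congr (eventually_exteriorPart_of_mem_frontier hγ0 hxf), extDerivAt_zero,
      (eventually_extDerivAt_eq_zero hΩ hb hγ (hγ0 x hxf)).self_of_nhds hx]
  · rw [extDerivAt_congr (eventually_exteriorPart_of_notMem_closure hxc)]

/-- When `H^{k+1}(F) = 0`, a smooth form whose differential vanishes along `F` is exact up to a
form that vanishes along `F`. -/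
theorem exists_primitive_along {F : Set X} [hF : Subsingleton (DeRham n F (k + 1))]
    {α : (x : X) → TangentSpace (𝓡 n) x [⋀^Fin (k + 1)]→L[ℝ] ℝ} (hα : ∀ x, SmoothFormAt α x)
    (hd : VanishesAlong F (extDerivAt α)) :
    ∃ β : (x : X) → TangentSpace (𝓡 n) x [⋀^Fin k]→L[ℝ] ℝ, (∀ x, SmoothFormAt β x) ∧
      VanishesAlong F (α - extDerivAt β) := by
  let a : SmoothForm n X (k + 1) := ⟨α, mem_smoothForm_iff.2 hα⟩
  have ha : a ∈ closedOn F (k + 1) := hd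
  have h1 : (Submodule.Quotient.mk ⟨a, ha⟩ : DeRham n F (k + 1)) = 0 := Subsingleton.elim _ _
  rw [Submodule.Quotient.mk_eq_zero] at h1
  obtain ⟨_, ⟨β, rfl⟩, μ, hμ, h2⟩ := Submodule.mem_sup.1 (show a ∈ exactOn F (k + 1) from h1)
  refine ⟨β.1, mem_smoothForm_iff.1 β.2, ?_⟩
  have h3 : α - extDerivAt β.1 = μ.1 := by
    have h4 : (extD n X k β).1 + μ.1 = α := congrArg Subtype.val h2
    rw [← h4]
    exact add_sub_cancel_left _ _
  rw [h3]
  exact hμ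

variable [T2Space X]

/-- A form that is closed off `Ω` is, off `Ω` and up to an exact form, the restriction of a closed
form on `X`. -/
theorem exists_closed_extension (hΩ : IsOpen Ω) (hb : HasSmoothBoundary n Ω)
    (hc : IsCompact (frontier Ω)) [Subsingleton (DeRham n (frontier Ω) (k + 1))]
    {α : (x : X) → TangentSpace (𝓡 n) x [⋀^Fin (k + 1)]→L[ℝ] ℝ} (hα : ∀ x, SmoothFormAt α x)
    (hd : ∀ x ∉ Ω, extDerivAt α x = 0) :
    ∃ (α' : (x : X) → TangentSpace (𝓡 n) x [⋀^Fin (k + 1)]→L[ℝ] ℝ)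
      (β : (x : X) → TangentSpace (𝓡 n) x [⋀^Fin k]→L[ℝ] ℝ), (∀ x, SmoothFormAt α' x) ∧
      (∀ x, SmoothFormAt β x) ∧ (∀ x, extDerivAt α' x = 0) ∧
      ∀ x ∉ Ω, α' x - α x = extDerivAt β x := by
  have hfr : ∀ x ∈ frontier Ω, x ∉ Ω := fun x hx => by
    rw [hΩ.frontier_eq] at hx
    exact hx.2
  obtain ⟨β, hβ, hv⟩ := exists_primitive_along (F := frontier Ω) hα fun x hx v _ => by
    rw [hd x (hfr x hx)]
    rfl
  have hdβ := smoothFormAt_extDerivAt hβ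
  have hμd : ∀ x ∉ Ω, extDerivAt (α - extDerivAt β) x = 0 := fun x hx => by
    rw [extDerivAt_sub (hα x) (hdβ x), hd x hx, extDerivAt_extDerivAt hβ, sub_zero]
  have hμs : ∀ x, SmoothFormAt (α - extDerivAt β) x := fun x => (hα x).sub (hdβ x)
  obtain ⟨κ, hκ, hκ'⟩ := exists_collar_primitive hΩ hb hc (N := Set.univ)
    (fun _ _ => Filter.univ_mem) hμs (fun x _ hx => hμd x hx) hv
  have hdκ := smoothFormAt_extDerivAt hκ
  have hγs : ∀ x, SmoothFormAt (α - extDerivAt β - extDerivAt κ) x := fun x =>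
    (hμs x).sub (hdκ x)
  have hγ0 : ∀ x ∈ frontier Ω, ∀ᶠ y in 𝓝 x, y ∉ Ω →
      (α - extDerivAt β - extDerivAt κ) y = 0 := fun x hx => by
    filter_upwards [hκ' x hx] with y hy hyΩ
    rw [Pi.sub_apply, hy hyΩ, sub_self]
  refine ⟨exteriorPart Ω (α - extDerivAt β - extDerivAt κ), -(β + κ),
    smoothFormAt_exteriorPart hΩ hγs hγ0, fun x => ((hβ x).add (hκ x)).neg, fun x => ?_,
    fun x hx => ?_⟩
  · by_cases hx : x ∈ Ω
    · exact extDerivAt_exteriorPart_of_mem hΩ hx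
    · rw [extDerivAt_exteriorPart_of_notMem hΩ hb hγs hγ0 hx, extDerivAt_sub (hμs x) (hdκ x),
        hμd x hx, extDerivAt_extDerivAt hκ, sub_zero]
  · rw [exteriorPart_of_notMem hx, extDerivAt_neg, extDerivAt_add (hβ x) (hκ x)]
    simp only [Pi.sub_apply]
    abel

variable [SecondCountableTopology X]

/-- Closed forms of positive degree are exact near the closure of a contractible domain. -/
theorem exists_primitive_near_closure (hΩ : IsOpen Ω) [ContractibleSpace Ω]
    (hb : HasSmoothBoundary n Ω) (hc : IsCompact (closure Ω))
    {ν : (x : X) → TangentSpace (𝓡 n) x [⋀^Fin (k + 1)]→L[ℝ] ℝ} (hν : ∀ x, SmoothFormAt ν x)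
    (hd : ∀ x, extDerivAt ν x = 0) :
    ∃ η : (x : X) → TangentSpace (𝓡 n) x [⋀^Fin k]→L[ℝ] ℝ, (∀ x, SmoothFormAt η x) ∧
      ∀ x ∈ closure Ω, ∀ᶠ y in 𝓝 x, extDerivAt η y = ν y := by
  obtain ⟨P, hP, hPΩ⟩ := exists_push (n := n) k hΩ hb
    (hc.of_isClosed_subset isClosed_frontier frontier_subset_closure)
  obtain ⟨κ, hκ, hκ'⟩ := hP.exists_primitive ν hν hd
  obtain ⟨η, hη, hη'⟩ := exists_primitive_near_of_contractible hΩ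
    (hc.image hP.contMDiff.continuous) (Set.image_subset_iff.2 hPΩ) hν hd
  have hPη : ∀ x, SmoothFormAt (formPullback P η) x := fun x =>
    SmoothFormAt.formPullback hP.contMDiff.contMDiffAt (hη _)
  refine ⟨κ + formPullback P η, fun x => (hκ x).add (hPη x), fun x hx => ?_⟩
  filter_upwards [hP.contMDiff.continuous.continuousAt.eventually
    (hη' (P x) (Set.mem_image_of_mem P hx))] with y hy
  have h1 : formPullback P (extDerivAt η) y = formPullback P ν y := by
    unfold formPullback
    rw [hy]
  rw [extDerivAt_add (hκ y) (hPη y), hκ', extDerivAt_formPullback hP.contMDiff.contMDiffAt (hη _),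
    h1, sub_add_cancel]

/-- A closed form that is zero off a contractible domain is exact. -/
theorem exists_primitive_of_eq_zero (hΩ : IsOpen Ω) [ContractibleSpace Ω]
    (hb : HasSmoothBoundary n Ω) (hc : IsCompact (closure Ω))
    [Subsingleton (DeRham n (frontier Ω) (k + 1))]
    {ν : (x : X) → TangentSpace (𝓡 n) x [⋀^Fin (k + 2)]→L[ℝ] ℝ} (hν : ∀ x, SmoothFormAt ν x)
    (hd : ∀ x, extDerivAt ν x = 0) (h0 : ∀ x ∉ Ω, ν x = 0) :
    ∃ η : (x : X) → TangentSpace (𝓡 n) x [⋀^Fin (k + 1)]→L[ℝ] ℝ, (∀ x, SmoothFormAt η x) ∧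
      ∀ x, extDerivAt η x = ν x := by
  have hfr : ∀ x ∈ frontier Ω, x ∉ Ω := fun x hx => by
    rw [hΩ.frontier_eq] at hx
    exact hx.2
  obtain ⟨η, hη, hη'⟩ := exists_primitive_near_closure hΩ hb hc hν hd
  obtain ⟨ξ, hξ, hv⟩ := exists_primitive_along (F := frontier Ω) hη fun x hx v _ => by
    rw [(hη' x (frontier_subset_closure hx)).self_of_nhds, h0 x (hfr x hx)]
    rfl
  have hdξ := smoothFormAt_extDerivAt hξ
  have hμs : ∀ x, SmoothFormAt (η - extDerivAt ξ) x := fun x => (hη x).sub (hdξ x)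
  have hμd : ∀ x, extDerivAt (η - extDerivAt ξ) x = extDerivAt η x := fun x => by
    rw [extDerivAt_sub (hη x) (hdξ x), extDerivAt_extDerivAt hξ, sub_zero]
  obtain ⟨κ, hκ, hκ'⟩ := exists_collar_primitive hΩ hb
    (hc.of_isClosed_subset isClosed_frontier frontier_subset_closure)
    -- `η` is a primitive of `ν` only near the closure, so the corrected form is closed off `Ω` only
    -- on this neighbourhood of the boundary.
    (N := {y | extDerivAt η y = ν y}) (fun x hx => hη' x (frontier_subset_closure hx)) hμs
    (fun x hxN hx => by rw [hμd, show extDerivAt η x = ν x from hxN, h0 x hx]) hv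
  have hdκ := smoothFormAt_extDerivAt hκ
  have hγs : ∀ x, SmoothFormAt (η - extDerivAt ξ - extDerivAt κ) x := fun x =>
    (hμs x).sub (hdκ x)
  have hγ0 : ∀ x ∈ frontier Ω, ∀ᶠ y in 𝓝 x, y ∉ Ω →
      (η - extDerivAt ξ - extDerivAt κ) y = 0 := fun x hx => by
    filter_upwards [hκ' x hx] with y hy hyΩ
    rw [Pi.sub_apply, hy hyΩ, sub_self]
  have hes := smoothFormAt_exteriorPart hΩ hγs hγ0
  -- The primitive is the corrected form minus its exterior part: unchanged on `Ω`, zero off `Ω`.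
  refine ⟨_, fun x => (hγs x).sub (hes x), fun x => ?_⟩
  rw [extDerivAt_sub (hγs x) (hes x)]
  by_cases hx : x ∈ Ω
  · rw [extDerivAt_exteriorPart_of_mem hΩ hx, sub_zero, extDerivAt_sub (hμs x) (hdκ x), hμd,
      extDerivAt_extDerivAt hκ, sub_zero, (hη' x (subset_closure hx)).self_of_nhds]
  · rw [extDerivAt_exteriorPart_of_notMem hΩ hb hγs hγ0 hx, sub_self, h0 x hx]

end Gluing

/-! ### The restriction map is bijective. -/

theorem propositionP1 {n : ℕ} {X : Type*} [TopologicalSpace X] [T2Space X]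
    [SecondCountableTopology X] [ChartedSpace (EuclideanSpace ℝ (Fin n)) X]
    [IsManifold (𝓡 n) ∞ X] (Ω : Set X) (hopen : IsOpen Ω) (hconn : IsConnected Ω)
    (hbdd : IsCompact (closure Ω)) (hbdry : HasSmoothBoundary n Ω)
    (hcoh : ∀ j : ℕ, 1 ≤ j → j + 2 ≤ n → Subsingleton (DeRham n (frontier Ω) j))
    (hcontr : ContractibleSpace Ω) :
    ∀ j : ℕ, 1 < j → j + 2 ≤ n → Function.Bijective (DeRham.restrict n Ωᶜ j) := by
  intro j hj hjn
  -- With `j ≥ 2`, the degree `j - 1 = k + 1` used for injectivity also lies in the range where the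
  -- cohomology of the boundary vanishes.
  obtain ⟨k, rfl⟩ : ∃ k, j = k + 2 := ⟨j - 2, by omega⟩
  have hcf : IsCompact (frontier Ω) :=
    hbdd.of_isClosed_subset isClosed_frontier frontier_subset_closure
  have h1 : Subsingleton (DeRham n (frontier Ω) (k + 1)) := hcoh _ (by omega) (by omega)
  have h2 : Subsingleton (DeRham n (frontier Ω) (k + 1 + 1)) := hcoh _ (by omega) hjn
  constructor
  · rw [injective_iff_map_eq_zero]
    intro a ha
    obtain ⟨⟨α, hα⟩, rfl⟩ := Submodule.Quotient.mk_surjective _ a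
    have h3 : α ∈ exactOn Ωᶜ (k + 2) :=
      (Submodule.Quotient.mk_eq_zero ((exactOn Ωᶜ (k + 2)).submoduleOf (closedOn Ωᶜ (k + 2)))).1 ha
    obtain ⟨_, ⟨β, rfl⟩, ν, hν, h4⟩ := Submodule.mem_sup.1 h3
    have hαd : extD n X (k + 2) α = 0 := by
      have h5 : extD n X (k + 2) α ∈ vanishingOn (Set.univ : Set X) (k + 2 + 1) := hα
      rwa [vanishingOn_univ, Submodule.mem_bot] at h5
    have hνd : extD n X (k + 2) ν = 0 := by
      rw [← h4, map_add, extD_extD, zero_add] at hαd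
      exact hαd
    have hνs := mem_smoothForm_iff.1 ν.2
    -- `ν = α - dβ` is closed on `X` and zero off `Ω`; a primitive `η` of it gives `α = d(β + η)`.
    obtain ⟨η, hη, hη'⟩ := exists_primitive_of_eq_zero hopen hbdry hbdd hνs
      (fun x => congrFun (congrArg Subtype.val hνd) x) (VanishesAlong.eq_zero hopen hbdry hνs hν)
    refine (Submodule.Quotient.mk_eq_zero _).2 ?_
    change α ∈ (extD n X (k + 1)).range ⊔ vanishingOn Set.univ (k + 2)
    refine Submodule.mem_sup_left ⟨β + ⟨η, mem_smoothForm_iff.2 hη⟩, ?_⟩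
    rw [map_add, ← h4]
    congr 1
    exact Subtype.ext (funext hη')
  · intro a
    obtain ⟨⟨α, hα⟩, rfl⟩ := Submodule.Quotient.mk_surjective _ a
    have hαs := mem_smoothForm_iff.1 α.2
    have hαd : ∀ x ∉ Ω, extDerivAt α.1 x = 0 :=
      VanishesAlong.eq_zero hopen hbdry (smoothFormAt_extDerivAt hαs) hα
    obtain ⟨α', β, hα', hβ, hd, h3⟩ := exists_closed_extension hopen hbdry hcf hαs hαd
    let a' : SmoothForm n X (k + 2) := ⟨α', mem_smoothForm_iff.2 hα'⟩
    let b : SmoothForm n X (k + 1) := ⟨β, mem_smoothForm_iff.2 hβ⟩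
    have ha' : a' ∈ closedOn (Set.univ : Set X) (k + 2) := fun x _ v _ => by
      change extDerivAt α' x v = 0
      rw [hd x]
      rfl
    refine ⟨Submodule.Quotient.mk ⟨a', ha'⟩, (Submodule.Quotient.eq _).2 ?_⟩
    change a' - α ∈ (extD n X (k + 1)).range ⊔ vanishingOn Ωᶜ (k + 2)
    refine Submodule.mem_sup.2 ⟨extD n X (k + 1) b, ⟨b, rfl⟩, a' - α - extD n X (k + 1) b,
      fun x hx v _ => ?_, add_sub_cancel _ _⟩
    change (α' x - α.1 x - extDerivAt β x) v = 0
    rw [h3 x hx, sub_self]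
    rfl
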